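/- Let $(\mathcal A,\varphi)$ be a non-commutative probability space, i.e. a unital C*-algebra (for instance a von Neumann algebra) with a state $\varphi$. The free cumulants $k_n\colon\mathcal A^n\to\mathbb C$ are defined by $\varphi(a_1\cdots a_n)=\sum_{\pi\in NC(n)}\prod_{V\in\pi}k_{|V|}[a_v: v\in V]$, $n\ge 1$, where $NC(n)$ is the set of non-crossing partitions of $\{1,\dots,n\}$; write $k_n(a)=k_n[a,\dots,a]$, and let $R_a(z)=\sum_{n\ge 0}k_{n+1}(a)z^n$ be the R-transform of $a$. The law of a self-adjoint $a$ is the compactly supported probability measure on $\mathbb R$ with moments $\varphi(a^n)$. For compactly supported probability measures $\mu,\nu$ on $\mathbb R$, $\mu\boxplus\nu$ is the law of $a+b$ where $a,b$ are free self-adjoint random variables with laws $\mu,\nu$; $\mu$ is freely infinitely divisible if for every $n\ge1$ there is a compactly supported probability measure $\mu_n$ with $\mu=\mu_n\boxplus\cdots\boxplus\mu_n$ ($n$ factors). Let $(\beta(t))_{0\le t\le 2\pi}$ be a free Brownian bridge in $\mathcal A$, i.e. a family of self-adjoint elements with $k_2[\beta(s),\beta(t)]=s\wedge t-\frac{st}{2\pi}$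 and $k_n[\beta(t_1),\dots,\beta(t_n)]=0$ for all $n\ne2$. Its Lévy area is $$\ell=\frac i2\int_0^{2\pi}\bigl(\beta(s)\,d\beta(s)-d\beta(s)\,\beta(s)\bigr),$$ the limit in norm of the Riemann sums $\frac i2\sum_k\bigl(\beta(t_k)(\beta(t_{k+1})-\beta(t_k))-(\beta(t_{k+1})-\beta(t_k))\beta(t_k)\bigr)$ over partitions of $[0,2\pi]$ as the mesh tends to $0$. If $\varphi$ is faithful, this limit exists. Whenever it exists (whether or not $\varphi$ is faithful), $\ell$ is self-adjoint and: 1. for $0<|z|<1$ the series $R_\ell(z)$ converges and $R_\ell(z)=\frac1z-\pi\cot(\pi z)$; 2. for $m\ge1$, $k_m(\ell)=2\zeta(m)$ if $m$ is even and $k_m(\ell)=0$ if $m$ is odd; 3. the law of $\ell$ is freely infinitely divisible. -/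

import Mathlib

open MeasureTheory

/-! ### Non-commutative probability spaces, laws and freeness -/

section FreeProbability

variable {A : Type*} [CStarAlgebra A]

open scoped ComplexOrder in
/-- A state on a unital C⋆-algebra: a positive linear functional that is `1` at the unit.
The pair `(A, φ)` is then a non-commutative (C⋆-)probability space. -/
structure IsState (φ : A →ₗ[ℂ] ℂ) : Prop where
  map_one : φ 1 = 1
  nonneg : ∀ a : A, 0 ≤ φ (star a * a)

/-- A linear functional is faithful if it vanishes on `a⋆a` only for `a = 0`. -/
def IsFaithful (φ : A →ₗ[ℂ] ℂ) : Prop :=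
  ∀ a : A, φ (star a * a) = 0 → a = 0

/-- A compactly supported Borel probability measure on the real line. -/
def IsCompactlySupportedProb (μ : Measure ℝ) : Prop :=
  IsProbabilityMeasure μ ∧ ∃ K : Set ℝ, IsCompact K ∧ μ Kᶜ = 0

/-- `μ` is the distribution of `a`: the compactly supported probability measure on `ℝ` whose
moments are the moments `φ (a ^ n)` of `a`. -/
def IsLaw (φ : A →ₗ[ℂ] ℂ) (a : A) (μ : Measure ℝ) : Prop :=
  IsCompactlySupportedProb μ ∧ ∀ n : ℕ, φ (a ^ n) = ((∫ t : ℝ, t ^ n ∂μ : ℝ) : ℂ)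

/-- Free independence of random variables: every non-empty product `x₁ ⋯ xₘ` of centred elements,
with `xⱼ` in the unital ⋆-algebra generated by `a (rⱼ)` and `rⱼ ≠ rⱼ₊₁`, is centred. -/
def AreFree {ι : Type*} (φ : A →ₗ[ℂ] ℂ) (a : ι → A) : Prop :=
  ∀ l : List (ι × A), l ≠ [] →
    (∀ p ∈ l, p.2 ∈ StarAlgebra.adjoin ℂ {a p.1} ∧ φ p.2 = 0) →
    l.IsChain (fun p q => p.1 ≠ q.1) →
    φ (l.map Prod.snd).prod = 0

/-! ### Free cumulants -/

/-- A partition of `{0, …, n-1}` is non-crossing if there are no two distinct blocks `V`, `W` and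
`x₁, y₁ ∈ V`, `x₂, y₂ ∈ W` with `x₁ < x₂ < y₁ < y₂`. -/
def IsNonCrossing {n : ℕ} (p : Finpartition (Finset.univ : Finset (Fin n))) : Prop :=
  ∀ V ∈ p.parts, ∀ W ∈ p.parts, V ≠ W →
    ∀ x₁ ∈ V, ∀ y₁ ∈ V, ∀ x₂ ∈ W, ∀ y₂ ∈ W, ¬ (x₁ < x₂ ∧ x₂ < y₁ ∧ y₁ < y₂)

open Classical in
/-- The finite set `NC(n)` of non-crossing partitions. -/
noncomputable def nonCrossingPartitions (n : ℕ) :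
    Finset (Finpartition (Finset.univ : Finset (Fin n))) :=
  Finset.univ.filter IsNonCrossing

open Classical in
/-- The free cumulants `kₙ[a₁, …, aₙ]`, obtained by solving the moment-cumulant relations
`φ(a₁ ⋯ aₙ) = ∑_{π ∈ NC(n)} ∏_{V ∈ π} k_{|V|}[a_v : v ∈ V]` recursively for the term of the
one-block partition; see `moment_eq_sum_freeCumulant`. -/
noncomputable def freeCumulant (φ : A →ₗ[ℂ] ℂ) (n : ℕ) (a : Fin n → A) : ℂ :=
  φ (List.ofFn a).prod -
    ∑ p ∈ ((nonCrossingPartitions n).filter (fun p => Finset.univ ∉ p.parts)).attach,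
      ∏ V ∈ p.1.parts.attach, freeCumulant φ V.1.card (fun i => a (V.1.orderEmbOfFin rfl i))
termination_by n
decreasing_by
  have hp := (Finset.mem_filter.mp p.2).2
  have hU : ∀ W ∈ p.1.parts, W ≠ Finset.univ := by
    rintro W hW rfl
    exact hp hW
  simpa using Finset.card_lt_card (Finset.ssubset_univ_iff.mpr (hU V.1 V.2))

/-- The one-block partition. -/
theorem existsUnique_univ_mem_parts {n : ℕ} (hn : 0 < n) :
    ∃ p ∈ nonCrossingPartitions n, p.parts = {Finset.univ} ∧
      ∀ q : Finpartition (Finset.univ : Finset (Fin n)), Finset.univ ∈ q.parts → q = p := by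
  have hne : (Finset.univ : Finset (Fin n)) ≠ ⊥ := by
    have : Nonempty (Fin n) := ⟨⟨0, hn⟩⟩
    exact Finset.univ_nonempty.ne_empty
  refine ⟨Finpartition.indiscrete hne, ?_, rfl, ?_⟩
  · simp only [nonCrossingPartitions, Finset.mem_filter, Finset.mem_univ, true_and]
    intro V hV W hW hVW
    simp only [Finpartition.indiscrete_parts, Finset.mem_singleton] at hV hW
    exact absurd (hV.trans hW.symm) hVW
  · intro q hq
    ext V
    simp only [Finpartition.indiscrete_parts, Finset.mem_singleton]
    constructor
    · intro hV
      by_contra hne'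
      have hd := q.disjoint hV hq hne'
      have hd' : Disjoint V Finset.univ := hd
      have hbot : V = ⊥ := hd'.eq_bot_of_le (Finset.subset_univ V)
      exact q.ne_bot hV hbot
    · rintro rfl
      exact hq

/-- The moment-cumulant relations. -/
theorem moment_eq_sum_freeCumulant (φ : A →ₗ[ℂ] ℂ) {n : ℕ} (hn : 0 < n) (a : Fin n → A) :
    φ (List.ofFn a).prod = ∑ p ∈ nonCrossingPartitions n, ∏ V ∈ p.parts,
      freeCumulant φ V.card (fun i => a (V.orderEmbOfFin rfl i)) := by
  classical
  obtain ⟨p₀, hp₀, hparts, huniq⟩ := existsUnique_univ_mem_parts hn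
  have hfull : ∀ (m : ℕ) (h : (Finset.univ : Finset (Fin n)).card = m),
      freeCumulant φ m (fun i => a ((Finset.univ : Finset (Fin n)).orderEmbOfFin h i)) =
        freeCumulant φ n a := by
    intro m h
    have hm : m = n := by simpa using h.symm
    subst hm
    congr 1
    funext i
    congr 1
    have := Finset.orderEmbOfFin_unique (s := (Finset.univ : Finset (Fin m))) h
      (f := id) (fun _ => Finset.mem_univ _) strictMono_id
    exact (congrFun this i).symm
  rw [← Finset.sum_filter_add_sum_filter_not (nonCrossingPartitions n)
    (fun p => Finset.univ ∉ p.parts)]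
  have h1 : (nonCrossingPartitions n).filter (fun p => ¬ Finset.univ ∉ p.parts) = {p₀} := by
    ext q
    simp only [not_not, Finset.mem_filter, Finset.mem_singleton]
    constructor
    · rintro ⟨-, hq⟩
      exact huniq q hq
    · rintro rfl
      exact ⟨hp₀, by simp [hparts]⟩
  rw [h1, Finset.sum_singleton, hparts, Finset.prod_singleton, hfull _ rfl]
  conv_rhs => rw [freeCumulant]
  have h2 : ∀ p : Finpartition (Finset.univ : Finset (Fin n)),
      ∏ V ∈ p.parts.attach, freeCumulant φ V.1.card (fun i => a (V.1.orderEmbOfFin rfl i)) =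
        ∏ V ∈ p.parts, freeCumulant φ V.card (fun i => a (V.orderEmbOfFin rfl i)) := fun p =>
    Finset.prod_attach _ (fun V : Finset (Fin n) =>
      freeCumulant φ V.card (fun i => a (V.orderEmbOfFin rfl i)))
  simp_rw [h2]
  have h3 := Finset.sum_attach
    ((nonCrossingPartitions n).filter (fun p => Finset.univ ∉ p.parts))
    (fun p => ∏ V ∈ p.parts, freeCumulant φ V.card (fun i => a (V.orderEmbOfFin rfl i)))
  rw [h3]
  ring

/-- The R-transform `R_a(z) = ∑ₙ k_{n+1}(a) zⁿ`, where `kₙ(a) = kₙ[a, …, a]`, as a formal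
power series. -/
noncomputable def rTransform (φ : A →ₗ[ℂ] ℂ) (a : A) : PowerSeries ℂ :=
  PowerSeries.mk fun n => freeCumulant φ (n + 1) (fun _ => a)

/-! ### Semicircular families and the free Brownian bridge -/

/-- `s` is a (centred) semicircular family with covariance `c`: it consists of self-adjoint
elements, its second order cumulants are given by `c`, and all its other cumulants vanish. -/
structure IsSemicircularFamily {ι : Type*} (φ : A →ₗ[ℂ] ℂ) (s : ι → A) (c : ι → ι → ℝ) :
    Prop where
  selfAdjoint : ∀ i, IsSelfAdjoint (s i)
  cumulant_two : ∀ i j, freeCumulant φ 2 ![s i, s j] = (c i j : ℂ)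
  cumulant_ne_two : ∀ n : ℕ, 0 < n → n ≠ 2 → ∀ j : Fin n → ι,
    freeCumulant φ n (fun p => s (j p)) = 0

/-- A free Brownian bridge on `[0, T]`: a centred semicircular process `(β t)`, `0 ≤ t ≤ T`, with
covariance `s ∧ t - s t / T`. Values of `β` outside `[0, T]` are irrelevant. -/
def IsFreeBrownianBridge (φ : A →ₗ[ℂ] ℂ) (T : ℝ) (β : ℝ → A) : Prop :=
  IsSemicircularFamily φ (fun t : Set.Icc (0 : ℝ) T => β t)
    (fun s t => min (s : ℝ) t - s * t / T)

/-- The Riemann sum `(i/2) ∑ₖ (β(tₖ)(β(tₖ₊₁) - β(tₖ)) - (β(tₖ₊₁) - β(tₖ))β(tₖ))`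
over the points `t₀, …, tₙ`. -/
noncomputable def levyAreaSum (β : ℝ → A) (n : ℕ) (t : ℕ → ℝ) : A :=
  (Complex.I / 2) • ∑ k ∈ Finset.range n,
    (β (t k) * (β (t (k + 1)) - β (t k)) - (β (t (k + 1)) - β (t k)) * β (t k))

/-- `ℓ` is the Lévy area `(i/2) ∫₀ᵀ (β(s) dβ(s) - dβ(s) β(s))` of the path `β` at time `T`, the
stochastic integral being the limit in norm of the Riemann sums over partitions
`0 = t₀ ≤ t₁ ≤ … ≤ tₙ = T` as the mesh tends to zero. -/
def IsLevyArea (β : ℝ → A) (T : ℝ) (ℓ : A) : Prop :=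
  ∀ ε > (0 : ℝ), ∃ δ > (0 : ℝ), ∀ (n : ℕ) (t : ℕ → ℝ), Monotone t → t 0 = 0 → t n = T →
    (∀ k < n, t (k + 1) - t k < δ) → ‖levyAreaSum β n t - ℓ‖ < ε

end FreeProbability

/-! ### Free convolution and free infinite divisibility -/

/-- `ρ = μ ⊞ ν`: there are free self-adjoint random variables `a`, `b` in some non-commutative
probability space with distributions `μ`, `ν` such that `a + b` has distribution `ρ`. -/
def IsFreeConv (μ ν ρ : Measure ℝ) : Prop :=
  ∃ (B : Type) (_ : CStarAlgebra B) (ψ : B →ₗ[ℂ] ℂ) (a b : B),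
    IsState ψ ∧ IsSelfAdjoint a ∧ IsSelfAdjoint b ∧ AreFree ψ ![a, b] ∧
      IsLaw ψ a μ ∧ IsLaw ψ b ν ∧ IsLaw ψ (a + b) ρ

/-- `ρ = μ ⊞ ⋯ ⊞ μ` with `n` factors; the empty free convolution is the unit mass at `0`. -/
def IsFreeConvPow (μ : Measure ℝ) : ℕ → Measure ℝ → Prop
  | 0, ρ => ρ = Measure.dirac 0
  | 1, ρ => ρ = μ
  | n + 2, ρ => ∃ σ : Measure ℝ, IsFreeConvPow μ (n + 1) σ ∧ IsFreeConv σ μ ρ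

/-- A compactly supported probability measure `μ` is freely infinitely divisible if for every
`n ≥ 1` there is a compactly supported probability measure whose `n`-fold free convolution with
itself is `μ`. -/
def IsFreelyInfinitelyDivisible (μ : Measure ℝ) : Prop :=
  IsCompactlySupportedProb μ ∧
    ∀ n : ℕ, 0 < n → ∃ ν : Measure ℝ, IsCompactlySupportedProb ν ∧ IsFreeConvPow ν n μ

/-! ### Sums over non-crossing partitions of finite sets of natural numbers -/

/-- `P` is a non-crossing partition of the finite set `s`. -/
structure IsNCPart (s : Finset ℕ) (P : Finset (Finset ℕ)) : Prop where
  nonempty : ∀ V ∈ P, V.Nonempty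
  subset : ∀ V ∈ P, V ⊆ s
  cover : ∀ x ∈ s, ∃ V ∈ P, x ∈ V
  disj : ∀ V ∈ P, ∀ W ∈ P, ∀ x ∈ V, x ∈ W → V = W
  nc : ∀ V ∈ P, ∀ W ∈ P, V ≠ W →
    ∀ x₁ ∈ V, ∀ y₁ ∈ V, ∀ x₂ ∈ W, ∀ y₂ ∈ W, ¬ (x₁ < x₂ ∧ x₂ < y₁ ∧ y₁ < y₂)

open Classical in
/-- The non-crossing partitions of a finite set of natural numbers. -/
noncomputable def ncParts (s : Finset ℕ) : Finset (Finset (Finset ℕ)) :=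
  s.powerset.powerset.filter (IsNCPart s)

theorem mem_ncParts {s : Finset ℕ} {P : Finset (Finset ℕ)} : P ∈ ncParts s ↔ IsNCPart s P := by
  classical
  simp only [ncParts, Finset.mem_filter, Finset.mem_powerset, and_iff_right_iff_imp]
  intro h V hV
  exact Finset.mem_powerset.mpr (h.subset V hV)

/-- `V` lies on one side of each point of `W`. -/
def Separates (W V : Finset ℕ) : Prop :=
  ∀ w ∈ W, (∀ v ∈ V, v < w) ∨ (∀ v ∈ V, w < v)

section Sums
variable {R : Type*} [CommRing R]

/-- The sum over the non-crossing partitions of `s` of the product of the weights of the blocks. -/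
noncomputable def ncSum (κ : Finset ℕ → R) (s : Finset ℕ) : R :=
  ∑ P ∈ ncParts s, ∏ V ∈ P, κ V

open Classical in
/-- As `ncSum`, for partitions all of whose blocks lie between consecutive points of `W`. -/
noncomputable def sepSum (κ : Finset ℕ → R) (W s : Finset ℕ) : R :=
  ∑ P ∈ (ncParts s).filter (fun P => ∀ V ∈ P, Separates W V), ∏ V ∈ P, κ V

theorem sepSum_empty (κ : Finset ℕ → R) (s : Finset ℕ) : sepSum κ ∅ s = ncSum κ s := by
  classical
  rw [sepSum, ncSum, Finset.filter_true_of_mem]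
  intro P _ V _ w hw
  simp at hw

theorem ncSum_empty (κ : Finset ℕ → R) : ncSum κ ∅ = 1 := by
  classical
  have : ncParts ∅ = {∅} := by
    ext P
    rw [mem_ncParts, Finset.mem_singleton]
    constructor
    · intro h
      by_contra hne
      obtain ⟨V, hV⟩ := Finset.nonempty_iff_ne_empty.mpr hne
      obtain ⟨x, hx⟩ := h.nonempty V hV
      simpa using h.subset V hV hx
    · rintro rfl
      constructor <;> simp
  simp [ncSum, this]

/-- Decomposition according to the block of the smallest element. -/
theorem ncSum_insert (κ : Finset ℕ → R) {a : ℕ} {s : Finset ℕ} (ha : ∀ x ∈ s, a < x) :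
    ncSum κ (insert a s) = ∑ W ∈ s.powerset, κ (insert a W) * sepSum κ W (s \ W) := by
  classical
  have has : a ∉ s := fun h => lt_irrefl _ (ha a h)
  simp_rw [sepSum, Finset.mul_sum]
  rw [Finset.sum_sigma', ncSum]
  symm
  have key : ∀ W Q, W ⊆ s → IsNCPart (s \ W) Q → insert a W ∉ Q := by
    intro W Q _ hQ h
    have := hQ.subset _ h (Finset.mem_insert_self a W)
    exact has (Finset.mem_sdiff.mp this).1
  refine Finset.sum_bij (fun x _ => insert (insert a x.1) x.2) ?_ ?_ ?_ ?_
  · rintro ⟨W, Q⟩ h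
    simp only [Finset.mem_sigma, Finset.mem_powerset, Finset.mem_filter, mem_ncParts] at h ⊢
    obtain ⟨hW, hQ, hsep⟩ := h
    have hcr : ∀ V ∈ Q, ∀ x ∈ V, a < x ∧ x ∈ s ∧ x ∉ W := by
      intro V hV x hx
      have := Finset.mem_sdiff.mp (hQ.subset V hV hx)
      exact ⟨ha x this.1, this⟩
    constructor
    · intro V hV
      rcases Finset.mem_insert.mp hV with rfl | hV
      · exact ⟨a, Finset.mem_insert_self _ _⟩
      · exact hQ.nonempty V hV
    · intro V hV
      rcases Finset.mem_insert.mp hV with rfl | hV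
      · exact Finset.insert_subset_insert a hW
      · exact fun x hx => Finset.mem_insert_of_mem (hcr V hV x hx).2.1
    · intro x hx
      by_cases hxW : x ∈ insert a W
      · exact ⟨_, Finset.mem_insert_self _ _, hxW⟩
      · have hxa : x ∈ s := by
          rcases Finset.mem_insert.mp hx with rfl | h
          · simp at hxW
          · exact h
        obtain ⟨V, hV, hxV⟩ := hQ.cover x (Finset.mem_sdiff.mpr
          ⟨hxa, fun h => hxW (Finset.mem_insert_of_mem h)⟩)
        exact ⟨V, Finset.mem_insert_of_mem hV, hxV⟩
    · intro V hV V' hV' x hx hx'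
      rcases Finset.mem_insert.mp hV with rfl | hV <;>
        rcases Finset.mem_insert.mp hV' with rfl | hV'
      · rfl
      · have := hcr _ hV' x hx'
        rcases Finset.mem_insert.mp hx with rfl | h
        · omega
        · exact absurd h this.2.2
      · have := hcr _ hV x hx
        rcases Finset.mem_insert.mp hx' with rfl | h
        · omega
        · exact absurd h this.2.2
      · exact hQ.disj V hV V' hV' x hx hx'
    · rintro V hV V' hV' hne x₁ hx₁ y₁ hy₁ x₂ hx₂ y₂ hy₂ ⟨h1, h2, h3⟩
      rcases Finset.mem_insert.mp hV with rfl | hV <;>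
        rcases Finset.mem_insert.mp hV' with rfl | hV'
      · exact hne rfl
      · have hx := hcr _ hV' x₂ hx₂
        rcases Finset.mem_insert.mp hy₁ with rfl | h
        · omega
        · rcases hsep V' hV' y₁ h with h' | h'
          · have := h' y₂ hy₂
            omega
          · have := h' x₂ hx₂
            omega
      · have hx := hcr _ hV x₁ hx₁
        rcases Finset.mem_insert.mp hx₂ with rfl | h
        · omega
        · rcases hsep V hV x₂ h with h' | h'
          · have := h' y₁ hy₁
            omega
          · have := h' x₁ hx₁
            omega
      · exact hQ.nc V hV V' hV' hne x₁ hx₁ y₁ hy₁ x₂ hx₂ y₂ hy₂ ⟨h1, h2, h3⟩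
  · rintro ⟨W, Q⟩ h ⟨W', Q'⟩ h' heq
    simp only [Finset.mem_sigma, Finset.mem_powerset, Finset.mem_filter, mem_ncParts] at h h' heq
    have hWW : insert a W = insert a W' := by
      have h1 : insert a W ∈ insert (insert a W') Q' := heq ▸ Finset.mem_insert_self _ _
      rcases Finset.mem_insert.mp h1 with h1 | h1
      · exact h1
      · have := h'.2.1.subset _ h1 (Finset.mem_insert_self a W)
        exact absurd (Finset.mem_sdiff.mp this).1 has
    have hW : W = W' := by
      rw [← Finset.erase_insert (fun h1 => has (h.1 h1)), hWW,
        Finset.erase_insert (fun h1 => has (h'.1 h1))]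
    subst hW
    have hQ : Q = Q' := by
      rw [← Finset.erase_insert (key W Q h.1 h.2.1), heq, Finset.erase_insert (key W Q' h.1 h'.2.1)]
    rw [hQ]
  · intro P hP
    rw [mem_ncParts] at hP
    obtain ⟨B, hB, haB⟩ := hP.cover a (Finset.mem_insert_self _ _)
    have hBa : insert a (B.erase a) = B := Finset.insert_erase haB
    have hother : ∀ V ∈ P.erase B, ∀ x ∈ V, x ∈ s ∧ x ∉ B := by
      intro V hV x hx
      obtain ⟨hne, hV⟩ := Finset.mem_erase.mp hV
      have hxB : x ∉ B := fun h => hne (hP.disj V hV B hB x hx h)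
      rcases Finset.mem_insert.mp (hP.subset V hV hx) with rfl | h
      · exact absurd haB hxB
      · exact ⟨h, hxB⟩
    refine ⟨⟨B.erase a, P.erase B⟩, ?_, ?_⟩
    · simp only [Finset.mem_sigma, Finset.mem_powerset, Finset.mem_filter, mem_ncParts]
      refine ⟨?_, ?_, ?_⟩
      · intro x hx
        obtain ⟨h1, h2⟩ := Finset.mem_erase.mp hx
        exact (Finset.mem_insert.mp (hP.subset B hB h2)).resolve_left h1
      · constructor
        · exact fun V hV => hP.nonempty V (Finset.mem_of_mem_erase hV)
        · intro V hV x hx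
          have := hother V hV x hx
          exact Finset.mem_sdiff.mpr ⟨this.1, fun h => this.2 (Finset.mem_of_mem_erase h)⟩
        · intro x hx
          obtain ⟨h1, h2⟩ := Finset.mem_sdiff.mp hx
          obtain ⟨V, hV, hxV⟩ := hP.cover x (Finset.mem_insert_of_mem h1)
          refine ⟨V, Finset.mem_erase.mpr ⟨?_, hV⟩, hxV⟩
          rintro rfl
          exact h2 (Finset.mem_erase.mpr ⟨(ha x h1).ne', hxV⟩)
        · exact fun V hV W hW => hP.disj V (Finset.mem_of_mem_erase hV) W
            (Finset.mem_of_mem_erase hW)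
        · exact fun V hV W hW => hP.nc V (Finset.mem_of_mem_erase hV) W
            (Finset.mem_of_mem_erase hW)
      · intro V hV w hw
        by_contra hcon
        push Not at hcon
        obtain ⟨⟨v₁, hv₁, h1⟩, v₂, hv₂, h2⟩ := hcon
        obtain ⟨hne, hV'⟩ := Finset.mem_erase.mp hV
        have hwB := Finset.mem_of_mem_erase hw
        have e1 : w ≠ v₁ := fun h => (hother V hV v₁ hv₁).2 (h ▸ hwB)
        have e2 : w ≠ v₂ := fun h => (hother V hV v₂ hv₂).2 (h ▸ hwB)
        exact hP.nc B hB V hV' (Ne.symm hne) a haB w hwB v₂ hv₂ v₁ hv₁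
          ⟨ha v₂ (hother V hV v₂ hv₂).1, by omega, by omega⟩
    · simp only [hBa]
      exact Finset.insert_erase hB
  · rintro ⟨W, Q⟩ h
    simp only [Finset.mem_sigma, Finset.mem_powerset, Finset.mem_filter, mem_ncParts] at h
    rw [Finset.prod_insert (key W Q h.1 h.2.1)]

/-- Decomposition at a separating point. -/
theorem sepSum_insert (κ : Finset ℕ → R) {w : ℕ} {W t : Finset ℕ} (hw : ∀ x ∈ W, w < x)
    (hwt : w ∉ t) :
    sepSum κ (insert w W) t = ncSum κ (t.filter (· < w)) * sepSum κ W (t.filter (w < ·)) := by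
  classical
  rw [ncSum, sepSum, sepSum, Finset.sum_mul_sum, ← Finset.sum_product']
  symm
  have hdisj : ∀ P Q, IsNCPart (t.filter (· < w)) P → IsNCPart (t.filter (w < ·)) Q →
      Disjoint P Q := by
    intro P Q hP hQ
    rw [Finset.disjoint_left]
    intro V hV hV'
    obtain ⟨x, hx⟩ := hP.nonempty V hV
    have h1 := (Finset.mem_filter.mp (hP.subset V hV hx)).2
    have h2 := (Finset.mem_filter.mp (hQ.subset V hV' hx)).2
    omega
  have hfilt : ∀ P Q, IsNCPart (t.filter (· < w)) P → IsNCPart (t.filter (w < ·)) Q →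
      (P ∪ Q).filter (fun V => ∀ v ∈ V, v < w) = P ∧
      (P ∪ Q).filter (fun V => ∀ v ∈ V, w < v) = Q := by
    intro P Q hP hQ
    constructor
    · ext V
      simp only [Finset.mem_filter, Finset.mem_union]
      constructor
      · rintro ⟨h | h, h'⟩
        · exact h
        · obtain ⟨x, hx⟩ := hQ.nonempty V h
          have h1 := (Finset.mem_filter.mp (hQ.subset V h hx)).2
          have h2 := h' x hx
          omega
      · exact fun h => ⟨Or.inl h, fun x hx => (Finset.mem_filter.mp (hP.subset V h hx)).2⟩
    · ext V
      simp only [Finset.mem_filter, Finset.mem_union]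
      constructor
      · rintro ⟨h | h, h'⟩
        · obtain ⟨x, hx⟩ := hP.nonempty V h
          have h1 := (Finset.mem_filter.mp (hP.subset V h hx)).2
          have h2 := h' x hx
          omega
        · exact h
      · exact fun h => ⟨Or.inr h, fun x hx => (Finset.mem_filter.mp (hQ.subset V h hx)).2⟩
  refine Finset.sum_bij (fun x _ => x.1 ∪ x.2) ?_ ?_ ?_ ?_
  · rintro ⟨P, Q⟩ h
    simp only [Finset.mem_product, Finset.mem_filter, mem_ncParts] at h ⊢
    obtain ⟨hP, hQ, hsep⟩ := h
    have h1 : ∀ V ∈ P, ∀ x ∈ V, x ∈ t ∧ x < w := fun V hV x hx =>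
      Finset.mem_filter.mp (hP.subset V hV hx)
    have h2 : ∀ V ∈ Q, ∀ x ∈ V, x ∈ t ∧ w < x := fun V hV x hx =>
      Finset.mem_filter.mp (hQ.subset V hV hx)
    refine ⟨⟨?_, ?_, ?_, ?_, ?_⟩, ?_⟩
    · intro V hV
      exact (Finset.mem_union.mp hV).elim (hP.nonempty V) (hQ.nonempty V)
    · intro V hV x hx
      exact (Finset.mem_union.mp hV).elim (fun h => (h1 V h x hx).1) (fun h => (h2 V h x hx).1)
    · intro x hx
      rcases lt_trichotomy x w with h | h | h
      · obtain ⟨V, hV, hxV⟩ := hP.cover x (Finset.mem_filter.mpr ⟨hx, h⟩)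
        exact ⟨V, Finset.mem_union_left _ hV, hxV⟩
      · exact absurd (h ▸ hx) hwt
      · obtain ⟨V, hV, hxV⟩ := hQ.cover x (Finset.mem_filter.mpr ⟨hx, h⟩)
        exact ⟨V, Finset.mem_union_right _ hV, hxV⟩
    · intro V hV V' hV' x hx hx'
      rcases Finset.mem_union.mp hV with hV | hV <;> rcases Finset.mem_union.mp hV' with hV' | hV'
      · exact hP.disj V hV V' hV' x hx hx'
      · have := (h1 V hV x hx).2
        have := (h2 V' hV' x hx').2
        omega
      · have := (h2 V hV x hx).2
        have := (h1 V' hV' x hx').2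
        omega
      · exact hQ.disj V hV V' hV' x hx hx'
    · rintro V hV V' hV' hne x₁ hx₁ y₁ hy₁ x₂ hx₂ y₂ hy₂ ⟨k1, k2, k3⟩
      rcases Finset.mem_union.mp hV with hV | hV <;> rcases Finset.mem_union.mp hV' with hV' | hV'
      · exact hP.nc V hV V' hV' hne x₁ hx₁ y₁ hy₁ x₂ hx₂ y₂ hy₂ ⟨k1, k2, k3⟩
      · have := (h1 V hV y₁ hy₁).2
        have := (h2 V' hV' x₂ hx₂).2
        omega
      · have := (h2 V hV y₁ hy₁).2
        have := (h1 V' hV' y₂ hy₂).2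
        omega
      · exact hQ.nc V hV V' hV' hne x₁ hx₁ y₁ hy₁ x₂ hx₂ y₂ hy₂ ⟨k1, k2, k3⟩
    · intro V hV u hu
      rcases Finset.mem_insert.mp hu with rfl | hu
      · exact (Finset.mem_union.mp hV).imp (fun h x hx => (h1 V h x hx).2)
          (fun h x hx => (h2 V h x hx).2)
      · rcases Finset.mem_union.mp hV with hV | hV
        · exact Or.inl fun x hx => (h1 V hV x hx).2.trans (hw u hu)
        · exact hsep V hV u hu
  · rintro ⟨P, Q⟩ h ⟨P', Q'⟩ h' heq
    simp only [Finset.mem_product, Finset.mem_filter, mem_ncParts] at h h' heq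
    have e1 := hfilt P Q h.1 h.2.1
    have e2 := hfilt P' Q' h'.1 h'.2.1
    rw [heq, e2.1, e2.2] at e1
    rw [e1.1, e1.2]
  · intro P hP
    simp only [Finset.mem_filter, mem_ncParts] at hP
    obtain ⟨hP, hsep⟩ := hP
    have hside : ∀ V ∈ P, (∀ v ∈ V, v < w) ∨ (∀ v ∈ V, w < v) := fun V hV =>
      hsep V hV w (Finset.mem_insert_self _ _)
    refine ⟨⟨P.filter (fun V => ∀ v ∈ V, v < w), P.filter (fun V => ∀ v ∈ V, w < v)⟩, ?_, ?_⟩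
    · simp only [Finset.mem_product, Finset.mem_filter, mem_ncParts]
      refine ⟨?_, ?_, ?_⟩
      · constructor
        · exact fun V hV => hP.nonempty V (Finset.mem_filter.mp hV).1
        · intro V hV x hx
          obtain ⟨h1, h2⟩ := Finset.mem_filter.mp hV
          exact Finset.mem_filter.mpr ⟨hP.subset V h1 hx, h2 x hx⟩
        · intro x hx
          obtain ⟨h1, h2⟩ := Finset.mem_filter.mp hx
          obtain ⟨V, hV, hxV⟩ := hP.cover x h1
          refine ⟨V, Finset.mem_filter.mpr ⟨hV, (hside V hV).resolve_right ?_⟩, hxV⟩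
          intro h
          have := h x hxV
          omega
        · exact fun V hV W hW => hP.disj V (Finset.mem_filter.mp hV).1 W (Finset.mem_filter.mp hW).1
        · exact fun V hV W hW => hP.nc V (Finset.mem_filter.mp hV).1 W (Finset.mem_filter.mp hW).1
      · constructor
        · exact fun V hV => hP.nonempty V (Finset.mem_filter.mp hV).1
        · intro V hV x hx
          obtain ⟨h1, h2⟩ := Finset.mem_filter.mp hV
          exact Finset.mem_filter.mpr ⟨hP.subset V h1 hx, h2 x hx⟩
        · intro x hx
          obtain ⟨h1, h2⟩ := Finset.mem_filter.mp hx
          obtain ⟨V, hV, hxV⟩ := hP.cover x h1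
          refine ⟨V, Finset.mem_filter.mpr ⟨hV, (hside V hV).resolve_left ?_⟩, hxV⟩
          intro h
          have := h x hxV
          omega
        · exact fun V hV W hW => hP.disj V (Finset.mem_filter.mp hV).1 W (Finset.mem_filter.mp hW).1
        · exact fun V hV W hW => hP.nc V (Finset.mem_filter.mp hV).1 W (Finset.mem_filter.mp hW).1
      · intro V hV u hu
        exact hsep V hV.1 u (Finset.mem_insert_of_mem hu)
    · simp only
      rw [← Finset.filter_or]
      exact Finset.filter_true_of_mem hside
  · rintro ⟨P, Q⟩ h
    simp only [Finset.mem_product, Finset.mem_filter, mem_ncParts] at h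
    exact (Finset.prod_union (hdisj P Q h.1 h.2.1)).symm

end Sums

theorem sum_nonCrossingPartitions {R : Type*} [CommRing R] (F : Finset ℕ → R) {n : ℕ}
    (s : Finset ℕ) (h : s.card = n) :
    ∑ p ∈ nonCrossingPartitions n, ∏ V ∈ p.parts, F (V.map (s.orderEmbOfFin h).toEmbedding) =
      ncSum F s := by
  classical
  set e := s.orderEmbOfFin h with he
  have hes : ∀ i, e i ∈ s := fun i => Finset.orderEmbOfFin_mem s h i
  have hsurj : ∀ x ∈ s, ∃ i, e i = x := by
    intro x hx
    have : x ∈ Set.range e := by rw [Finset.range_orderEmbOfFin]; exact hx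
    exact this
  rw [ncSum]
  refine Finset.sum_bij (fun p _ => p.parts.map (Finset.mapEmbedding e.toEmbedding).toEmbedding)
    ?_ ?_ ?_ ?_
  · intro p hp
    rw [mem_ncParts]
    have hp' : IsNonCrossing p := (Finset.mem_filter.mp hp).2
    have hm : ∀ V, V ∈ p.parts.map (Finset.mapEmbedding e.toEmbedding).toEmbedding →
        ∃ U ∈ p.parts, U.map e.toEmbedding = V := fun V hV => Finset.mem_map.mp hV
    constructor
    · intro V hV
      obtain ⟨U, hU, rfl⟩ := hm V hV
      exact (p.nonempty_of_mem_parts hU).map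
    · intro V hV x hx
      obtain ⟨U, hU, rfl⟩ := hm V hV
      obtain ⟨i, _, rfl⟩ := Finset.mem_map.mp hx
      exact hes i
    · intro x hx
      obtain ⟨i, rfl⟩ := hsurj x hx
      obtain ⟨U, hU, hi⟩ := p.exists_mem (Finset.mem_univ i)
      exact ⟨_, Finset.mem_map_of_mem _ hU, Finset.mem_map_of_mem e.toEmbedding hi⟩
    · intro V hV W hW x hx hx'
      obtain ⟨U, hU, rfl⟩ := hm V hV
      obtain ⟨U', hU', rfl⟩ := hm W hW
      obtain ⟨i, hi, rfl⟩ := Finset.mem_map.mp hx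
      obtain ⟨j, hj, hij⟩ := Finset.mem_map.mp hx'
      have hij' : j = i := e.injective hij
      rw [p.eq_of_mem_parts hU hU' hi (hij' ▸ hj)]
    · intro V hV W hW hne x₁ hx₁ y₁ hy₁ x₂ hx₂ y₂ hy₂
      obtain ⟨U, hU, rfl⟩ := hm V hV
      obtain ⟨U', hU', rfl⟩ := hm W hW
      obtain ⟨i₁, hi₁, rfl⟩ := Finset.mem_map.mp hx₁
      obtain ⟨j₁, hj₁, rfl⟩ := Finset.mem_map.mp hy₁
      obtain ⟨i₂, hi₂, rfl⟩ := Finset.mem_map.mp hx₂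
      obtain ⟨j₂, hj₂, rfl⟩ := Finset.mem_map.mp hy₂
      have := hp' U hU U' hU' (fun h => hne (h ▸ rfl)) i₁ hi₁ j₁ hj₁ i₂ hi₂ j₂ hj₂
      simpa using this
  · intro p _ q _ hpq
    exact Finpartition.ext (Finset.map_injective _ hpq)
  · intro P hP
    rw [mem_ncParts] at hP
    have hU : ∀ V ∈ P, ∃ U : Finset (Fin n), U.map e.toEmbedding = V := by
      intro V hV
      refine ⟨Finset.univ.filter (fun i => e i ∈ V), ?_⟩
      ext x
      simp only [Finset.mem_map, Finset.mem_filter, Finset.mem_univ, true_and]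
      constructor
      · rintro ⟨i, hi, rfl⟩
        exact hi
      · intro hx
        obtain ⟨i, rfl⟩ := hsurj x (hP.subset V hV hx)
        exact ⟨i, hx, rfl⟩
    let Q : Finset (Finset (Fin n)) := Finset.univ.filter (fun U => U.map e.toEmbedding ∈ P)
    have hQ : ∀ U, U ∈ Q ↔ U.map e.toEmbedding ∈ P := by
      intro U
      simp [Q]
    let p : Finpartition (Finset.univ : Finset (Fin n)) :=
      Finpartition.ofExistsUnique Q (fun U _ => Finset.subset_univ U)
        (by
          intro i _
          obtain ⟨V, hV, hi⟩ := hP.cover (e i) (hes i)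
          obtain ⟨U, rfl⟩ := hU V hV
          refine ⟨U, ⟨(hQ U).mpr hV, ?_⟩, ?_⟩
          · simpa using hi
          · rintro U' ⟨hU', hi'⟩
            have := hP.disj _ ((hQ U').mp hU') _ hV (e i)
              (Finset.mem_map_of_mem e.toEmbedding hi') hi
            exact Finset.map_injective _ this)
        (by
          intro h0
          have := hP.nonempty _ ((hQ ∅).mp h0)
          simp at this)
    have hp : p.parts = Q := rfl
    refine ⟨p, ?_, ?_⟩
    · simp only [nonCrossingPartitions, Finset.mem_filter, Finset.mem_univ, true_and]
      intro V hV W hW hne x₁ hx₁ y₁ hy₁ x₂ hx₂ y₂ hy₂ hlt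
      rw [hp, hQ] at hV hW
      refine hP.nc _ hV _ hW (fun h => hne (Finset.map_injective _ h))
        (e x₁) (Finset.mem_map_of_mem e.toEmbedding hx₁)
        (e y₁) (Finset.mem_map_of_mem e.toEmbedding hy₁)
        (e x₂) (Finset.mem_map_of_mem e.toEmbedding hx₂)
        (e y₂) (Finset.mem_map_of_mem e.toEmbedding hy₂) ?_
      simpa using hlt
    · ext V
      rw [Finset.mem_map, hp]
      constructor
      · rintro ⟨U, hU, rfl⟩
        exact (hQ U).mp hU
      · intro hV
        obtain ⟨U, rfl⟩ := hU V hV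
        exact ⟨U, (hQ U).mpr hV, rfl⟩
  · intro p _
    rw [Finset.prod_map]
    rfl

section Moments
variable {A : Type*} [CStarAlgebra A]

theorem freeCumulant_orderEmbOfFin_congr (φ : A →ₗ[ℂ] ℂ) (x : ℕ → A) (V : Finset ℕ) {m : ℕ}
    (h : V.card = m) :
    freeCumulant φ V.card (fun i => x (V.orderEmbOfFin rfl i)) =
      freeCumulant φ m (fun i => x (V.orderEmbOfFin h i)) := by
  subst h
  rfl

/-- The moment-cumulant relations for a subset of the indices. -/
theorem moment_sort_eq_ncSum {φ : A →ₗ[ℂ] ℂ} (hφ : IsState φ) (x : ℕ → A) (s : Finset ℕ) :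
    φ ((s.sort (· ≤ ·)).map x).prod =
      ncSum (fun V => freeCumulant φ V.card (fun i => x (V.orderEmbOfFin rfl i))) s := by
  rcases s.eq_empty_or_nonempty with rfl | hs
  · simp [ncSum_empty, hφ.map_one]
  · rw [← sum_nonCrossingPartitions _ s rfl, ← Finset.listMap_orderEmbOfFin_finRange s rfl,
      List.map_map, ← List.ofFn_eq_map, moment_eq_sum_freeCumulant φ (Finset.card_pos.mpr hs)]
    refine Finset.sum_congr rfl fun p _ => Finset.prod_congr rfl fun V _ => ?_
    rw [freeCumulant_orderEmbOfFin_congr φ x _ (Finset.card_map _)]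
    congr 1
    funext i
    simp only [Function.comp]
    congr 1
    have := Finset.orderEmbOfFin_unique' (s := V.map (s.orderEmbOfFin rfl).toEmbedding)
      (Finset.card_map _) (f := (V.orderEmbOfFin rfl).trans (s.orderEmbOfFin rfl))
      (fun j => Finset.mem_map_of_mem _ (Finset.orderEmbOfFin_mem _ _ _))
    rw [← this]
    rfl

end Moments

section OneVariable
variable {R : Type*} [CommRing R]

open Finset in
theorem sum_powersetCard_succ_Ico {M : Type*} [AddCommMonoid M] (f : Finset ℕ → M) (j n b : ℕ) :
    ∑ W ∈ powersetCard (j + 1) (Ico b (b + n)), f W =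
      ∑ x ∈ range n, ∑ W ∈ powersetCard j (Ico (b + x + 1) (b + n)), f (insert (b + x) W) := by
  induction n generalizing b with
  | zero => rw [add_zero, Ico_self, powersetCard_eq_empty.mpr (by simp)]; simp
  | succ n ih =>
    have hIco : Ico b (b + (n + 1)) = insert b (Ico (b + 1) (b + 1 + n)) := by
      ext x
      simp only [mem_Ico, mem_insert]
      omega
    have hb : b ∉ Ico (b + 1) (b + 1 + n) := by simp
    have hsub : ∀ W ∈ powersetCard j (Ico (b + 1) (b + 1 + n)), b ∉ W := fun W hW h =>
      hb ((mem_powersetCard.mp hW).1 h)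
    rw [hIco, powersetCard_succ_insert hb, sum_union, sum_image, ih, sum_range_succ', add_comm]
    · have e : b + 1 + n = b + (n + 1) := by omega
      simp only [e, add_zero]
      rw [add_comm]
      congr 1
      refine sum_congr rfl fun x _ => ?_
      rw [show b + 1 + x = b + (x + 1) by omega]
    · intro W hW W' hW' h
      rw [← erase_insert (hsub W hW), h, erase_insert (hsub W' hW')]
    · rw [disjoint_left]
      intro W hW hW'
      obtain ⟨U, _, rfl⟩ := mem_image.mp hW'
      exact hb ((mem_powersetCard.mp hW).1 (mem_insert_self b U))

open PowerSeries in
theorem sum_sepSum_eq_coeff (κ : Finset ℕ → R) (M : PowerSeries R)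
    (hM : ∀ s, ncSum κ s = coeff s.card M) (j n b : ℕ) :
    ∑ W ∈ Finset.powersetCard j (Finset.Ico b (b + n)), sepSum κ W (Finset.Ico b (b + n) \ W) =
      coeff n (X ^ j * M ^ (j + 1)) := by
  induction j generalizing n b with
  | zero => simp [sepSum_empty, hM]
  | succ j ih =>
    rw [sum_powersetCard_succ_Ico]
    have h1 : ∀ x ∈ Finset.range n,
        ∑ W ∈ Finset.powersetCard j (Finset.Ico (b + x + 1) (b + n)),
          sepSum κ (insert (b + x) W) (Finset.Ico b (b + n) \ insert (b + x) W) =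
        coeff x M * coeff (n - 1 - x) (X ^ j * M ^ (j + 1)) := by
      intro x hx
      have hx' := Finset.mem_range.mp hx
      rw [← ih (n - 1 - x) (b + x + 1), Finset.mul_sum,
        show b + x + 1 + (n - 1 - x) = b + n by omega]
      refine Finset.sum_congr rfl fun W hW => ?_
      have hW' : ∀ y ∈ W, b + x < y := fun y hy => by
        have := Finset.mem_Ico.mp ((Finset.mem_powersetCard.mp hW).1 hy)
        omega
      rw [sepSum_insert κ hW' (by simp), hM]
      congr 2
      · have : Finset.filter (· < b + x) (Finset.Ico b (b + n) \ insert (b + x) W) =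
            Finset.Ico b (b + x) := by
          ext y
          simp only [Finset.mem_filter, Finset.mem_sdiff, Finset.mem_Ico, Finset.mem_insert, not_or]
          constructor
          · rintro ⟨⟨h, _⟩, h'⟩
            omega
          · rintro ⟨h, h'⟩
            refine ⟨⟨by omega, by omega, fun hy => ?_⟩, h'⟩
            have := hW' y hy
            omega
        rw [this]
        simp
      · ext y
        simp only [Finset.mem_filter, Finset.mem_sdiff, Finset.mem_Ico, Finset.mem_insert, not_or]
        constructor
        · rintro ⟨⟨h, _, h2⟩, h'⟩
          exact ⟨by omega, h2⟩
        · rintro ⟨h, h'⟩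
          exact ⟨⟨by omega, by omega, h'⟩, by omega⟩
    rw [Finset.sum_congr rfl h1]
    have h2 : (X : PowerSeries R) ^ (j + 1) * M ^ (j + 1 + 1) = X * (M * (X ^ j * M ^ (j + 1))) := by
      ring
    rw [h2]
    cases n with
    | zero => simp
    | succ n =>
      rw [coeff_succ_X_mul, coeff_mul, Finset.Nat.sum_antidiagonal_eq_sum_range_succ
        (fun a c => coeff a M * coeff c (X ^ j * M ^ (j + 1)))]
      simp

open PowerSeries in
/-- The one-variable moment-cumulant relation, on the level of generating functions. -/
theorem coeff_succ_eq_sum_of_ncSum (k : ℕ → R) (M : PowerSeries R)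
    (hM : ∀ s, ncSum (fun V => k V.card) s = coeff s.card M) (n : ℕ) :
    coeff (n + 1) M = ∑ j ∈ Finset.range (n + 1), k (j + 1) * coeff (n + 1) ((X * M) ^ (j + 1)) := by
  have h0 : Finset.range (n + 1) = insert 0 (Finset.Ico 1 (1 + n)) := by
    ext x
    simp only [Finset.mem_range, Finset.mem_insert, Finset.mem_Ico]
    omega
  have h1 := hM (Finset.range (n + 1))
  rw [Finset.card_range] at h1
  have hcard : (Finset.Ico 1 (1 + n)).card + 1 = n + 1 := by simp
  rw [← h1, h0, ncSum_insert _ (by intro x hx; exact (Finset.mem_Ico.mp hx).1),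
    Finset.sum_powerset, hcard, ← h0]
  refine Finset.sum_congr rfl fun j _ => ?_
  rw [show (X * M) ^ (j + 1) = X * (X ^ j * M ^ (j + 1)) by ring, coeff_succ_X_mul,
    ← sum_sepSum_eq_coeff _ M hM j n 1, Finset.mul_sum]
  refine Finset.sum_congr rfl fun W hW => ?_
  obtain ⟨hW1, hW2⟩ := Finset.mem_powersetCard.mp hW
  rw [Finset.card_insert_of_notMem (fun h => by simpa using hW1 h), hW2]

open PowerSeries in
theorem coeff_X_mul_pow_of_lt (M : PowerSeries R) {m j : ℕ} (h : m < j) :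
    coeff m ((X * M) ^ j) = 0 :=
  X_pow_dvd_iff.mp (by rw [mul_pow]; exact dvd_mul_right _ _) m h

open PowerSeries in
/-- The moment-cumulant relation as a congruence modulo `X ^ (n + 1)`. -/
theorem X_pow_dvd_of_coeff_succ_eq (k : ℕ → R) (M : PowerSeries R) (h0 : coeff 0 M = 1)
    (h : ∀ n, coeff (n + 1) M =
      ∑ j ∈ Finset.range (n + 1), k (j + 1) * coeff (n + 1) ((X * M) ^ (j + 1))) (n : ℕ) :
    X ^ (n + 1) ∣ M - (1 + ∑ j ∈ Finset.range n, C (k (j + 1)) * (X * M) ^ (j + 1)) := by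
  rw [X_pow_dvd_iff]
  intro m hm
  rw [map_sub, map_add, map_sum, sub_eq_zero]
  simp_rw [coeff_C_mul]
  cases m with
  | zero =>
    rw [h0, Finset.sum_eq_zero]
    · simp
    · intro j _
      rw [coeff_X_mul_pow_of_lt M (Nat.succ_pos j), mul_zero]
  | succ m =>
    rw [h, coeff_one, if_neg (Nat.succ_ne_zero m), zero_add]
    refine Finset.sum_subset (fun j hj => ?_) (fun j _ hj => ?_)
    · rw [Finset.mem_range] at *
      omega
    · rw [Finset.mem_range, not_lt] at hj
      rw [coeff_X_mul_pow_of_lt M (by omega), mul_zero]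

theorem sepSum_singleton (κ : Finset ℕ → R) {w : ℕ} {t : Finset ℕ} (hwt : w ∉ t) :
    sepSum κ {w} t = ncSum κ (t.filter (· < w)) * ncSum κ (t.filter (w < ·)) := by
  rw [← sepSum_empty κ (t.filter (w < ·)), ← sepSum_insert κ (by simp) hwt]
  rfl

/-- Decomposition according to the block of the smallest element if only pairs contribute. -/
theorem ncSum_range_succ_of_pairs (κ : Finset ℕ → R)
    (hκ : ∀ V : Finset ℕ, V.Nonempty → V.card ≠ 2 → κ V = 0) (n : ℕ) :
    ncSum κ (Finset.range (n + 1)) = ∑ w ∈ Finset.range n, κ {0, w + 1} *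
      (ncSum κ (Finset.Ico 1 (1 + w)) * ncSum κ (Finset.Ico (w + 2) (n + 1))) := by
  have h0 : Finset.range (n + 1) = insert 0 (Finset.Ico 1 (n + 1)) := by
    ext x
    simp only [Finset.mem_range, Finset.mem_insert, Finset.mem_Ico]
    omega
  have hS : ∀ W ∈ (Finset.Ico 1 (n + 1)).powerset,
      W ∉ (Finset.Ico 1 (n + 1)).powersetCard 1 →
      κ (insert 0 W) * sepSum κ W (Finset.Ico 1 (n + 1) \ W) = 0 := by
    intro W hW hW'
    have hW0 : 0 ∉ W := fun h => by simpa using Finset.mem_powerset.mp hW h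
    rw [hκ _ (Finset.insert_nonempty _ _), zero_mul]
    rw [Finset.card_insert_of_notMem hW0]
    intro h
    exact hW' (Finset.mem_powersetCard.mpr ⟨Finset.mem_powerset.mp hW, by omega⟩)
  rw [h0, ncSum_insert _ (by intro x hx; exact (Finset.mem_Ico.mp hx).1),
    ← Finset.sum_subset (fun W hW => Finset.mem_powerset.mpr (Finset.mem_powersetCard.mp hW).1) hS,
    Finset.powersetCard_one, Finset.sum_map, Finset.sum_Ico_eq_sum_range]
  refine Finset.sum_congr rfl fun w hw => ?_
  have hw := Finset.mem_range.mp hw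
  simp only [Function.Embedding.coeFn_mk]
  rw [sepSum_singleton κ (by simp), add_comm 1 w]
  congr 3
  · ext x
    simp only [Finset.mem_filter, Finset.mem_sdiff, Finset.mem_Ico, Finset.mem_singleton]
    omega
  · ext x
    simp only [Finset.mem_filter, Finset.mem_sdiff, Finset.mem_Ico, Finset.mem_singleton]
    omega

end OneVariable

section Catalan

theorem ncSum_one (s : Finset ℕ) :
    ncSum (fun _ => (1 : ℤ)) s = (nonCrossingPartitions s.card).card := by
  rw [← sum_nonCrossingPartitions _ s rfl]
  simp

open PowerSeries in
theorem card_nonCrossingPartitions (n : ℕ) : (nonCrossingPartitions n).card = catalan n := by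
  set N : PowerSeries ℤ := PowerSeries.mk fun n => ((nonCrossingPartitions n).card : ℤ) with hN
  have h0 : (nonCrossingPartitions 0).card = 1 := by
    have := ncSum_one ∅
    rw [ncSum_empty] at this
    exact_mod_cast this.symm
  have h := coeff_succ_eq_sum_of_ncSum (fun _ => (1 : ℤ)) N
    (fun s => by rw [ncSum_one, hN, coeff_mk])
  have hrec : N = 1 + X * N * N := by
    ext n
    have hg : (1 + ∑ j ∈ Finset.range n, C 1 * (X * N) ^ (j + 1)) * (1 - X * N) =
        1 - (X * N) ^ (n + 1) := by
      have h1 := geom_sum_mul (X * N) (n + 1)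
      rw [Finset.sum_range_succ', pow_zero] at h1
      simp only [map_one, one_mul]
      linear_combination -h1
    have hd := X_pow_dvd_of_coeff_succ_eq (fun _ => (1 : ℤ)) N (by simp [hN, h0]) h n
    have hd' : X ^ (n + 1) ∣ N - (1 + X * N * N) := by
      have e : N - (1 + X * N * N) =
          (N - (1 + ∑ j ∈ Finset.range n, C 1 * (X * N) ^ (j + 1))) * (1 - X * N)
            - (X * N) ^ (n + 1) := by
        linear_combination hg
      rw [e]
      exact dvd_sub (hd.mul_right _) (by rw [mul_pow]; exact dvd_mul_right _ _)
    have := X_pow_dvd_iff.mp hd' n (Nat.lt_succ_self n)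
    rwa [map_sub, sub_eq_zero] at this
  induction n using Nat.strong_induction_on with
  | _ n ih =>
    cases n with
    | zero => simpa using h0
    | succ n =>
      have h1 := congrArg (coeff (n + 1)) hrec
      rw [map_add, mul_assoc, coeff_succ_X_mul, coeff_mul, coeff_one, if_neg (by omega), zero_add,
        hN, coeff_mk] at h1
      simp only [coeff_mk] at h1
      rw [catalan_succ']
      have h2 : ∀ ij ∈ Finset.HasAntidiagonal.antidiagonal n,
          ((nonCrossingPartitions ij.1).card : ℤ) * (nonCrossingPartitions ij.2).card =
          ((catalan ij.1 * catalan ij.2 : ℕ) : ℤ) := by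
        intro ij hij
        have := Finset.HasAntidiagonal.mem_antidiagonal.mp hij
        rw [ih ij.1 (by omega), ih ij.2 (by omega)]
        push_cast
        ring
      rw [Finset.sum_congr rfl h2] at h1
      exact_mod_cast h1

theorem card_nonCrossingPartitions_le (n : ℕ) : (nonCrossingPartitions n).card ≤ 4 ^ n := by
  rw [card_nonCrossingPartitions, catalan_eq_centralBinom_div]
  exact (Nat.div_le_self _ _).trans (Nat.centralBinom_le_four_pow n)

end Catalan

section Wick
variable {A : Type*} [CStarAlgebra A]

/-- The moment generating series of `a`. -/
noncomputable def momentSeries (φ : A →ₗ[ℂ] ℂ) (a : A) : PowerSeries ℂ :=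
  PowerSeries.mk fun n => φ (a ^ n)

open PowerSeries in
theorem ncSum_freeCumulant_const {φ : A →ₗ[ℂ] ℂ} (hφ : IsState φ) (a : A) (s : Finset ℕ) :
    ncSum (fun V => freeCumulant φ V.card (fun _ => a)) s = coeff s.card (momentSeries φ a) := by
  have := moment_sort_eq_ncSum hφ (fun _ => a) s
  rw [← this, momentSeries, coeff_mk, List.map_const', List.prod_replicate, Finset.length_sort]

open PowerSeries in
theorem coeff_zero_momentSeries {φ : A →ₗ[ℂ] ℂ} (hφ : IsState φ) (a : A) :
    coeff 0 (momentSeries φ a) = 1 := by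
  rw [momentSeries, coeff_mk, pow_zero, hφ.map_one]

open PowerSeries in
/-- The moment-cumulant relation of a single random variable. -/
theorem coeff_succ_momentSeries {φ : A →ₗ[ℂ] ℂ} (hφ : IsState φ) (a : A) (n : ℕ) :
    coeff (n + 1) (momentSeries φ a) = ∑ j ∈ Finset.range (n + 1),
      freeCumulant φ (j + 1) (fun _ => a) * coeff (n + 1) ((X * momentSeries φ a) ^ (j + 1)) :=
  coeff_succ_eq_sum_of_ncSum (fun m => freeCumulant φ m (fun _ => a)) _
    (ncSum_freeCumulant_const hφ a) n

open PowerSeries in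
theorem coeff_X_mul_pow_self {R : Type*} [CommRing R] {M : PowerSeries R} (h0 : coeff 0 M = 1)
    (n : ℕ) : coeff n ((X * M) ^ n) = 1 := by
  have h := coeff_X_pow_mul (M ^ n) n 0
  rw [zero_add] at h
  rw [mul_pow, h, coeff_zero_eq_constantCoeff_apply, map_pow,
    ← coeff_zero_eq_constantCoeff_apply, h0, one_pow]

open PowerSeries in
/-- The free cumulants are determined by the moment generating series. -/
theorem freeCumulant_eq_of_coeff_succ {φ : A →ₗ[ℂ] ℂ} (hφ : IsState φ) (a : A) (k : ℕ → ℂ)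
    (h : ∀ n, coeff (n + 1) (momentSeries φ a) = ∑ j ∈ Finset.range (n + 1),
      k (j + 1) * coeff (n + 1) ((X * momentSeries φ a) ^ (j + 1))) (n : ℕ) :
    freeCumulant φ (n + 1) (fun _ => a) = k (n + 1) := by
  induction n using Nat.strong_induction_on with
  | _ n ih =>
    have h1 := (coeff_succ_momentSeries hφ a n).symm.trans (h n)
    rw [Finset.sum_range_succ, Finset.sum_range_succ,
      coeff_X_mul_pow_self (coeff_zero_momentSeries hφ a), mul_one, mul_one] at h1
    have h2 : ∀ j ∈ Finset.range n,
        freeCumulant φ (j + 1) (fun _ => a) * coeff (n + 1) ((X * momentSeries φ a) ^ (j + 1)) =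
        k (j + 1) * coeff (n + 1) ((X * momentSeries φ a) ^ (j + 1)) := fun j hj => by
      rw [ih j (Finset.mem_range.mp hj)]
    rw [Finset.sum_congr rfl h2] at h1
    exact add_left_cancel h1

/-- The recursive form of Wick's formula for the moments of a semicircular family. -/
def IsWick {ι : Type*} (φ : A →ₗ[ℂ] ℂ) (s : ι → A) (c : ι → ι → ℂ) : Prop :=
  ∀ (i : ι) (L : List ι), φ (s i * (L.map s).prod) =
    ∑ k ∈ Finset.range L.length, c i (L.getD k i) *
      (φ ((L.take k).map s).prod * φ ((L.drop (k + 1)).map s).prod)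

theorem sort_Ico (a b : ℕ) : (Finset.Ico a b).sort (· ≤ ·) = List.range' a (b - a) := by
  refine List.Perm.eq_of_pairwise' (r := (· ≤ ·)) ?_ ?_ ?_
  · exact Finset.pairwise_sort _ _
  · exact (List.pairwise_lt_range' (s := a) (n := b - a)).imp le_of_lt
  · rw [List.perm_ext_iff_of_nodup (Finset.sort_nodup _ _) List.nodup_range']
    intro x
    rw [Finset.mem_sort, Finset.mem_Ico, List.mem_range'_1]
    omega

theorem IsSemicircularFamily.isWick {ι : Type*} {φ : A →ₗ[ℂ] ℂ} (hφ : IsState φ) {s : ι → A}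
    {c : ι → ι → ℝ} (hs : IsSemicircularFamily φ s c) : IsWick φ s (fun i j => (c i j : ℂ)) := by
  intro i L
  set f : ℕ → ι := fun n => (i :: L).getD n i with hf
  set κ : Finset ℕ → ℂ := fun V => freeCumulant φ V.card (fun i => s (f (V.orderEmbOfFin rfl i)))
    with hκ
  have hmom : ∀ a b, ncSum κ (Finset.Ico a b) = φ (((List.range' a (b - a)).map f).map s).prod := by
    intro a b
    rw [← sort_Ico, List.map_map]
    exact (moment_sort_eq_ncSum hφ (fun n => s (f n)) (Finset.Ico a b)).symm
  have hpair : ∀ w, κ {0, w + 1} = c i (L.getD w i) := by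
    intro w
    have hcard : ({0, w + 1} : Finset ℕ).card = 2 := Finset.card_pair (Nat.succ_ne_zero w).symm
    have he : ∀ p, ({0, w + 1} : Finset ℕ).orderEmbOfFin hcard p = ![0, w + 1] p := by
      intro p
      refine (congrFun (Finset.orderEmbOfFin_unique hcard (f := ![0, w + 1]) ?_ ?_) p).symm
      · intro q
        fin_cases q <;> simp
      · intro p q hpq
        fin_cases p <;> fin_cases q <;> simp_all
    rw [hκ]
    simp only
    rw [freeCumulant_orderEmbOfFin_congr φ (fun n => s (f n)) _ hcard]
    simp_rw [he]
    rw [← hs.cumulant_two]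
    congr 1
    funext p
    fin_cases p <;> simp [hf]
  have h := ncSum_range_succ_of_pairs κ (fun V hV hV2 => hs.cumulant_ne_two V.card
    (Finset.card_pos.mpr hV) hV2 (fun p => f (V.orderEmbOfFin rfl p))) L.length
  have hfull : (List.range' 0 (L.length + 1)).map f = i :: L := by
    refine List.ext_getElem (by simp) fun n h1 h2 => ?_
    simp only [List.getElem_map, List.getElem_range', zero_add, one_mul, hf]
    exact List.getD_eq_getElem _ _ h2
  rw [Finset.range_eq_Ico, hmom, Nat.sub_zero, hfull, List.map_cons, List.prod_cons] at h
  rw [h]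
  refine Finset.sum_congr rfl fun w hw => ?_
  have hw := Finset.mem_range.mp hw
  rw [hpair, hmom, hmom]
  congr 5
  · refine List.ext_getElem (by simp [hw.le]) fun n h1 h2 => ?_
    simp only [List.length_map, List.length_range'] at h1
    have : n < L.length := by omega
    simp only [List.getElem_map, List.getElem_range', one_mul, hf, List.getElem_take]
    rw [add_comm, List.getD_cons_succ, List.getD_eq_getElem _ _ this]
  · refine List.ext_getElem (by simp) fun n h1 h2 => ?_
    simp only [List.length_map, List.length_range'] at h1
    have : w + 1 + n < L.length := by omega
    simp only [List.getElem_map, List.getElem_range', one_mul, hf, List.getElem_drop]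
    rw [show w + 2 + n = (w + 1 + n) + 1 by ring, List.getD_cons_succ,
      List.getD_eq_getElem _ _ this]

end Wick

section Quadratic
variable {A : Type*} [CStarAlgebra A] {ι : Type*} [Fintype ι]

/-- The quadratic form with coefficients `Q` in the random variables `s`. -/
noncomputable def quadForm (Q : Matrix ι ι ℂ) (s : ι → A) : A :=
  ∑ p : ι × ι, Q p.1 p.2 • (s p.1 * s p.2)

theorem sum_mul_apply_append (φ : A →ₗ[ℂ] ℂ) (s : ι → A) (Q : Matrix ι ι ℂ) (L : List ι) (y : A) :
    ∑ p : ι × ι, Q p.1 p.2 * φ (((L ++ [p.1, p.2]).map s).prod * y) =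
      φ ((L.map s).prod * quadForm Q s * y) := by
  rw [quadForm, Finset.mul_sum, Finset.sum_mul, map_sum]
  refine Finset.sum_congr rfl fun p _ => ?_
  rw [mul_smul_comm, smul_mul_assoc, map_smul, smul_eq_mul]
  simp [mul_assoc]

theorem IsWick.apply_mul_quadForm_pow {φ : A →ₗ[ℂ] ℂ} {s : ι → A} {c : ι → ι → ℂ}
    (h : IsWick φ s c) (Q : Matrix ι ι ℂ) (n : ℕ) (i : ι) (L L' : List ι) :
    φ (s i * ((L.map s).prod * quadForm Q s ^ n * (L'.map s).prod)) =
      ∑ k ∈ Finset.range L.length, c i (L.getD k i) * (φ ((L.take k).map s).prod *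
        φ (((L.drop (k + 1)).map s).prod * quadForm Q s ^ n * (L'.map s).prod)) +
      ∑ r ∈ Finset.range n, ∑ p : ι × ι, Q p.1 p.2 *
        (c i p.1 * (φ ((L.map s).prod * quadForm Q s ^ r) *
          φ (s p.2 * quadForm Q s ^ (n - 1 - r) * (L'.map s).prod)) +
         c i p.2 * (φ ((L.map s).prod * quadForm Q s ^ r * s p.1) *
          φ (quadForm Q s ^ (n - 1 - r) * (L'.map s).prod))) +
      ∑ k ∈ Finset.range L'.length, c i (L'.getD k i) *
        (φ ((L.map s).prod * quadForm Q s ^ n * ((L'.take k).map s).prod) *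
          φ ((L'.drop (k + 1)).map s).prod) := by
  induction n generalizing L with
  | zero =>
    have h1 := h i (L ++ L')
    rw [List.map_append, List.prod_append, List.length_append, Finset.sum_range_add] at h1
    simp only [pow_zero, mul_one, Finset.range_zero, Finset.sum_empty, add_zero, h1]
    congr 1
    · refine Finset.sum_congr rfl fun k hk => ?_
      have hk := Finset.mem_range.mp hk
      rw [List.getD_append _ _ _ _ hk, List.take_append_of_le_length hk.le,
        List.drop_append_of_le_length hk, List.map_append, List.prod_append]
    · refine Finset.sum_congr rfl fun k hk => ?_
      rw [List.getD_append_right _ _ _ _ (by omega), List.take_length_add_append,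
        show L.length + k + 1 = L.length + (k + 1) by ring, List.drop_length_add_append,
        List.map_append, List.prod_append, Nat.add_sub_cancel_left]
  | succ n ih =>
    set S := quadForm Q s with hS
    have hL : φ (s i * ((L.map s).prod * S ^ (n + 1) * (L'.map s).prod)) =
        ∑ p : ι × ι, Q p.1 p.2 *
          φ (s i * (((L ++ [p.1, p.2]).map s).prod * S ^ n * (L'.map s).prod)) := by
      have := sum_mul_apply_append φ s Q (i :: L) (S ^ n * (L'.map s).prod)
      rw [← hS] at this
      simp only [List.cons_append, List.map_cons, List.prod_cons, mul_assoc] at this ⊢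
      rw [this, pow_succ']
      simp only [mul_assoc]
    rw [hL]
    have h1 : ∀ p : ι × ι, ∑ k ∈ Finset.range (L ++ [p.1, p.2]).length,
        c i ((L ++ [p.1, p.2]).getD k i) * (φ (((L ++ [p.1, p.2]).take k).map s).prod *
          φ ((((L ++ [p.1, p.2]).drop (k + 1)).map s).prod * S ^ n * (L'.map s).prod)) =
        ∑ k ∈ Finset.range L.length, c i (L.getD k i) * (φ ((L.take k).map s).prod *
          φ (((L.drop (k + 1) ++ [p.1, p.2]).map s).prod * (S ^ n * (L'.map s).prod))) +
        (c i p.1 * (φ ((L.map s).prod * S ^ 0) * φ (s p.2 * S ^ n * (L'.map s).prod)) +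
          c i p.2 * (φ ((L.map s).prod * S ^ 0 * s p.1) * φ (S ^ n * (L'.map s).prod))) := by
      intro p
      rw [List.length_append, List.length_cons, List.length_singleton, ← add_assoc,
        Finset.sum_range_succ, Finset.sum_range_succ, add_assoc]
      congr 1
      · refine Finset.sum_congr rfl fun k hk => ?_
        have hk := Finset.mem_range.mp hk
        rw [List.getD_append _ _ _ _ hk, List.take_append_of_le_length hk.le,
          List.drop_append_of_le_length hk, mul_assoc]
      · rw [List.getD_append_right _ _ _ _ (by omega), List.getD_append_right _ _ _ _ (by omega),
          List.take_left, List.take_length_add_append, List.drop_length_add_append,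
          show L.length + 1 + 1 = L.length + 2 by ring, List.drop_length_add_append]
        simp
    have h2 : ∀ k, ∑ p : ι × ι, Q p.1 p.2 * (c i (L.getD k i) * (φ ((L.take k).map s).prod *
          φ (((L.drop (k + 1) ++ [p.1, p.2]).map s).prod * (S ^ n * (L'.map s).prod)))) =
        c i (L.getD k i) * (φ ((L.take k).map s).prod *
          φ (((L.drop (k + 1)).map s).prod * S ^ (n + 1) * (L'.map s).prod)) := by
      intro k
      have := sum_mul_apply_append φ s Q (L.drop (k + 1)) (S ^ n * (L'.map s).prod)
      rw [← hS] at this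
      rw [pow_succ', mul_assoc, mul_assoc, ← mul_assoc S, mul_assoc S, ← mul_assoc _ S, ← this,
        Finset.mul_sum, Finset.mul_sum]
      exact Finset.sum_congr rfl fun p _ => by ring
    have h3 : ∀ r, ∑ p : ι × ι, Q p.1 p.2 * ∑ p' : ι × ι, Q p'.1 p'.2 *
          (c i p'.1 * (φ (((L ++ [p.1, p.2]).map s).prod * S ^ r) *
            φ (s p'.2 * S ^ (n - 1 - r) * (L'.map s).prod)) +
          c i p'.2 * (φ (((L ++ [p.1, p.2]).map s).prod * S ^ r * s p'.1) *
            φ (S ^ (n - 1 - r) * (L'.map s).prod))) =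
        ∑ p' : ι × ι, Q p'.1 p'.2 *
          (c i p'.1 * (φ ((L.map s).prod * S ^ (r + 1)) *
            φ (s p'.2 * S ^ (n - 1 - r) * (L'.map s).prod)) +
          c i p'.2 * (φ ((L.map s).prod * S ^ (r + 1) * s p'.1) *
            φ (S ^ (n - 1 - r) * (L'.map s).prod))) := by
      intro r
      simp_rw [Finset.mul_sum]
      rw [Finset.sum_comm]
      refine Finset.sum_congr rfl fun p' _ => ?_
      have e1 := sum_mul_apply_append φ s Q L (S ^ r)
      have e2 := sum_mul_apply_append φ s Q L (S ^ r * s p'.1)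
      rw [← hS, mul_assoc, ← pow_succ'] at e1
      rw [← hS, mul_assoc, ← mul_assoc S, ← pow_succ', ← mul_assoc] at e2
      rw [← e1, ← e2, Finset.sum_mul, Finset.sum_mul, Finset.mul_sum, Finset.mul_sum,
        ← Finset.sum_add_distrib, Finset.mul_sum]
      refine Finset.sum_congr rfl fun p _ => ?_
      rw [mul_assoc _ (S ^ r)]
      ring
    have h4 : ∀ k, ∑ p : ι × ι, Q p.1 p.2 * (c i (L'.getD k i) *
          (φ (((L ++ [p.1, p.2]).map s).prod * S ^ n * ((L'.take k).map s).prod) *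
            φ ((L'.drop (k + 1)).map s).prod)) =
        c i (L'.getD k i) * (φ ((L.map s).prod * S ^ (n + 1) * ((L'.take k).map s).prod) *
            φ ((L'.drop (k + 1)).map s).prod) := by
      intro k
      have := sum_mul_apply_append φ s Q L (S ^ n * ((L'.take k).map s).prod)
      rw [← hS, mul_assoc, ← mul_assoc S, ← pow_succ', ← mul_assoc] at this
      rw [← this, Finset.sum_mul, Finset.mul_sum]
      refine Finset.sum_congr rfl fun p _ => ?_
      rw [mul_assoc _ (S ^ n)]
      ring
    rw [Finset.sum_range_succ', Finset.sum_congr rfl fun k _ => (h2 k).symm,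
      Finset.sum_congr (s₁ := Finset.range L'.length) rfl fun k _ => (h4 k).symm]
    simp only [ih, h1]
    have h5 : ∀ r, n + 1 - 1 - (r + 1) = n - 1 - r := fun r => by omega
    simp only [h5, ← h3]
    rw [Finset.sum_comm (s := Finset.range L.length), Finset.sum_comm (s := Finset.range n),
      Finset.sum_comm (s := Finset.range L'.length), add_right_comm, ← add_assoc,
      ← Finset.sum_add_distrib, ← Finset.sum_add_distrib, ← Finset.sum_add_distrib]
    refine Finset.sum_congr rfl fun p _ => ?_
    simp only [← Finset.mul_sum, Nat.add_sub_cancel, Nat.sub_zero]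
    ring

theorem IsWick.apply_eq_zero_of_odd {ι : Type*} {φ : A →ₗ[ℂ] ℂ} {s : ι → A} {c : ι → ι → ℂ}
    (h : IsWick φ s c) (L : List ι) (hL : Odd L.length) : φ (L.map s).prod = 0 := by
  induction hn : L.length using Nat.strong_induction_on generalizing L with
  | _ n ih =>
    cases L with
    | nil => simp at hL
    | cons i L =>
      rw [List.length_cons] at hL hn
      rw [List.map_cons, List.prod_cons, h]
      refine Finset.sum_eq_zero fun k hk => ?_
      have hk := Finset.mem_range.mp hk
      rcases Nat.even_or_odd k with hk' | hk'
      · rw [ih (L.length - (k + 1)) (by omega) (L.drop (k + 1)) ?_ (by simp), mul_zero, mul_zero]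
        rw [List.length_drop]
        rw [Nat.odd_iff] at *
        rw [Nat.even_iff] at hk'
        omega
      · rw [ih k (by omega) (L.take k) ?_ (by simp; omega), zero_mul, mul_zero]
        rwa [List.length_take, min_eq_left hk.le]

theorem IsWick.apply_quadForm_pow_eq_zero_of_odd {φ : A →ₗ[ℂ] ℂ} {s : ι → A} {c : ι → ι → ℂ}
    (h : IsWick φ s c) (Q : Matrix ι ι ℂ) (n : ℕ) (L L' : List ι)
    (hL : Odd (L.length + L'.length)) :
    φ ((L.map s).prod * quadForm Q s ^ n * (L'.map s).prod) = 0 := by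
  induction n generalizing L with
  | zero =>
    rw [pow_zero, mul_one, ← List.prod_append, ← List.map_append]
    exact h.apply_eq_zero_of_odd _ (by rwa [List.length_append])
  | succ n ih =>
    have := sum_mul_apply_append φ s Q L (quadForm Q s ^ n * (L'.map s).prod)
    rw [pow_succ', mul_assoc, mul_assoc, ← mul_assoc, ← this]
    refine Finset.sum_eq_zero fun p _ => ?_
    rw [← mul_assoc, ih, mul_zero]
    rw [List.length_append, List.length_cons, List.length_singleton]
    rw [Nat.odd_iff] at *
    omega

theorem IsWick.apply_mul_quadForm_pow_mul {φ : A →ₗ[ℂ] ℂ} (hφ : IsState φ) {s : ι → A}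
    {c : ι → ι → ℂ} (h : IsWick φ s c) (Q : Matrix ι ι ℂ) (n : ℕ) (j a : ι) :
    φ (s j * quadForm Q s ^ n * s a) = c j a * φ (quadForm Q s ^ n) +
      ∑ r ∈ Finset.range n, ∑ p : ι × ι, c j p.1 * Q p.1 p.2 *
        (φ (quadForm Q s ^ r) * φ (s p.2 * quadForm Q s ^ (n - 1 - r) * s a)) := by
  have h1 := h.apply_mul_quadForm_pow Q n j [] [a]
  simp only [List.map_nil, List.prod_nil, one_mul, List.map_cons, mul_one, List.prod_cons,
    List.length_nil, Finset.range_zero, Finset.sum_empty, zero_add, List.length_singleton,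
    Finset.range_one, Finset.sum_singleton, List.getD_cons_zero, List.take_zero, List.drop_one,
    List.tail_cons, hφ.map_one] at h1
  rw [mul_assoc, h1, add_comm]
  congr 1
  refine Finset.sum_congr rfl fun r _ => Finset.sum_congr rfl fun p _ => ?_
  have h0 := h.apply_quadForm_pow_eq_zero_of_odd Q r [] [p.1] (by simp)
  simp only [List.map_nil, List.prod_nil, one_mul, List.map_cons, mul_one, List.prod_cons] at h0
  rw [h0]
  ring

theorem IsWick.apply_quadForm_pow_succ {φ : A →ₗ[ℂ] ℂ} (hφ : IsState φ) {s : ι → A}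
    {c : ι → ι → ℂ} (h : IsWick φ s c) (Q : Matrix ι ι ℂ) (n : ℕ) :
    φ (quadForm Q s ^ (n + 1)) = ∑ p : ι × ι, Q p.1 p.2 * (c p.1 p.2 * φ (quadForm Q s ^ n) +
      ∑ r ∈ Finset.range n, ∑ q : ι × ι, Q q.1 q.2 * c p.1 q.2 *
        (φ (s p.2 * quadForm Q s ^ r * s q.1) * φ (quadForm Q s ^ (n - 1 - r)))) := by
  have h2 := sum_mul_apply_append φ s Q [] (quadForm Q s ^ n)
  simp only [List.map_nil, List.prod_nil, one_mul, List.nil_append, List.map_cons,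
    List.prod_cons, mul_one] at h2
  rw [pow_succ', ← h2]
  refine Finset.sum_congr rfl fun p _ => ?_
  congr 1
  have h1 := h.apply_mul_quadForm_pow Q n p.1 [p.2] []
  simp only [List.map_nil, List.prod_nil, one_mul, List.map_cons, mul_one, List.prod_cons,
    List.length_nil, Finset.range_zero, Finset.sum_empty, add_zero, List.length_singleton,
    Finset.range_one, Finset.sum_singleton, List.getD_cons_zero, List.take_zero,
    hφ.map_one] at h1
  rw [mul_assoc, h1]
  refine congrArg₂ (· + ·) (by simp) (Finset.sum_congr rfl fun r _ => Finset.sum_congr rfl fun q _ => ?_)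
  have h0 := h.apply_quadForm_pow_eq_zero_of_odd Q r [p.2] [] (by simp)
  simp only [List.map_nil, List.prod_nil, List.map_cons, mul_one, List.prod_cons] at h0
  rw [h0]
  ring

open PowerSeries in
theorem coeff_X_mul_mul {R : Type*} [CommRing R] (F G : PowerSeries R) (n : ℕ) :
    coeff n (X * (F * G)) = ∑ r ∈ Finset.range n, coeff r F * coeff (n - 1 - r) G := by
  cases n with
  | zero => simp
  | succ n =>
    rw [coeff_succ_X_mul, coeff_mul, Finset.Nat.sum_antidiagonal_eq_sum_range_succ
      (fun a c => coeff a F * coeff c G)]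
    simp

open PowerSeries in
/-- The free cumulants of a quadratic form in a semicircular family are traces of powers. -/
theorem IsWick.freeCumulant_quadForm [DecidableEq ι] {φ : A →ₗ[ℂ] ℂ} (hφ : IsState φ) {s : ι → A}
    {c : Matrix ι ι ℂ} (h : IsWick φ s c) (hc : c.IsSymm) (Q : Matrix ι ι ℂ) (n : ℕ) :
    freeCumulant φ (n + 1) (fun _ => quadForm Q s) = ((c * Q) ^ (n + 1)).trace := by
  set S := quadForm Q s with hS
  refine freeCumulant_eq_of_coeff_succ hφ S (fun m => ((c * Q) ^ m).trace) (fun n => ?_) n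
  set M := momentSeries φ S with hM
  let f : Matrix ι ι ℂ →+* Matrix ι ι (PowerSeries ℂ) := (C : ℂ →+* PowerSeries ℂ).mapMatrix
  let B : Matrix ι ι (PowerSeries ℂ) :=
    fun j a => PowerSeries.mk fun n => φ (s j * S ^ n * s a)
  have hcoef : ∀ n, coeff n M = φ (S ^ n) := fun n => by rw [hM, momentSeries, coeff_mk]
  have hcoefB : ∀ j a n, coeff n (B j a) = φ (s j * S ^ n * s a) := fun j a n => coeff_mk _ _
  have hmul : ∀ j a, (f c * f Q * B) j a = ∑ p : ι × ι, C (c j p.1 * Q p.1 p.2) * B p.2 a := by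
    intro j a
    rw [Fintype.sum_prod_type_right, Matrix.mul_apply]
    refine Finset.sum_congr rfl fun p _ => ?_
    rw [Matrix.mul_apply, Finset.sum_mul]
    refine Finset.sum_congr rfl fun q _ => ?_
    rw [map_mul]
    rfl
  have hB : B = M • f c + (X * M) • (f c * f Q * B) := by
    refine Matrix.ext fun j a => PowerSeries.ext fun n => ?_
    rw [Matrix.add_apply, Matrix.smul_apply, Matrix.smul_apply, hmul, smul_eq_mul, smul_eq_mul,
      map_add, Finset.mul_sum, map_sum, show f c j a = C (c j a) from rfl, coeff_mul_C, hcoef]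
    have e : ∀ p : ι × ι, coeff n (X * M * (C (c j p.1 * Q p.1 p.2) * B p.2 a)) =
        ∑ r ∈ Finset.range n, c j p.1 * Q p.1 p.2 *
          (φ (S ^ r) * φ (s p.2 * S ^ (n - 1 - r) * s a)) := by
      intro p
      rw [show X * M * (C (c j p.1 * Q p.1 p.2) * B p.2 a) =
        C (c j p.1 * Q p.1 p.2) * (X * (M * B p.2 a)) by ring, coeff_C_mul, coeff_X_mul_mul,
        Finset.mul_sum]
      refine Finset.sum_congr rfl fun r _ => ?_
      rw [hcoef, hcoefB]
    rw [Finset.sum_congr rfl fun p _ => e p, Finset.sum_comm, hcoefB, mul_comm (φ _)]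
    exact h.apply_mul_quadForm_pow_mul hφ Q n j a
  have htr1 : ∀ N : Matrix ι ι (PowerSeries ℂ), (N * f Q).trace =
      ∑ q : ι × ι, N q.2 q.1 * C (Q q.1 q.2) := by
    intro N
    simp only [Matrix.trace, Matrix.diag, Matrix.mul_apply]
    exact (Fintype.sum_prod_type_right (fun q : ι × ι => N q.2 q.1 * C (Q q.1 q.2))).symm
  have hM1 : M = 1 + X * M * (f (c * Q)).trace + X ^ 2 * M * (f (c * Q) * B * f Q).trace := by
    have e1 : (f (c * Q)).trace = ∑ p : ι × ι, C (Q p.1 p.2 * c p.1 p.2) := by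
      rw [map_mul, htr1]
      refine Finset.sum_congr rfl fun p _ => ?_
      rw [show f c p.2 p.1 = C (c p.2 p.1) from rfl, ← hc.apply p.1 p.2, map_mul, mul_comm]
    have e2 : (f (c * Q) * B * f Q).trace = ∑ p : ι × ι, ∑ q : ι × ι,
        C (Q p.1 p.2 * (Q q.1 q.2 * c p.1 q.2)) * B p.2 q.1 := by
      rw [htr1, Finset.sum_comm (s := Finset.univ)]
      refine Finset.sum_congr rfl fun q _ => ?_
      rw [map_mul, hmul, Finset.sum_mul]
      refine Finset.sum_congr rfl fun p _ => ?_
      rw [← hc.apply p.1 q.2]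
      simp only [map_mul]
      ring
    refine PowerSeries.ext fun n => ?_
    rw [e1, e2]
    cases n with
    | zero =>
      have h0 := coeff_zero_momentSeries hφ S
      rw [← hM] at h0
      rw [h0, map_add, map_add, coeff_zero_one, pow_two, mul_assoc, mul_assoc, mul_assoc,
        coeff_zero_X_mul, coeff_zero_X_mul, add_zero, add_zero]
    | succ n =>
      rw [hcoef, hS, h.apply_quadForm_pow_succ hφ Q n, ← hS]
      simp_rw [mul_add, Finset.sum_add_distrib]
      rw [map_add, map_add, coeff_one, if_neg (Nat.succ_ne_zero n), zero_add, mul_assoc,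
        coeff_succ_X_mul, pow_two, mul_assoc, mul_assoc, coeff_succ_X_mul]
      congr 1
      · rw [Finset.mul_sum, map_sum]
        refine Finset.sum_congr rfl fun p _ => ?_
        rw [coeff_mul_C, hcoef]
        ring
      · simp_rw [Finset.mul_sum, map_sum]
        refine Finset.sum_congr rfl fun p _ => ?_
        rw [Finset.sum_comm]
        refine Finset.sum_congr rfl fun q _ => ?_
        rw [show X * (M * (C (Q p.1 p.2 * (Q q.1 q.2 * c p.1 q.2)) * B p.2 q.1)) =
          C (Q p.1 p.2 * (Q q.1 q.2 * c p.1 q.2)) * (X * (B p.2 q.1 * M)) by ring, coeff_C_mul,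
          coeff_X_mul_mul, Finset.mul_sum]
        refine Finset.sum_congr rfl fun r _ => ?_
        rw [hcoef, hcoefB]
        ring
  have htr : ∀ m, (f (c * Q) ^ m).trace = C (((c * Q) ^ m).trace) := by
    intro m
    rw [← map_pow]
    exact (AddMonoidHom.map_trace (C : ℂ →+* PowerSeries ℂ) _).symm
  have hiter : ∀ n, X ^ 2 * M * (f (c * Q) * B * f Q).trace =
      ∑ j ∈ Finset.range n, (X * M) ^ (j + 2) * (f (c * Q) ^ (j + 2)).trace +
        X ^ 2 * M * (X * M) ^ n * (f (c * Q) ^ (n + 1) * B * f Q).trace := by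
    intro n
    induction n with
    | zero => simp
    | succ n ih =>
      rw [ih, Finset.sum_range_succ]
      nth_rewrite 1 [hB]
      simp only [mul_add, add_mul, Matrix.mul_smul, Matrix.smul_mul, Matrix.trace_add,
        Matrix.trace_smul, smul_eq_mul]
      have e1 : f (c * Q) ^ (n + 1) * f c * f Q = f (c * Q) ^ (n + 2) := by
        rw [mul_assoc, ← map_mul, ← pow_succ]
      have e2 : f (c * Q) ^ (n + 1) * (f c * f Q * B) * f Q = f (c * Q) ^ (n + 1 + 1) * B * f Q := by
        rw [← map_mul, ← mul_assoc, ← pow_succ]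
      rw [e1, e2]
      ring
  have h3 : M = 1 + ∑ j ∈ Finset.range (n + 1), C (((c * Q) ^ (j + 1)).trace) * (X * M) ^ (j + 1) +
      X ^ (n + 2) * (M * M ^ n * (f (c * Q) ^ (n + 1) * B * f Q).trace) := by
    conv_lhs => rw [hM1, hiter n]
    rw [Finset.sum_range_succ', ← htr, pow_one]
    simp only [← htr]
    rw [Finset.sum_congr rfl fun j _ => mul_comm ((X * M) ^ (j + 2)) _]
    ring
  conv_lhs => rw [h3]
  rw [map_add, map_add, map_sum, coeff_one, if_neg (Nat.succ_ne_zero n), zero_add,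
    X_pow_dvd_iff.mp (dvd_mul_right _ _) (n + 1) (by omega), add_zero]
  simp_rw [coeff_C_mul]

end Quadratic

section State
variable {A : Type*} [CStarAlgebra A]

open scoped ComplexOrder in
theorem IsState.apply_cfcHom_nonneg {φ : A →ₗ[ℂ] ℂ} (hφ : IsState φ) {a : A}
    (ha : IsSelfAdjoint a) (f : C(spectrum ℝ a, ℝ)) (hf : ∀ x, 0 ≤ f x) :
    0 ≤ φ (cfcHom (R := ℝ) ha f) := by
  let g : C(spectrum ℝ a, ℝ) := ⟨fun x => Real.sqrt (f x), by fun_prop⟩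
  have hg : f = star g * g := by
    ext x
    simp [g, Real.mul_self_sqrt (hf x)]
  rw [hg, map_mul, map_star]
  exact hφ.nonneg _

theorem IsState.apply_cfcHom_eq_ofReal_re {φ : A →ₗ[ℂ] ℂ} (hφ : IsState φ) {a : A}
    (ha : IsSelfAdjoint a) (f : C(spectrum ℝ a, ℝ)) :
    φ (cfcHom (R := ℝ) ha f) = ((φ (cfcHom (R := ℝ) ha f)).re : ℂ) := by
  have h := hφ.apply_cfcHom_nonneg ha (f + algebraMap ℝ _ ‖f‖) (fun x => by
    have := neg_le_of_abs_le (f.norm_coe_le_norm x)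
    rw [Algebra.algebraMap_eq_smul_one, ContinuousMap.add_apply, ContinuousMap.smul_apply,
      ContinuousMap.one_apply, smul_eq_mul, mul_one]
    linarith)
  rw [map_add, AlgHomClass.commutes, map_add, IsScalarTower.algebraMap_apply ℝ ℂ A,
    Algebra.algebraMap_eq_smul_one (A := A), map_smul, hφ.map_one] at h
  have := (Complex.le_def.mp h).2
  apply Complex.ext
  · simp
  · simpa using this.symm

theorem cfcHom_id_pow {a : A} (ha : IsSelfAdjoint a) (n : ℕ) :
    cfcHom (R := ℝ) ha ((ContinuousMap.id ℝ).restrict (spectrum ℝ a) ^ n) = a ^ n := by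
  rw [map_pow, cfcHom_id]

/-- A self-adjoint element is bounded by the growth rate of its moments in a faithful state. -/
theorem IsFaithful.norm_le {φ : A →ₗ[ℂ] ℂ} (hf : IsFaithful φ) (hφ : IsState φ) {a : A}
    (ha : IsSelfAdjoint a) {r : ℝ} (hr : 0 ≤ r) (h : ∀ n, ‖φ (a ^ n)‖ ≤ r ^ n) : ‖a‖ ≤ r := by
  refine le_of_forall_gt_imp_ge_of_dense fun R hR => ?_
  have hR0 : 0 < R := hr.trans_lt hR
  set X : C(spectrum ℝ a, ℝ) := (ContinuousMap.id ℝ).restrict (spectrum ℝ a) with hX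
  let f : C(spectrum ℝ a, ℝ) := ⟨fun x => max (|(x : ℝ)| - R) 0, by fun_prop⟩
  have hfle : ∀ n x, f x ^ 2 ≤ (‖f‖ ^ 2 * (R⁻¹ ^ (2 * n))) * X x ^ (2 * n) := by
    intro n x
    rcases le_total (|(x : ℝ)|) R with hx | hx
    · have : f x = 0 := max_eq_right (by linarith)
      rw [this, zero_pow two_ne_zero]
      refine mul_nonneg (by positivity) ?_
      rw [pow_mul]
      positivity
    · have h1 : f x ^ 2 ≤ ‖f‖ ^ 2 := by
        rw [← sq_abs]
        exact pow_le_pow_left₀ (abs_nonneg _) (f.norm_coe_le_norm x) 2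
      have h2 : 1 ≤ R⁻¹ ^ (2 * n) * X x ^ (2 * n) := by
        rw [← mul_pow, pow_mul, show X x = (x : ℝ) from rfl]
        apply one_le_pow₀
        rw [← sq_abs, abs_mul, abs_inv, abs_of_pos hR0]
        apply one_le_pow₀
        rwa [← div_eq_inv_mul, one_le_div hR0]
      rw [mul_assoc]
      calc f x ^ 2 ≤ ‖f‖ ^ 2 := h1
        _ ≤ _ := le_mul_of_one_le_right (by positivity) h2
  set F := cfcHom (R := ℝ) ha f with hF
  have hFF : star F * F = cfcHom (R := ℝ) ha (f ^ 2) := by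
    rw [hF, ← map_star, ← map_mul, pow_two]
    rfl
  have hbound : ∀ n : ℕ, (φ (star F * F)).re ≤ ‖f‖ ^ 2 * ((r / R) ^ 2) ^ n := by
    intro n
    have h1 := hφ.apply_cfcHom_nonneg ha
      ((‖f‖ ^ 2 * (R⁻¹ ^ (2 * n))) • X ^ (2 * n) - f ^ 2) (fun x => by
        have := hfle n x
        simpa using this)
    rw [map_sub, map_smul, hX, cfcHom_id_pow, ← hFF, map_sub, ← Complex.coe_smul, map_smul] at h1
    have h2 := (Complex.le_def.mp h1).1
    rw [Complex.zero_re, Complex.sub_re, smul_eq_mul, Complex.re_ofReal_mul, sub_nonneg] at h2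
    refine h2.trans ?_
    have h3 : (φ (a ^ (2 * n))).re ≤ r ^ (2 * n) := (Complex.re_le_norm _).trans (h _)
    calc _ ≤ ‖f‖ ^ 2 * R⁻¹ ^ (2 * n) * r ^ (2 * n) := by gcongr
      _ = _ := by rw [← pow_mul, div_pow, div_eq_mul_inv, inv_pow]; ring
  have hlim : Filter.Tendsto (fun n : ℕ => ‖f‖ ^ 2 * ((r / R) ^ 2) ^ n) Filter.atTop
      (nhds (‖f‖ ^ 2 * 0)) := by
    refine (tendsto_pow_atTop_nhds_zero_of_lt_one (by positivity) ?_).const_mul _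
    exact pow_lt_one₀ (by positivity) ((div_lt_one hR0).mpr hR) two_ne_zero
  have hre : (φ (star F * F)).re ≤ 0 := by
    rw [mul_zero] at hlim
    exact ge_of_tendsto' hlim hbound
  have h0 : φ (star F * F) = 0 := by
    have hn := Complex.le_def.mp (hφ.nonneg F)
    apply Complex.ext
    · exact le_antisymm hre hn.1
    · exact hn.2.symm
  have hF0 := hf F h0
  have hf0 : f = 0 := by
    apply cfcHom_injective (R := ℝ) ha
    rw [← hF, hF0, map_zero]
  rw [← cfcHom_id (R := ℝ) ha, norm_cfcHom (𝕜 := ℝ) a _ ha]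
  refine (ContinuousMap.norm_le _ hR0.le).mpr fun x => ?_
  have := congrArg (fun g => g x) hf0
  have h1 : max (|(x : ℝ)| - R) 0 = 0 := this
  have h2 := (le_max_left (|(x : ℝ)| - R) 0).trans h1.le
  rw [Real.norm_eq_abs]
  exact sub_nonpos.mp h2

/-- States are bounded. -/
theorem IsState.exists_norm_le {φ : A →ₗ[ℂ] ℂ} (hφ : IsState φ) :
    ∃ C : ℝ, ∀ a, ‖φ a‖ ≤ C * ‖a‖ := by
  let _ : PartialOrder A := CStarAlgebra.spectralOrder A
  have : StarOrderedRing A := CStarAlgebra.spectralOrderedRing A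
  open scoped ComplexOrder in
  obtain ⟨C, hC⟩ := PositiveLinearMap.exists_norm_apply_le (PositiveLinearMap.mk₀ φ (fun x hx => by
    obtain ⟨y, rfl⟩ := CStarAlgebra.nonneg_iff_eq_star_mul_self.mp hx
    exact hφ.nonneg y))
  exact ⟨C, hC⟩

theorem IsState.continuous {φ : A →ₗ[ℂ] ℂ} (hφ : IsState φ) : Continuous φ := by
  obtain ⟨C, hC⟩ := hφ.exists_norm_le
  exact AddMonoidHomClass.continuous_of_bound φ C hC

/-- Every self-adjoint element of a C⋆-probability space has a law. -/
theorem IsState.exists_isLaw {φ : A →ₗ[ℂ] ℂ} (hφ : IsState φ) {a : A} (ha : IsSelfAdjoint a) :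
    ∃ μ : Measure ℝ, IsLaw φ a μ := by
  open CompactlySupported in
  let Λ₀ : C_c(spectrum ℝ a, ℝ) →ₗ[ℝ] ℝ :=
    { toFun := fun f => (φ (cfcHom (R := ℝ) ha f.toContinuousMap)).re
      map_add' := fun f g => by
        have : (f + g).toContinuousMap = f.toContinuousMap + g.toContinuousMap := rfl
        rw [this, map_add, map_add, Complex.add_re]
      map_smul' := fun r f => by
        have : (r • f).toContinuousMap = r • f.toContinuousMap := rfl
        rw [this, map_smul, ← Complex.coe_smul, map_smul, smul_eq_mul, Complex.re_ofReal_mul]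
        rfl }
  open CompactlySupported in
  let Λ : C_c(spectrum ℝ a, ℝ) →ₚ[ℝ] ℝ := PositiveLinearMap.mk₀ Λ₀ (fun f hf =>
    (Complex.le_def.mp (hφ.apply_cfcHom_nonneg ha f.toContinuousMap hf)).1)
  set ν := RealRMK.rieszMeasure Λ with hν
  have hint : ∀ f : C(spectrum ℝ a, ℝ), φ (cfcHom (R := ℝ) ha f) = ((∫ x, f x ∂ν : ℝ) : ℂ) := by
    intro f
    rw [hφ.apply_cfcHom_eq_ofReal_re ha f]
    congr 1
    exact (RealRMK.integral_rieszMeasure Λ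
      (CompactlySupportedContinuousMap.continuousMapEquiv f)).symm
  have hpow : ∀ n : ℕ, φ (a ^ n) = ((∫ x : spectrum ℝ a, (x : ℝ) ^ n ∂ν : ℝ) : ℂ) := by
    intro n
    rw [← cfcHom_id_pow ha n, hint]
    rfl
  have hprob : IsProbabilityMeasure ν := by
    have h1 := hpow 0
    simp only [pow_zero, hφ.map_one, integral_const, smul_eq_mul, mul_one] at h1
    have h2 : ν.real Set.univ = 1 := by exact_mod_cast h1.symm
    refine ⟨?_⟩
    rw [Measure.real, ENNReal.toReal_eq_one_iff] at h2
    exact h2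
  refine ⟨ν.map Subtype.val, ⟨?_, spectrum ℝ a, spectrum.isCompact a, ?_⟩, fun n => ?_⟩
  · exact Measure.isProbabilityMeasure_map measurable_subtype_coe.aemeasurable
  · rw [Measure.map_apply measurable_subtype_coe (spectrum.isCompact a).measurableSet.compl]
    have : (Subtype.val ⁻¹' (spectrum ℝ a)ᶜ : Set (spectrum ℝ a)) = ∅ := by
      ext x
      simp
    rw [this, measure_empty]
  · rw [hpow, integral_map measurable_subtype_coe.aemeasurable
      (by fun_prop)]

open Filter Topology in
/-- Free cumulants depend continuously on the moments. -/
theorem tendsto_freeCumulant {φ : A →ₗ[ℂ] ℂ} (hφ : IsState φ) {α : Type*} {l : Filter α} {n : ℕ}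
    {x : α → Fin n → A} {y : Fin n → A} (h : ∀ i, Tendsto (fun t => x t i) l (𝓝 (y i))) :
    Tendsto (fun t => freeCumulant φ n (x t)) l (𝓝 (freeCumulant φ n y)) := by
  induction n using Nat.strong_induction_on with
  | _ n ih =>
    rw [freeCumulant]
    simp_rw [fun t => freeCumulant.eq_1 φ n (x t)]
    refine Tendsto.sub ?_ ?_
    · refine (hφ.continuous.tendsto _).comp ?_
      simp_rw [List.ofFn_eq_map]
      exact tendsto_list_prod _ (fun i _ => h i)
    · refine tendsto_finsetSum _ fun p _ => tendsto_finsetProd _ fun V _ => ?_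
      refine ih _ ?_ fun i => h _
      have hp := (Finset.mem_filter.mp p.2).2
      have hU : ∀ W ∈ p.1.parts, W ≠ Finset.univ := by
        rintro W hW rfl
        exact hp hW
      simpa using Finset.card_lt_card (Finset.ssubset_univ_iff.mpr (hU V.1 V.2))

end State

section Trace

theorem Matrix.trace_mul_pow_comm {R m n : Type*} [CommRing R] [Fintype m] [Fintype n]
    [DecidableEq m] [DecidableEq n] (V : Matrix m n R) (W : Matrix n m R) (k : ℕ) :
    ((V * W) ^ (k + 1)).trace = ((W * V) ^ (k + 1)).trace := by
  have h : ∀ k, (V * W) ^ (k + 1) = V * (W * V) ^ k * W := by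
    intro k
    induction k with
    | zero => simp
    | succ k ih =>
      rw [pow_succ, ih, pow_succ (W * V)]
      simp only [Matrix.mul_assoc]
  rw [h, Matrix.trace_mul_comm, ← Matrix.mul_assoc, ← pow_succ']

end Trace

section Commutators
variable {A : Type*} [CStarAlgebra A]

theorem IsWick.comp {ι κ : Type*} {φ : A →ₗ[ℂ] ℂ} {s : ι → A} {c : ι → ι → ℂ}
    (h : IsWick φ s c) (f : κ → ι) : IsWick φ (fun k => s (f k)) (fun k l => c (f k) (f l)) := by
  intro i L
  have := h (f i) (L.map f)
  rw [List.map_map] at this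
  refine this.trans ?_
  rw [List.length_map]
  refine Finset.sum_congr rfl fun k _ => ?_
  rw [List.getD_map, ← List.map_take, ← List.map_drop, List.map_map, List.map_map]
  rfl

variable {J : Type*} [Fintype J] [DecidableEq J]

/-- The coefficients of the linear combination `(i/2) ∑ⱼ wⱼ [uⱼ, vⱼ]` of commutators, as a quadratic
form in the `uⱼ` and `vⱼ`. -/
noncomputable def commMatrix (w : J → ℝ) : Matrix (J ⊕ J) (J ⊕ J) ℂ :=
  Matrix.fromBlocks 0 (Matrix.diagonal fun j => Complex.I / 2 * w j)
    (Matrix.diagonal fun j => -(Complex.I / 2 * w j)) 0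

theorem quadForm_commMatrix (w : J → ℝ) (s : J ⊕ J → A) :
    quadForm (commMatrix w) s = (Complex.I / 2) • ∑ j, (w j : ℂ) •
      (s (Sum.inl j) * s (Sum.inr j) - s (Sum.inr j) * s (Sum.inl j)) := by
  rw [quadForm, Fintype.sum_prod_type, Fintype.sum_sum_type]
  simp only [Fintype.sum_sum_type, commMatrix, Matrix.fromBlocks_apply₁₁, Matrix.fromBlocks_apply₁₂,
    Matrix.fromBlocks_apply₂₁, Matrix.fromBlocks_apply₂₂, Matrix.zero_apply, zero_smul,
    Finset.sum_const_zero, zero_add, add_zero, Matrix.diagonal_apply, ite_smul,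
    Finset.sum_ite_eq, Finset.mem_univ, if_true]
  rw [← Finset.sum_add_distrib, Finset.smul_sum]
  refine Finset.sum_congr rfl fun j _ => ?_
  rw [smul_smul, smul_sub, neg_smul, sub_eq_add_neg]

theorem conjTranspose_mul_commMatrix_mul {P : Type*} (w : J → ℝ) (V : Matrix (J ⊕ J) P ℂ) (p q : P) :
    (V.conjTranspose * commMatrix w * V) p q = Complex.I / 2 * ∑ j, (w j : ℂ) *
      (star (V (Sum.inl j) p) * V (Sum.inr j) q - star (V (Sum.inr j) p) * V (Sum.inl j) q) := by
  rw [Matrix.mul_apply, Fintype.sum_sum_type]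
  simp only [Matrix.mul_apply, Fintype.sum_sum_type, commMatrix, Matrix.fromBlocks_apply₁₁,
    Matrix.fromBlocks_apply₁₂, Matrix.fromBlocks_apply₂₁, Matrix.fromBlocks_apply₂₂,
    Matrix.zero_apply, mul_zero, Finset.sum_const_zero, zero_add, add_zero,
    Matrix.diagonal_apply, mul_ite, Finset.sum_ite_eq', Finset.mem_univ, if_true,
    Matrix.conjTranspose_apply]
  rw [← Finset.sum_add_distrib, Finset.mul_sum]
  refine Finset.sum_congr rfl fun j _ => ?_
  ring

end Commutators

section RootsOfUnity

theorem sum_pow_range_of_pow_eq_one {z : ℂ} {N : ℕ} (hz : z ^ N = 1) :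
    ∑ k ∈ Finset.range N, z ^ k = if z = 1 then (N : ℂ) else 0 := by
  split_ifs with h
  · simp [h]
  · have := geom_sum_mul z N
    rw [hz, sub_self] at this
    exact (mul_eq_zero.mp this).resolve_right (sub_ne_zero.mpr h)

theorem sum_range_commutator {a b : ℂ} {N : ℕ} (ha : a ^ N = 1) (hb : b ^ N = 1) (ha1 : a ≠ 1)
    (hb1 : b ≠ 1) :
    ∑ k ∈ Finset.range N, ((a ^ k - 1) * (b ^ (k + 1) - 1) - (a ^ (k + 1) - 1) * (b ^ k - 1)) =
      if a * b = 1 then N * (b - a) else 0 := by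
  have h1 : ∀ k ∈ Finset.range N,
      (a ^ k - 1) * (b ^ (k + 1) - 1) - (a ^ (k + 1) - 1) * (b ^ k - 1) =
      (a * b) ^ k * (b - a) + (a - 1) * a ^ k - (b - 1) * b ^ k := by
    intro k _
    rw [mul_pow]
    ring
  rw [Finset.sum_congr rfl h1, Finset.sum_sub_distrib, Finset.sum_add_distrib, ← Finset.sum_mul,
    ← Finset.mul_sum, ← Finset.mul_sum, sum_pow_range_of_pow_eq_one ha,
    sum_pow_range_of_pow_eq_one hb, if_neg ha1, if_neg hb1,
    sum_pow_range_of_pow_eq_one (by rw [mul_pow, ha, hb, one_mul])]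
  split_ifs <;> ring

theorem sum_range_geom_mul_geom {ω : ℂ} {N : ℕ} (hω : IsPrimitiveRoot ω N) {k l : ℕ} (hk : k ≤ N)
    (hl : l ≤ N) :
    ∑ p ∈ Finset.range N, (∑ i ∈ Finset.range k, (ω ^ p) ^ i) *
      (∑ j ∈ Finset.range l, (ω⁻¹ ^ p) ^ j) = N * (min k l : ℕ) := by
  have h1 : ∀ p, (∑ i ∈ Finset.range k, (ω ^ p) ^ i) * (∑ j ∈ Finset.range l, (ω⁻¹ ^ p) ^ j) =
      ∑ i ∈ Finset.range k, ∑ j ∈ Finset.range l, (ω ^ i * ω⁻¹ ^ j) ^ p := by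
    intro p
    rw [Finset.sum_mul_sum]
    refine Finset.sum_congr rfl fun i _ => Finset.sum_congr rfl fun j _ => ?_
    rw [mul_pow, ← pow_mul, ← pow_mul, ← pow_mul, ← pow_mul, mul_comm i, mul_comm j]
  simp_rw [h1]
  rw [Finset.sum_comm]
  have h2 : ∀ i ∈ Finset.range k, ∑ p ∈ Finset.range N, ∑ j ∈ Finset.range l,
      (ω ^ i * ω⁻¹ ^ j) ^ p = if i < l then (N : ℂ) else 0 := by
    intro i hi
    have hi := (Finset.mem_range.mp hi).trans_le hk
    rw [Finset.sum_comm]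
    have h3 : ∀ j ∈ Finset.range l, ∑ p ∈ Finset.range N, (ω ^ i * ω⁻¹ ^ j) ^ p =
        if i = j then (N : ℂ) else 0 := by
      intro j hj
      have hj := (Finset.mem_range.mp hj).trans_le hl
      rw [sum_pow_range_of_pow_eq_one]
      · have hω0 : ω ^ j ≠ 0 := pow_ne_zero _ (hω.ne_zero (by omega))
        have : ω ^ i * ω⁻¹ ^ j = 1 ↔ i = j := by
          rw [inv_pow, mul_inv_eq_one₀ hω0]
          exact ⟨fun h => hω.pow_inj hi hj h, fun h => h ▸ rfl⟩
        simp only [this]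
      · rw [mul_pow, ← pow_mul, ← pow_mul, mul_comm i, mul_comm j, pow_mul, pow_mul, inv_pow,
          hω.pow_eq_one]
        simp
    rw [Finset.sum_congr rfl h3, Finset.sum_ite_eq]
    simp only [Finset.mem_range]
  rw [Finset.sum_congr rfl h2, ← Finset.sum_filter]
  have h4 : (Finset.range k).filter (· < l) = Finset.range (min k l) := by
    ext i
    simp
  rw [h4, Finset.sum_const, Finset.card_range, nsmul_eq_mul, mul_comm]

end RootsOfUnity

section Uniform
variable {A : Type*} [CStarAlgebra A]

theorem levyAreaSum_eq_quadForm (β : ℝ → A) (n : ℕ) (t : ℕ → ℝ) :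
    levyAreaSum β n t = quadForm (commMatrix fun _ : Fin n => 1)
      (fun x => β (Sum.elim (fun j : Fin n => t j) (fun j : Fin n => t (j + 1)) x)) := by
  rw [quadForm_commMatrix, levyAreaSum, Finset.sum_range]
  congr 1
  refine Finset.sum_congr rfl fun j _ => ?_
  simp only [Sum.elim_inl, Sum.elim_inr, Complex.ofReal_one, one_smul]
  noncomm_ring

/-- The eigenvalues of the Lévy area form of the uniform partition. -/
noncomputable def areaEigenvalue (N : ℕ) (p : ℕ) : ℝ :=
  -(Real.pi / N * (Real.cos (Real.pi * p / N) / Real.sin (Real.pi * p / N)))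

open Complex in
theorem areaEigenvalue_eq {N p : ℕ} (hp : 0 < p) (hpN : p < N) :
    (areaEigenvalue N p : ℂ) = -(I / 2 * (2 * Real.pi / N)) *
      (exp (2 * Real.pi * I / N) ^ p + 1) / (exp (2 * Real.pi * I / N) ^ p - 1) := by
  have hN : (0 : ℝ) < N := by exact_mod_cast hp.trans hpN
  have hN' : (N : ℂ) ≠ 0 := by exact_mod_cast hN.ne'
  set x : ℝ := Real.pi * p / N with hx
  have hs : Real.sin x ≠ 0 := by
    apply (Real.sin_pos_of_pos_of_lt_pi _ _).ne'
    · have : (0 : ℝ) < p := by exact_mod_cast hp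
      positivity
    · rw [hx, div_lt_iff₀ hN]
      have : (p : ℝ) < N := by exact_mod_cast hpN
      exact mul_lt_mul_of_pos_left this Real.pi_pos
  have he : exp (2 * Real.pi * I / N) ^ p = exp (x * I) * exp (x * I) := by
    rw [← exp_nat_mul, ← exp_add]
    congr 1
    rw [hx]
    push_cast
    field_simp
    ring
  have hs' : (Real.sin x : ℂ) ≠ 0 := by exact_mod_cast hs
  have h1 : exp (x * I) = Real.cos x + Real.sin x * I := by
    rw [exp_mul_I, ofReal_cos, ofReal_sin]
  have hcs : (Real.cos x : ℂ) ^ 2 + (Real.sin x : ℂ) ^ 2 = 1 := by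
    exact_mod_cast Real.cos_sq_add_sin_sq x
  have h2 : exp (x * I) * exp (x * I) - 1 = 2 * I * Real.sin x * exp (x * I) := by
    rw [h1]
    linear_combination hcs - (Real.sin x : ℂ) ^ 2 * I_sq
  have h3 : exp (x * I) * exp (x * I) + 1 = 2 * Real.cos x * exp (x * I) := by
    rw [h1]
    linear_combination (-1 : ℂ) * hcs + (Real.sin x : ℂ) ^ 2 * I_sq
  rw [he, h2, h3, areaEigenvalue]
  have h4 := exp_ne_zero (x * I)
  rw [← hx]
  simp only [ofReal_neg, ofReal_mul, ofReal_div, ofReal_natCast]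
  field_simp

open Complex in
theorem freeCumulant_levyAreaSum_uniform {φ : A →ₗ[ℂ] ℂ} (hφ : IsState φ) {β : ℝ → A}
    (hβ : IsFreeBrownianBridge φ (2 * Real.pi) β) (n m : ℕ) :
    freeCumulant φ (m + 1)
      (fun _ => levyAreaSum β (n + 1) fun k => k * (2 * Real.pi / (n + 1 : ℕ))) =
      ∑ p ∈ Finset.range n, (areaEigenvalue (n + 1) (p + 1) : ℂ) ^ (m + 1) := by
  set N : ℕ := n + 1 with hNdef
  have hN0 : N ≠ 0 := Nat.succ_ne_zero n
  have hN : (0 : ℝ) < N := by positivity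
  have hNC : (N : ℂ) ≠ 0 := by exact_mod_cast hN0
  set h : ℝ := 2 * Real.pi / N with hh
  set kidx : Fin N ⊕ Fin N → ℕ := Sum.elim (fun j => j) (fun j => j + 1) with hkidx
  have hkN : ∀ x, kidx x ≤ N := by
    rintro (j | j)
    · exact j.2.le
    · exact j.2
  have htime : ∀ x, (kidx x : ℝ) * h ∈ Set.Icc (0 : ℝ) (2 * Real.pi) := by
    intro x
    have hx : (kidx x : ℝ) ≤ N := by exact_mod_cast hkN x
    have hpos : 0 ≤ h := by positivity
    refine ⟨by positivity, (mul_le_mul_of_nonneg_right hx hpos).trans_eq ?_⟩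
    rw [hh]
    field_simp
  set c : Matrix (Fin N ⊕ Fin N) (Fin N ⊕ Fin N) ℂ := fun x y =>
    ((min ((kidx x : ℝ) * h) (kidx y * h) - kidx x * h * (kidx y * h) / (2 * Real.pi) : ℝ) : ℂ)
    with hc
  have hW : IsWick φ (fun x => β (kidx x * h)) c :=
    (hβ.isWick hφ).comp (fun x => (⟨kidx x * h, htime x⟩ : Set.Icc (0 : ℝ) (2 * Real.pi)))
  have hcs : c.IsSymm := by
    refine Matrix.IsSymm.ext fun x y => ?_
    simp only [hc]
    rw [min_comm, mul_comm (kidx y * h : ℝ)]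
  have hS : levyAreaSum β N (fun k => k * h) =
      quadForm (commMatrix fun _ => 1) (fun x => β (kidx x * h)) := by
    rw [levyAreaSum_eq_quadForm]
    congr 1
    funext x
    rcases x with j | j <;> simp [hkidx]
  rw [hS, hW.freeCumulant_quadForm hφ hcs]
  set ω : ℂ := exp (2 * Real.pi * I / N) with hω
  have hprim : IsPrimitiveRoot ω N := isPrimitiveRoot_exp N hN0
  have hω0 : ω ≠ 0 := hprim.ne_zero hN0
  have hstar : ∀ k : ℕ, star (ω ^ k) = ω⁻¹ ^ k := by
    intro k
    rw [star_pow]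
    congr 1
    rw [hω, ← exp_neg]
    change (starRingEnd ℂ) _ = _
    rw [← exp_conj]
    congr 1
    simp only [map_div₀, map_mul, conj_ofReal, conj_I, map_natCast, map_ofNat]
    ring
  have hne : ∀ p : Fin n, ω ^ ((p : ℕ) + 1) ≠ 1 := fun p =>
    hprim.pow_ne_one_of_pos_of_lt (Nat.succ_ne_zero _) (by omega)
  have hne' : ∀ p : Fin n, ω⁻¹ ^ ((p : ℕ) + 1) ≠ 1 := fun p => by
    rw [inv_pow, inv_ne_one]
    exact hne p
  have hpow : ∀ p : ℕ, (ω ^ p) ^ N = 1 := fun p => by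
    rw [← pow_mul, mul_comm, pow_mul, hprim.pow_eq_one, one_pow]
  have hpow' : ∀ p : ℕ, (ω⁻¹ ^ p) ^ N = 1 := fun p => by
    rw [inv_pow, inv_pow, hpow, inv_one]
  set r : ℝ := Real.sqrt (2 * Real.pi) / N with hr
  have hr2 : (r : ℂ) * r = 2 * Real.pi / N ^ 2 := by
    have : r * r = 2 * Real.pi / N ^ 2 := by
      rw [hr, div_mul_div_comm, Real.mul_self_sqrt (by positivity), pow_two]
    exact_mod_cast this
  let V : Matrix (Fin N ⊕ Fin N) (Fin n) ℂ := fun x p =>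
    r * (((ω ^ ((p : ℕ) + 1)) ^ kidx x - 1) / (ω ^ ((p : ℕ) + 1) - 1))
  have hVs : ∀ x p, star (V x p) =
      r * (((ω⁻¹ ^ ((p : ℕ) + 1)) ^ kidx x - 1) / (ω⁻¹ ^ ((p : ℕ) + 1) - 1)) := by
    intro x p
    simp only [V, star_mul', star_div₀, star_sub, star_one, star_pow (ω ^ _), hstar]
    congr 1
    exact conj_ofReal r
  have hcV : c = V * V.conjTranspose := by
    ext x y
    rw [Matrix.mul_apply]
    have h1 := sum_range_geom_mul_geom hprim (hkN x) (hkN y)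
    rw [hNdef, Finset.sum_range_succ', ← hNdef] at h1
    simp only [pow_zero, one_pow, Finset.sum_const, Finset.card_range, nsmul_eq_mul, mul_one] at h1
    have h2 : ∀ p : Fin n, V x p * V.conjTranspose p y = (r * r) *
        ((∑ i ∈ Finset.range (kidx x), (ω ^ ((p : ℕ) + 1)) ^ i) *
          ∑ j ∈ Finset.range (kidx y), (ω⁻¹ ^ ((p : ℕ) + 1)) ^ j) := by
      intro p
      rw [Matrix.conjTranspose_apply, hVs, geom_sum_eq (hne p), geom_sum_eq (hne' p)]
      ring
    rw [Finset.sum_congr rfl fun p _ => h2 p, ← Finset.mul_sum,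
      ← Finset.sum_range (fun p => (∑ i ∈ Finset.range (kidx x), (ω ^ (p + 1)) ^ i) *
          ∑ j ∈ Finset.range (kidx y), (ω⁻¹ ^ (p + 1)) ^ j), eq_sub_of_add_eq h1, hr2]
    have hmin : min ((kidx x : ℝ) * h) (kidx y * h) = (min (kidx x) (kidx y) : ℕ) * h := by
      rw [← min_mul_of_nonneg _ _ (by positivity : 0 ≤ h), Nat.cast_min]
    simp only [hc]
    rw [hmin, hh]
    simp only [ofReal_sub, ofReal_mul, ofReal_div, ofReal_natCast, ofReal_ofNat]
    have hpi : (Real.pi : ℂ) ≠ 0 := by exact_mod_cast Real.pi_ne_zero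
    field_simp
  have hdiag : V.conjTranspose * commMatrix (fun _ : Fin N => (1 : ℝ)) * V =
      Matrix.diagonal fun p : Fin n => (areaEigenvalue N (p + 1) : ℂ) := by
    ext p q
    rw [conjTranspose_mul_commMatrix_mul, Matrix.diagonal_apply]
    have h1 := sum_range_commutator (hpow' ((p : ℕ) + 1)) (hpow ((q : ℕ) + 1)) (hne' p) (hne q)
    have h2 : ∀ j : Fin N, ((1 : ℝ) : ℂ) * (star (V (Sum.inl j) p) * V (Sum.inr j) q -
        star (V (Sum.inr j) p) * V (Sum.inl j) q) =
        (r * r) / ((ω⁻¹ ^ ((p : ℕ) + 1) - 1) * (ω ^ ((q : ℕ) + 1) - 1)) *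
        (((ω⁻¹ ^ ((p : ℕ) + 1)) ^ (j : ℕ) - 1) * ((ω ^ ((q : ℕ) + 1)) ^ ((j : ℕ) + 1) - 1) -
          ((ω⁻¹ ^ ((p : ℕ) + 1)) ^ ((j : ℕ) + 1) - 1) * ((ω ^ ((q : ℕ) + 1)) ^ (j : ℕ) - 1)) := by
      intro j
      rw [hVs, hVs]
      simp only [V, hkidx, Sum.elim_inl, Sum.elim_inr, ofReal_one, one_mul]
      have e1 := sub_ne_zero.mpr (hne' p)
      have e2 := sub_ne_zero.mpr (hne q)
      field_simp
    rw [Finset.sum_congr rfl fun j _ => h2 j, ← Finset.mul_sum,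
      ← Finset.sum_range (fun j => ((ω⁻¹ ^ ((p : ℕ) + 1)) ^ j - 1) *
        ((ω ^ ((q : ℕ) + 1)) ^ (j + 1) - 1) -
          ((ω⁻¹ ^ ((p : ℕ) + 1)) ^ (j + 1) - 1) * ((ω ^ ((q : ℕ) + 1)) ^ j - 1)), h1]
    have hpq : ω⁻¹ ^ ((p : ℕ) + 1) * ω ^ ((q : ℕ) + 1) = 1 ↔ p = q := by
      rw [inv_pow, inv_mul_eq_one₀ (pow_ne_zero _ hω0)]
      constructor
      · intro h
        have := hprim.pow_inj (by omega) (by omega) h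
        exact Fin.ext (by omega)
      · rintro rfl
        rfl
    simp only [hpq]
    split_ifs with hpq'
    · subst hpq'
      rw [areaEigenvalue_eq (Nat.succ_pos _) (by omega), ← hω, hr2]
      have e1 := sub_ne_zero.mpr (hne p)
      have e0 : ω ^ ((p : ℕ) + 1) ≠ 0 := pow_ne_zero _ hω0
      rw [inv_pow]
      generalize ω ^ ((p : ℕ) + 1) = a at *
      have e2 : a⁻¹ - 1 ≠ 0 := by
        rw [sub_ne_zero, inv_ne_one]
        exact sub_ne_zero.mp e1
      have e3 : 1 - a ≠ 0 := by
        rw [← neg_sub]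
        exact neg_ne_zero.mpr e1
      rw [show a⁻¹ - 1 = (1 - a) / a by field_simp]
      field_simp
      ring
    · rw [mul_zero, mul_zero]
  rw [hcV, Matrix.mul_assoc, Matrix.trace_mul_pow_comm, hdiag, Matrix.diagonal_pow,
    Matrix.trace_diagonal, Finset.sum_range]
  rfl

end Uniform

section Limit
variable {A : Type*} [CStarAlgebra A]

open Filter Topology

theorem IsLevyArea.tendsto_uniform {β : ℝ → A} {T : ℝ} (hT : 0 < T) {ℓ : A}
    (h : IsLevyArea β T ℓ) :
    Tendsto (fun n : ℕ => levyAreaSum β (n + 1) fun k => k * (T / (n + 1 : ℕ))) atTop (𝓝 ℓ) := by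
  rw [Metric.tendsto_atTop]
  intro ε hε
  obtain ⟨δ, hδ, hs⟩ := h ε hε
  obtain ⟨n₀, hn₀⟩ := exists_nat_gt (T / δ)
  refine ⟨n₀, fun n hn => ?_⟩
  have hn' : (0 : ℝ) < (n + 1 : ℕ) := by positivity
  rw [dist_eq_norm]
  refine hs (n + 1) _ ?_ (by simp) (by field_simp) ?_
  · intro i j hij
    have : (i : ℝ) ≤ j := by exact_mod_cast hij
    exact mul_le_mul_of_nonneg_right this (by positivity)
  · intro k _
    have : ((k + 1 : ℕ) : ℝ) * (T / (n + 1 : ℕ)) - k * (T / (n + 1 : ℕ)) = T / (n + 1 : ℕ) := by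
      push_cast
      ring
    rw [this, div_lt_iff₀ hn', ← div_lt_iff₀' hδ]
    refine hn₀.trans_le ?_
    exact_mod_cast hn.trans (Nat.le_succ n)

theorem isSelfAdjoint_levyAreaSum {β : ℝ → A} {n : ℕ} {t : ℕ → ℝ}
    (h : ∀ k ≤ n, IsSelfAdjoint (β (t k))) : IsSelfAdjoint (levyAreaSum β n t) := by
  rw [IsSelfAdjoint, levyAreaSum, star_smul, star_sum]
  have h2 : star (Complex.I / 2) = -(Complex.I / 2) := by
    rw [star_div₀]
    simp [neg_div]
  rw [h2, neg_smul, ← smul_neg, ← Finset.sum_neg_distrib]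
  congr 1
  refine Finset.sum_congr rfl fun k hk => ?_
  have hk := Finset.mem_range.mp hk
  simp only [star_sub, star_mul, (h k hk.le).star_eq, (h (k + 1) hk).star_eq]
  rw [neg_sub]

theorem areaEigenvalue_reflect {N p : ℕ} (hN : 0 < N) (hp : p ≤ N) :
    areaEigenvalue N (N - p) = -areaEigenvalue N p := by
  have hN' : (N : ℝ) ≠ 0 := by exact_mod_cast hN.ne'
  have : Real.pi * ((N - p : ℕ) : ℝ) / N = Real.pi - Real.pi * p / N := by
    rw [Nat.cast_sub hp]
    field_simp
  rw [areaEigenvalue, areaEigenvalue, this, Real.cos_pi_sub, Real.sin_pi_sub]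
  ring

theorem sum_areaEigenvalue (K m : ℕ) :
    ∑ p ∈ Finset.range (2 * K), areaEigenvalue (2 * K + 1) (p + 1) ^ m =
      ∑ p ∈ Finset.range K, (areaEigenvalue (2 * K + 1) (p + 1) ^ m +
        (-areaEigenvalue (2 * K + 1) (p + 1)) ^ m) := by
  rw [two_mul, Finset.sum_range_add, Finset.sum_add_distrib]
  congr 1
  rw [← Finset.sum_range_reflect]
  refine Finset.sum_congr rfl fun p hp => ?_
  have hp := Finset.mem_range.mp hp
  rw [← areaEigenvalue_reflect (Nat.succ_pos _) (by omega)]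
  congr 2
  omega

theorem areaEigenvalue_eq_sinc {N p : ℕ} (hN : 0 < N) (hp : 0 < p) :
    areaEigenvalue N p =
      -(1 / p * (Real.cos (Real.pi * p / N) / Real.sinc (Real.pi * p / N))) := by
  have hN' : (N : ℝ) ≠ 0 := by exact_mod_cast hN.ne'
  have hp' : (p : ℝ) ≠ 0 := by exact_mod_cast hp.ne'
  have hx : Real.pi * p / N ≠ 0 := by
    have := Real.pi_ne_zero
    positivity
  rw [areaEigenvalue, Real.sinc_of_ne_zero hx]
  field_simp

theorem tendsto_areaEigenvalue (p : ℕ) :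
    Tendsto (fun K : ℕ => areaEigenvalue (2 * K + 1) (p + 1)) atTop (𝓝 (-(1 / ((p : ℝ) + 1)))) := by
  have hx : Tendsto (fun K : ℕ => Real.pi * ((p + 1 : ℕ) : ℝ) / ((2 * K + 1 : ℕ) : ℝ)) atTop
      (𝓝 0) := by
    refine Tendsto.div_atTop tendsto_const_nhds ?_
    refine tendsto_natCast_atTop_atTop.comp ?_
    exact tendsto_atTop_mono (fun K => by simp only [id]; omega) tendsto_id
  have h1 : Tendsto (fun x => Real.cos x / Real.sinc x) (𝓝 0) (𝓝 1) := by
    have : ContinuousAt (fun x => Real.cos x / Real.sinc x) 0 :=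
      Real.continuous_cos.continuousAt.div Real.continuous_sinc.continuousAt (by simp)
    have h := this.tendsto
    simpa using h
  have h2 := ((h1.comp hx).const_mul (1 / (((p + 1 : ℕ) : ℝ)))).neg
  rw [mul_one] at h2
  push_cast at h2
  refine h2.congr fun K => ?_
  rw [areaEigenvalue_eq_sinc (Nat.succ_pos _) (Nat.succ_pos _)]
  simp

theorem abs_areaEigenvalue_le {K p : ℕ} (hp : p < K) :
    |areaEigenvalue (2 * K + 1) (p + 1)| ≤ 1 / ((p : ℝ) + 1) := by
  rw [areaEigenvalue, abs_neg]
  have hN : (0 : ℝ) < (2 * K + 1 : ℕ) := by positivity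
  set x : ℝ := Real.pi * ((p + 1 : ℕ) : ℝ) / (2 * K + 1 : ℕ) with hx
  have hx0 : 0 < x := by
    have := Real.pi_pos
    positivity
  have hx1 : x < Real.pi / 2 := by
    rw [hx, div_lt_iff₀ hN]
    have h1 : ((p + 1 : ℕ) : ℝ) ≤ K := by exact_mod_cast hp
    have := Real.pi_pos
    push_cast at *
    nlinarith
  have hc : 0 < Real.cos x := Real.cos_pos_of_mem_Ioo ⟨by linarith, hx1⟩
  have hs : 0 < Real.sin x := Real.sin_pos_of_pos_of_lt_pi hx0 (by linarith [Real.pi_pos])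
  have ht := Real.le_tan hx0.le hx1
  rw [Real.tan_eq_sin_div_cos, le_div_iff₀ hc] at ht
  have hpi : Real.pi / (2 * K + 1 : ℕ) = x / ((p : ℝ) + 1) := by
    rw [hx]
    push_cast
    field_simp
  rw [hpi, abs_of_nonneg (by positivity), div_mul_div_comm, div_le_div_iff₀ (by positivity)
    (by positivity)]
  have : 0 < (p : ℝ) + 1 := by positivity
  nlinarith

theorem tendsto_sum_areaEigenvalue {m : ℕ} (hm : 1 < m) (heven : Even m) :
    Tendsto (fun K : ℕ => ∑ p ∈ Finset.range (2 * K), areaEigenvalue (2 * K + 1) (p + 1) ^ m) atTop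
      (𝓝 (2 * ∑' p : ℕ, (1 / ((p : ℝ) + 1)) ^ m)) := by
  have hsum : Summable fun p : ℕ => (1 / ((p : ℝ) + 1)) ^ m := by
    have := (summable_nat_add_iff 1).mpr (Real.summable_one_div_nat_pow.mpr hm)
    refine this.congr fun p => ?_
    push_cast
    rw [one_div_pow]
  have h := tendsto_tsum_of_dominated_convergence
    (f := fun (K : ℕ) (p : ℕ) => if p < K then areaEigenvalue (2 * K + 1) (p + 1) ^ m else 0)
    (𝓕 := atTop) (g := fun p => (1 / ((p : ℝ) + 1)) ^ m) hsum ?_ ?_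
  · refine (h.const_mul 2).congr fun K => ?_
    rw [sum_areaEigenvalue, tsum_eq_sum (s := Finset.range K) (fun p hp => if_neg (by simpa using hp)),
      Finset.mul_sum]
    refine Finset.sum_congr rfl fun p hp => ?_
    rw [if_pos (Finset.mem_range.mp hp), heven.neg_pow, two_mul]
  · intro p
    have h1 := (tendsto_areaEigenvalue p).pow m
    rw [heven.neg_pow] at h1
    refine h1.congr' ?_
    filter_upwards [eventually_gt_atTop p] with K hK
    rw [if_pos hK]
  · refine Eventually.of_forall fun K p => ?_
    split_ifs with hp
    · rw [norm_pow, Real.norm_eq_abs]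
      exact pow_le_pow_left₀ (abs_nonneg _) (abs_areaEigenvalue_le hp) m
    · rw [norm_zero]
      positivity

theorem IsLevyArea.tendsto_sum {φ : A →ₗ[ℂ] ℂ} (hφ : IsState φ) {β : ℝ → A}
    (hβ : IsFreeBrownianBridge φ (2 * Real.pi) β) {ℓ : A} (hℓ : IsLevyArea β (2 * Real.pi) ℓ)
    {m : ℕ} (hm : 0 < m) :
    Tendsto (fun K : ℕ =>
      ((∑ p ∈ Finset.range (2 * K), areaEigenvalue (2 * K + 1) (p + 1) ^ m : ℝ) : ℂ)) atTop
      (𝓝 (freeCumulant φ m fun _ => ℓ)) := by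
  obtain ⟨m, rfl⟩ : ∃ k, m = k + 1 := ⟨m - 1, by omega⟩
  have h1 := hℓ.tendsto_uniform Real.two_pi_pos
  have h2 : Tendsto (fun K : ℕ => 2 * K) atTop atTop :=
    tendsto_atTop_mono (fun K => by simp only [id]; omega) tendsto_id
  have h3 := tendsto_freeCumulant hφ (n := m + 1) (y := fun _ => ℓ) (fun _ => h1.comp h2)
  refine h3.congr fun K => ?_
  rw [Complex.ofReal_sum]
  simp only [Complex.ofReal_pow]
  exact freeCumulant_levyAreaSum_uniform hφ hβ (2 * K) m

theorem IsLevyArea.freeCumulant_odd {φ : A →ₗ[ℂ] ℂ} (hφ : IsState φ) {β : ℝ → A}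
    (hβ : IsFreeBrownianBridge φ (2 * Real.pi) β) {ℓ : A} (hℓ : IsLevyArea β (2 * Real.pi) ℓ)
    {m : ℕ} (hm : Odd m) : freeCumulant φ m (fun _ => ℓ) = 0 := by
  refine tendsto_nhds_unique (hℓ.tendsto_sum hφ hβ hm.pos) ?_
  refine tendsto_const_nhds.congr fun K => ?_
  rw [sum_areaEigenvalue, Finset.sum_eq_zero]
  · simp
  · intro p _
    rw [hm.neg_pow, add_neg_cancel]

theorem IsLevyArea.freeCumulant_even {φ : A →ₗ[ℂ] ℂ} (hφ : IsState φ) {β : ℝ → A}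
    (hβ : IsFreeBrownianBridge φ (2 * Real.pi) β) {ℓ : A} (hℓ : IsLevyArea β (2 * Real.pi) ℓ)
    {m : ℕ} (hm : 0 < m) (heven : Even m) :
    freeCumulant φ m (fun _ => ℓ) = ((2 * ∑' p : ℕ, (1 / ((p : ℝ) + 1)) ^ m : ℝ) : ℂ) := by
  have hm1 : 1 < m := by
    obtain ⟨k, rfl⟩ := heven
    omega
  exact tendsto_nhds_unique (hℓ.tendsto_sum hφ hβ hm)
    ((Complex.continuous_ofReal.tendsto _).comp (tendsto_sum_areaEigenvalue hm1 heven))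

theorem ofReal_tsum_eq_riemannZeta {m : ℕ} (hm : 1 < m) :
    ((∑' p : ℕ, (1 / ((p : ℝ) + 1)) ^ m : ℝ) : ℂ) = riemannZeta m := by
  rw [zeta_nat_eq_tsum_of_gt_one hm, Complex.ofReal_tsum]
  have hs : Summable fun n : ℕ => 1 / (n : ℂ) ^ m := by
    rw [← summable_norm_iff]
    refine (Real.summable_one_div_nat_pow.mpr hm).congr fun n => ?_
    simp
  rw [hs.tsum_eq_zero_add]
  simp only [Nat.cast_zero, zero_pow (by omega : m ≠ 0), div_zero, zero_add]
  refine tsum_congr fun p => ?_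
  push_cast
  rw [one_div_pow]

open Complex in
/-- The expansion of the cotangent at the origin. -/
theorem hasSum_cot {z : ℂ} (h0 : 0 < ‖z‖) (h1 : ‖z‖ < 1) :
    HasSum (fun j : ℕ => ((2 * ∑' p : ℕ, (1 / ((p : ℝ) + 1)) ^ (2 * j + 2) : ℝ) : ℂ) *
      z ^ (2 * j + 1)) (1 / z - Real.pi * Complex.cot (Real.pi * z)) := by
  have hz0 : z ≠ 0 := norm_pos_iff.mp h0
  have hz : z ∈ integerComplement := by
    rintro ⟨n, rfl⟩
    rw [Complex.norm_intCast] at h0 h1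
    have h0' : 0 < |n| := by exact_mod_cast h0
    have h1' : |n| < 1 := by exact_mod_cast h1
    omega
  set F : ℕ → ℕ → ℂ := fun p j => 2 * z ^ (2 * j + 1) * (1 / ((p : ℂ) + 1)) ^ (2 * j + 2) with hF
  have hnorm : ∀ p : ℕ, ‖1 / ((p : ℂ) + 1)‖ = 1 / ((p : ℝ) + 1) := by
    intro p
    rw [norm_div, norm_one]
    congr 1
    exact_mod_cast Complex.norm_natCast (p + 1)
  have hle : ∀ p : ℕ, 1 / ((p : ℝ) + 1) ≤ 1 := by
    intro p
    rw [div_le_one (by positivity)]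
    have : (0 : ℝ) ≤ p := by positivity
    linarith
  have hFs : Summable fun x : ℕ × ℕ => F x.1 x.2 := by
    have s1 : Summable fun p : ℕ => (1 / ((p : ℝ) + 1)) ^ 2 := by
      have := (summable_nat_add_iff 1).mpr (Real.summable_one_div_nat_pow.mpr one_lt_two)
      refine this.congr fun p => ?_
      push_cast
      rw [one_div_pow]
    have s2 : Summable fun j : ℕ => 2 * ‖z‖ ^ (2 * j + 1) := by
      have : Summable fun j : ℕ => (2 * ‖z‖) * (‖z‖ ^ 2) ^ j :=
        (summable_geometric_of_lt_one (by positivity) (by nlinarith)).mul_left _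
      refine this.congr fun j => ?_
      rw [← pow_mul]
      ring
    refine Summable.of_norm_bounded (s1.mul_of_nonneg s2 (fun _ => by positivity)
      (fun _ => by positivity)) ?_
    rintro ⟨p, j⟩
    simp only [hF]
    rw [norm_mul, norm_mul, norm_pow, norm_pow, hnorm, mul_comm]
    have : ‖(2 : ℂ)‖ = 2 := by simp
    rw [this]
    refine mul_le_mul_of_nonneg_right ?_ (by positivity)
    exact pow_le_pow_of_le_one (by positivity) (hle p) (by omega)
  have hrow : ∀ p : ℕ, HasSum (F p) (-(1 / (z - (p + 1)) + 1 / (z + (p + 1)))) := by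
    intro p
    have hp : ((p : ℂ) + 1) ≠ 0 := by exact_mod_cast Nat.succ_ne_zero p
    set q : ℂ := 1 / ((p : ℂ) + 1) with hq
    have hqz : ‖(z * q) ^ 2‖ < 1 := by
      rw [norm_pow, norm_mul, hnorm]
      have h3 : ‖z‖ * (1 / ((p : ℝ) + 1)) < 1 :=
        (mul_le_of_le_one_right (norm_nonneg _) (hle p)).trans_lt h1
      exact pow_lt_one₀ (by positivity) h3 two_ne_zero
    have h := (hasSum_geometric_of_norm_lt_one hqz).mul_left (2 * z * q ^ 2)
    have hfun : (fun j : ℕ => 2 * z * q ^ 2 * ((z * q) ^ 2) ^ j) = F p := by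
      funext j
      simp only [hF]
      rw [← pow_mul, mul_pow]
      ring
    rw [hfun] at h
    have e1 : z - (p + 1) ≠ 0 := by
      intro h0
      exact hz ⟨p + 1, by push_cast; linear_combination -h0⟩
    have e2 : z + (p + 1) ≠ 0 := by
      intro h0
      exact hz ⟨-(p + 1), by push_cast; linear_combination -h0⟩
    have e3 : 1 - (z * q) ^ 2 ≠ 0 := by
      intro h0
      rw [sub_eq_zero] at h0
      rw [← h0, norm_one] at hqz
      exact lt_irrefl _ hqz
    have e4 : 1 - (z * q) ^ 2 = -((z - (p + 1)) * (z + (p + 1))) * q ^ 2 := by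
      rw [hq]
      field_simp
      ring
    have hq0 : q ≠ 0 := by
      rw [hq]
      exact one_div_ne_zero hp
    have e5 : 2 * z * q ^ 2 * (1 - (z * q) ^ 2)⁻¹ =
        -(1 / (z - (p + 1)) + 1 / (z + (p + 1))) := by
      rw [e4]
      field_simp
      ring
    rwa [e5] at h
  have hcol : ∀ j : ℕ, HasSum (fun p => F p j)
      (((2 * ∑' p : ℕ, (1 / ((p : ℝ) + 1)) ^ (2 * j + 2) : ℝ) : ℂ) * z ^ (2 * j + 1)) := by
    intro j
    have s1 : Summable fun p : ℕ => (1 / ((p : ℝ) + 1)) ^ (2 * j + 2) := by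
      have := (summable_nat_add_iff 1).mpr
        (Real.summable_one_div_nat_pow.mpr (by omega : 1 < 2 * j + 2))
      refine this.congr fun p => ?_
      push_cast
      rw [one_div_pow]
    have h := (Complex.hasSum_ofReal.mpr s1.hasSum).mul_left (2 * z ^ (2 * j + 1))
    have e1 : (fun p : ℕ => 2 * z ^ (2 * j + 1) *
        (((1 / ((p : ℝ) + 1)) ^ (2 * j + 2) : ℝ) : ℂ)) = fun p => F p j := by
      funext p
      simp only [hF]
      push_cast
      ring
    rw [e1] at h
    rwa [Complex.ofReal_mul, mul_right_comm, Complex.ofReal_ofNat]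
  have hG := hFs.hasSum.prod_fiberwise hrow
  have hC := hFs.prod_symm.hasSum.prod_fiberwise hcol
  have hval : ∑' x : ℕ × ℕ, F x.1 x.2 = 1 / z - Real.pi * Complex.cot (Real.pi * z) := by
    rw [← hG.tsum_eq, tsum_neg, ← cot_series_rep' hz]
    ring
  have hswap : ∑' x : ℕ × ℕ, F x.swap.1 x.swap.2 = ∑' x : ℕ × ℕ, F x.1 x.2 :=
    (Equiv.prodComm ℕ ℕ).tsum_eq (fun x : ℕ × ℕ => F x.1 x.2)
  rw [← hval, ← hswap]
  exact hC

theorem IsLevyArea.hasSum_rTransform {φ : A →ₗ[ℂ] ℂ} (hφ : IsState φ) {β : ℝ → A}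
    (hβ : IsFreeBrownianBridge φ (2 * Real.pi) β) {ℓ : A} (hℓ : IsLevyArea β (2 * Real.pi) ℓ)
    {z : ℂ} (h0 : 0 < ‖z‖) (h1 : ‖z‖ < 1) :
    HasSum (fun n : ℕ => PowerSeries.coeff n (rTransform φ ℓ) * z ^ n)
      (1 / z - Real.pi * Complex.cot (Real.pi * z)) := by
  rw [← zero_add (1 / z - Real.pi * Complex.cot (Real.pi * z))]
  refine HasSum.even_add_odd ?_ ?_
  · have : ∀ k : ℕ, PowerSeries.coeff (2 * k) (rTransform φ ℓ) * z ^ (2 * k) = 0 := by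
      intro k
      rw [rTransform, PowerSeries.coeff_mk, hℓ.freeCumulant_odd hφ hβ ⟨k, rfl⟩, zero_mul]
    simp only [this]
    exact hasSum_zero
  · have : ∀ k : ℕ, PowerSeries.coeff (2 * k + 1) (rTransform φ ℓ) * z ^ (2 * k + 1) =
        ((2 * ∑' p : ℕ, (1 / ((p : ℝ) + 1)) ^ (2 * k + 2) : ℝ) : ℂ) * z ^ (2 * k + 1) := by
      intro k
      rw [rTransform, PowerSeries.coeff_mk,
        hℓ.freeCumulant_even hφ hβ (Nat.succ_pos _) ⟨k + 1, by omega⟩]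
    simp only [this]
    exact hasSum_cot h0 h1

end Limit

section CumulantSeries
variable {R : Type*} [CommRing R]

open PowerSeries

/-- The generating series `∑ₙ mₙ Xⁿ` of the moments with free cumulants `k`. -/
noncomputable def cumulantSeries (k : ℕ → R) : PowerSeries R :=
  mk fun n => ∑ p ∈ nonCrossingPartitions n, ∏ V ∈ p.parts, k V.card

theorem ncSum_card (k : ℕ → R) (s : Finset ℕ) :
    ncSum (fun V => k V.card) s = coeff s.card (cumulantSeries k) := by
  rw [cumulantSeries, coeff_mk, ← sum_nonCrossingPartitions (fun V => k V.card) s rfl]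
  simp only [Finset.card_map]

theorem coeff_zero_cumulantSeries (k : ℕ → R) : coeff 0 (cumulantSeries k) = 1 := by
  have := ncSum_card k ∅
  rw [ncSum_empty] at this
  exact this.symm

theorem coeff_succ_cumulantSeries (k : ℕ → R) (n : ℕ) :
    coeff (n + 1) (cumulantSeries k) = ∑ j ∈ Finset.range (n + 1),
      k (j + 1) * coeff (n + 1) ((X * cumulantSeries k) ^ (j + 1)) :=
  coeff_succ_eq_sum_of_ncSum k _ (ncSum_card k) n

/-- The series `∑ₘ sₘ (X M) ^ (m + 1)`. -/
noncomputable def substSeries (M : PowerSeries R) (s : ℕ → R) : PowerSeries R :=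
  mk fun n => ∑ m ∈ Finset.range (n + 1), s m * coeff n ((X * M) ^ (m + 1))

theorem coeff_mul_substSeries (M P : PowerSeries R) (s : ℕ → R) (n : ℕ) :
    coeff n (P * substSeries M s) =
      ∑ m ∈ Finset.range (n + 1), s m * coeff n (P * (X * M) ^ (m + 1)) := by
  simp_rw [coeff_mul, Finset.mul_sum]
  rw [Finset.sum_comm]
  refine Finset.sum_congr rfl fun p hp => ?_
  rw [substSeries, coeff_mk, Finset.mul_sum]
  have hp := Finset.HasAntidiagonal.mem_antidiagonal.mp hp
  rw [← Finset.sum_subset (Finset.range_subset_range.mpr (show p.2 + 1 ≤ n + 1 by omega))]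
  · exact Finset.sum_congr rfl fun m _ => by ring
  · intro m _ hm
    rw [coeff_X_mul_pow_of_lt M (by simp at hm; omega), mul_zero, mul_zero]

theorem cumulantSeries_eq (k : ℕ → R) (h1 : k 1 = 0) :
    cumulantSeries k = 1 + X * (cumulantSeries k *
      substSeries (cumulantSeries k) fun m => k (m + 2)) := by
  ext n
  cases n with
  | zero => simp [coeff_zero_cumulantSeries]
  | succ n =>
    rw [coeff_succ_cumulantSeries, Finset.sum_range_succ', zero_add, h1, zero_mul, add_zero,
      map_add, coeff_succ_X_mul, coeff_one, if_neg n.succ_ne_zero, zero_add,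
      coeff_mul_substSeries, Finset.sum_range_succ]
    have : coeff n (cumulantSeries k * (X * cumulantSeries k) ^ (n + 1)) = 0 := by
      have h := coeff_X_mul_pow_of_lt (cumulantSeries k) (show n + 1 < n + 2 by omega)
      rw [pow_succ', mul_assoc, coeff_succ_X_mul] at h
      exact h
    rw [this, mul_zero, add_zero]
    refine Finset.sum_congr rfl fun m _ => ?_
    rw [pow_succ' (X * cumulantSeries k) (m + 1), mul_assoc X, coeff_succ_X_mul]

theorem substSeries_pow_eq (M : PowerSeries R) (t : R) :
    substSeries M (fun m => t ^ m) = X * M * (1 + C t * substSeries M fun m => t ^ m) := by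
  ext n
  have h (m : ℕ) : coeff n (X * M * C t * (X * M) ^ (m + 1)) =
      t * coeff n ((X * M) ^ (m + 1 + 1)) := by
    rw [← coeff_C_mul]
    congr 1
    ring
  rw [mul_add, mul_one, ← mul_assoc, map_add, coeff_mul_substSeries, substSeries, coeff_mk,
    Finset.sum_range_succ', Finset.sum_range_succ, pow_zero, one_mul, zero_add, pow_one, add_comm]
  simp_rw [h]
  rw [coeff_X_mul_pow_of_lt M (show n < n + 1 + 1 by omega), mul_zero, mul_zero, add_zero]
  congr 1
  exact Finset.sum_congr rfl fun m _ => by ring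

end CumulantSeries

section CumulantSeriesDomain
variable {R : Type*} [CommRing R] [IsDomain R]

open PowerSeries

theorem substSeries_cumulantSeries_eq (k : ℕ → R) (h1 : k 1 = 0) (t : R) :
    substSeries (cumulantSeries k) (fun m => t ^ m) =
      X * (1 + C t * substSeries (cumulantSeries k) (fun m => t ^ m) +
        substSeries (cumulantSeries k) (fun m => k (m + 2)) *
          substSeries (cumulantSeries k) (fun m => t ^ m)) := by
  have hM : cumulantSeries k ≠ 0 := fun h => by
    have := coeff_zero_cumulantSeries k
    rw [h, map_zero] at this
    exact zero_ne_one this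
  refine mul_left_cancel₀ hM ?_
  have e1 := cumulantSeries_eq k h1
  have e2 := substSeries_pow_eq (cumulantSeries k) t
  linear_combination e2 + substSeries (cumulantSeries k) (fun m => t ^ m) * e1

end CumulantSeriesDomain

section Fock
variable {ι : Type*}

open ContinuousLinearMap

/-- The full Fock space over `ℓ²(ι)`, with its basis of words in the alphabet `ι`. -/
noncomputable abbrev FockSpace (ι : Type*) := lp (fun _ : List ι => ℂ) 2

theorem FockSpace.hasSum_norm_sq (x : FockSpace ι) :
    HasSum (fun w => ‖x w‖ ^ 2) (‖x‖ ^ 2) := by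
  have h := lp.hasSum_norm (p := 2) (by norm_num) x
  simpa using h

theorem FockSpace.memℓp_two {g : List ι → ℂ} (h : Summable fun w => ‖g w‖ ^ 2) :
    Memℓp (E := fun _ : List ι => ℂ) g 2 := by
  apply memℓp_gen
  simpa using h

/-- The vacuum vector. -/
noncomputable def vacuum (ι : Type*) : FockSpace ι :=
  open Classical in lp.single 2 [] 1

/-- The coordinates of `l(f) x` for the left creation operator `l(f)`. -/
def creationFun (f : ι → ℝ) (x : List ι → ℂ) : List ι → ℂ
  | [] => 0
  | i :: w => f i * x w

/-- The coordinates of the image of `x` under the gauge operator of multiplication by `t`. -/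
def gaugeFun (t : ι → ℝ) (x : List ι → ℂ) : List ι → ℂ
  | [] => 0
  | i :: w => t i * x (i :: w)

theorem hasSum_norm_creationFun {f : ι → ℝ} {F : ℝ} (hf : HasSum (fun i => f i ^ 2) F)
    (x : FockSpace ι) : HasSum (fun w => ‖creationFun f x w‖ ^ 2) (F * ‖x‖ ^ 2) := by
  have hx := FockSpace.hasSum_norm_sq x
  have h := hf.mul hx (hf.summable.mul_of_nonneg hx.summable (fun _ => sq_nonneg _)
    (fun _ => sq_nonneg _))
  have hinj : Function.Injective fun p : ι × List ι => p.1 :: p.2 := fun p q hpq => by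
    injection hpq with h1 h2
    exact Prod.ext h1 h2
  rw [← hinj.hasSum_iff]
  · refine h.congr_fun fun p => ?_
    simp [creationFun, mul_pow]
  · intro w hw
    cases w with
    | nil => simp [creationFun]
    | cons i w => exact absurd ⟨(i, w), rfl⟩ hw

/-- The left creation operator. -/
noncomputable def creationₗ {f : ι → ℝ} (hf : Summable fun i => f i ^ 2) :
    FockSpace ι →ₗ[ℂ] FockSpace ι where
  toFun x := ⟨creationFun f x,
    FockSpace.memℓp_two (hasSum_norm_creationFun hf.hasSum x).summable⟩
  map_add' x y := by
    refine Subtype.ext (funext fun w => ?_)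
    change creationFun f (fun v => x v + y v) w = creationFun f x w + creationFun f y w
    cases w <;> simp [creationFun, mul_add]
  map_smul' c x := by
    refine Subtype.ext (funext fun w => ?_)
    change creationFun f (fun v => c * x v) w = c * creationFun f x w
    cases w
    · simp [creationFun]
    · simp only [creationFun]
      ring

theorem norm_creationₗ_le {f : ι → ℝ} (hf : Summable fun i => f i ^ 2) (x : FockSpace ι) :
    ‖creationₗ hf x‖ ≤ Real.sqrt (∑' i, f i ^ 2) * ‖x‖ := by
  have h := hasSum_norm_creationFun hf.hasSum x
  rw [← pow_le_pow_iff_left₀ (norm_nonneg _) (by positivity) two_ne_zero, mul_pow,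
    Real.sq_sqrt (tsum_nonneg fun _ => sq_nonneg _)]
  exact ((FockSpace.hasSum_norm_sq (creationₗ hf x)).unique h).le

/-- The left creation operator, as a continuous linear map. -/
noncomputable def creation {f : ι → ℝ} (hf : Summable fun i => f i ^ 2) :
    FockSpace ι →L[ℂ] FockSpace ι :=
  (creationₗ hf).mkContinuous _ (norm_creationₗ_le hf)

theorem creation_apply {f : ι → ℝ} (hf : Summable fun i => f i ^ 2) (x : FockSpace ι)
    (w : List ι) : creation hf x w = creationFun f x w := rfl

theorem norm_gaugeFun_le {t : ι → ℝ} {C : ℝ} (ht : ∀ i, |t i| ≤ C)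
    (x : FockSpace ι) (w : List ι) : ‖gaugeFun t x w‖ ^ 2 ≤ C ^ 2 * ‖x w‖ ^ 2 := by
  cases w with
  | nil =>
    rw [gaugeFun, norm_zero, zero_pow two_ne_zero]
    positivity
  | cons i w =>
    rw [gaugeFun, norm_mul, mul_pow, Complex.norm_real, Real.norm_eq_abs]
    gcongr
    exact ht i

theorem summable_norm_gaugeFun {t : ι → ℝ} {C : ℝ} (ht : ∀ i, |t i| ≤ C)
    (x : FockSpace ι) : Summable fun w => ‖gaugeFun t x w‖ ^ 2 :=
  ((FockSpace.hasSum_norm_sq x).summable.mul_left (C ^ 2)).of_nonneg_of_le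
    (fun _ => sq_nonneg _) (norm_gaugeFun_le ht x)

/-- The gauge operator of multiplication by `t`. -/
noncomputable def gaugeₗ {t : ι → ℝ} {C : ℝ} (ht : ∀ i, |t i| ≤ C) :
    FockSpace ι →ₗ[ℂ] FockSpace ι where
  toFun x := ⟨gaugeFun t x, FockSpace.memℓp_two (summable_norm_gaugeFun ht x)⟩
  map_add' x y := by
    refine Subtype.ext (funext fun w => ?_)
    change gaugeFun t (fun v => x v + y v) w = gaugeFun t x w + gaugeFun t y w
    cases w <;> simp [gaugeFun, mul_add]
  map_smul' c x := by
    refine Subtype.ext (funext fun w => ?_)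
    change gaugeFun t (fun v => c * x v) w = c * gaugeFun t x w
    cases w
    · simp [gaugeFun]
    · simp only [gaugeFun]
      ring

theorem norm_gaugeₗ_le {t : ι → ℝ} {C : ℝ} (hC : 0 ≤ C) (ht : ∀ i, |t i| ≤ C)
    (x : FockSpace ι) : ‖gaugeₗ ht x‖ ≤ C * ‖x‖ := by
  rw [← pow_le_pow_iff_left₀ (norm_nonneg _) (by positivity) two_ne_zero, mul_pow]
  exact hasSum_le (norm_gaugeFun_le ht x) (FockSpace.hasSum_norm_sq (gaugeₗ ht x))
    ((FockSpace.hasSum_norm_sq x).mul_left _)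

/-- The gauge operator, as a continuous linear map. -/
noncomputable def gaugeOp {t : ι → ℝ} {C : ℝ} (hC : 0 ≤ C) (ht : ∀ i, |t i| ≤ C) :
    FockSpace ι →L[ℂ] FockSpace ι :=
  (gaugeₗ ht).mkContinuous _ (norm_gaugeₗ_le hC ht)

theorem gauge_apply {t : ι → ℝ} {C : ℝ} (hC : 0 ≤ C) (ht : ∀ i, |t i| ≤ C) (x : FockSpace ι)
    (w : List ι) : gaugeOp hC ht x w = gaugeFun t x w := rfl

theorem isSelfAdjoint_gaugeOp {t : ι → ℝ} {C : ℝ} (hC : 0 ≤ C) (ht : ∀ i, |t i| ≤ C) :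
    IsSelfAdjoint (gaugeOp hC ht) := by
  rw [isSelfAdjoint_iff_isSymmetric]
  intro x y
  have h1 := lp.hasSum_inner (𝕜 := ℂ) (gaugeOp hC ht x) y
  have h2 := lp.hasSum_inner (𝕜 := ℂ) x (gaugeOp hC ht y)
  refine h1.unique (h2.congr_fun fun w => ?_)
  rw [gauge_apply, gauge_apply]
  cases w with
  | nil => simp [gaugeFun]
  | cons i w => simp [gaugeFun]; ring

theorem FockSpace.inner_single (x : FockSpace ι) (w : List ι) : 
    open Classical in inner ℂ (lp.single 2 w (1 : ℂ) : FockSpace ι) x = x w := by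
  classical
  rw [lp.inner_single_left]
  simp

theorem hasSum_adjoint_creation {f : ι → ℝ} (hf : Summable fun i => f i ^ 2) (x : FockSpace ι)
    (w : List ι) : HasSum (fun j => (f j : ℂ) * x (j :: w)) (adjoint (creation hf) x w) := by
  classical
  have h := lp.hasSum_inner (𝕜 := ℂ) (creation hf (lp.single 2 w (1 : ℂ))) x
  rw [← adjoint_inner_right, FockSpace.inner_single] at h
  have hinj : Function.Injective fun j : ι => j :: w := fun p q hpq => by
    injection hpq
  rw [← hinj.hasSum_iff] at h
  · refine h.congr_fun fun j => ?_
    simp [creation_apply, creationFun, mul_comm]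
  · intro v hv
    rw [creation_apply]
    cases v with
    | nil => simp [creationFun]
    | cons i v =>
      have : v ≠ w := fun h => hv ⟨i, by rw [h]⟩
      simp [creationFun, this]

/-- `a` acts on the Fock space as the sum of the creation operator of `f`, its adjoint, and the
gauge operator of multiplication by `t`. -/
structure IsFockOp (a : FockSpace ι →L[ℂ] FockSpace ι) (f t : ι → ℝ) : Prop where
  selfAdjoint : IsSelfAdjoint a
  nil : ∀ x, HasSum (fun j => (f j : ℂ) * x [j]) (a x [])
  cons : ∀ x i w, HasSum (fun j => (f j : ℂ) * x (j :: i :: w))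
    (a x (i :: w) - f i * x w - t i * x (i :: w))

theorem IsFockOp.add {a b : FockSpace ι →L[ℂ] FockSpace ι} {f t g u : ι → ℝ}
    (ha : IsFockOp a f t) (hb : IsFockOp b g u) : IsFockOp (a + b) (f + g) (t + u) where
  selfAdjoint := ha.selfAdjoint.add hb.selfAdjoint
  nil x := ((ha.nil x).add (hb.nil x)).congr_fun fun j => by simp [add_mul]
  cons x i w := by
    convert (ha.cons x i w).add (hb.cons x i w) using 1
    · funext j
      simp [add_mul]
    · simp
      ring

theorem exists_isFockOp {f t : ι → ℝ} (hf : Summable fun i => f i ^ 2) {C : ℝ} (hC : 0 ≤ C)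
    (ht : ∀ i, |t i| ≤ C) : ∃ a : FockSpace ι →L[ℂ] FockSpace ι, IsFockOp a f t := by
  refine ⟨creation hf + adjoint (creation hf) + gaugeOp hC ht, ?_, ?_, ?_⟩
  · exact (IsSelfAdjoint.add_star_self (creation hf)).add (isSelfAdjoint_gaugeOp hC ht)
  · intro x
    simpa [creation_apply, gauge_apply, creationFun, gaugeFun] using
      hasSum_adjoint_creation hf x []
  · intro x i w
    have h : (creation hf + adjoint (creation hf) + gaugeOp hC ht) x (i :: w) =
        f i * x w + adjoint (creation hf) x (i :: w) + t i * x (i :: w) := rfl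
    rw [h, show ∀ p q r : ℂ, p + q + r - p - r = q from fun p q r => by ring]
    exact hasSum_adjoint_creation hf x (i :: w)

/-- The vacuum state. -/
noncomputable def vacuumState (ι : Type*) : (FockSpace ι →L[ℂ] FockSpace ι) →ₗ[ℂ] ℂ where
  toFun a := a (vacuum ι) []
  map_add' a b := by simp
  map_smul' c a := by simp

theorem vacuumState_apply (a : FockSpace ι →L[ℂ] FockSpace ι) :
    vacuumState ι a = a (vacuum ι) [] := rfl

theorem vacuum_nil : vacuum ι [] = 1 := by
  classical
  rw [vacuum]
  simp

theorem vacuum_cons (i : ι) (w : List ι) : vacuum ι (i :: w) = 0 := by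
  classical
  rw [vacuum, lp.single_apply_ne]
  simp

open scoped ComplexOrder in
theorem isState_vacuumState : IsState (vacuumState ι) where
  map_one := by
    rw [vacuumState_apply]
    exact vacuum_nil
  nonneg a := by
    classical
    rw [vacuumState_apply, ContinuousLinearMap.star_eq_adjoint, ← FockSpace.inner_single]
    change 0 ≤ inner ℂ (vacuum ι) (adjoint a (a (vacuum ι)))
    rw [adjoint_inner_right, inner_self_eq_norm_sq_to_K]
    have h := Complex.zero_le_real.mpr (sq_nonneg ‖a (vacuum ι)‖)
    rw [Complex.ofReal_pow] at h
    exact h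

end Fock

section FockMoments
variable {ι : Type*}

open PowerSeries in
theorem IsFockOp.pow_apply_vacuum {a : FockSpace ι →L[ℂ] FockSpace ι} {f t : ι → ℝ}
    (ha : IsFockOp a f t) {k : ℕ → ℂ} (h1 : k 1 = 0)
    (hk : ∀ m, HasSum (fun i => (f i : ℂ) ^ 2 * (t i : ℂ) ^ m) (k (m + 2))) (n : ℕ)
    (w : List ι) : (a ^ n) (vacuum ι) w = coeff n (cumulantSeries k *
      (w.map fun i => C (f i : ℂ) * substSeries (cumulantSeries k) fun m => (t i : ℂ) ^ m).prod) := by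
  set M := cumulantSeries k with hM
  set E : ι → PowerSeries ℂ := fun i => substSeries M fun m => (t i : ℂ) ^ m with hE
  set G := substSeries M fun m => k (m + 2) with hG
  have hE1 : ∀ i, E i = X * (1 + C (t i : ℂ) * E i + G * E i) := fun i =>
    substSeries_cumulantSeries_eq k h1 _
  have hM1 : M = 1 + X * (M * G) := cumulantSeries_eq k h1
  have hsum : ∀ n (P : PowerSeries ℂ),
      HasSum (fun j => (f j : ℂ) * coeff n (P * (C (f j : ℂ) * E j))) (coeff n (P * G)) := by
    intro n P
    rw [hG, coeff_mul_substSeries]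
    refine (hasSum_sum fun m _ => (hk m).mul_right (coeff n (P * (X * M) ^ (m + 1)))).congr_fun
      fun j => ?_
    rw [mul_left_comm, coeff_C_mul, coeff_mul_substSeries, Finset.mul_sum, Finset.mul_sum]
    exact Finset.sum_congr rfl fun m _ => by ring
  have h0 : coeff 0 M = 1 := coeff_zero_cumulantSeries k
  change (a ^ n) (vacuum ι) w = coeff n (M * (w.map fun i => C (f i : ℂ) * E i).prod)
  clear_value E G M
  induction n generalizing w with
  | zero =>
    cases w with
    | nil =>
      rw [List.map_nil, List.prod_nil, mul_one, h0]
      exact vacuum_nil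
    | cons i w =>
      rw [List.map_cons, List.prod_cons, hE1 i,
        show ∀ p q r s : PowerSeries ℂ, p * (q * (X * r) * s) = X * (p * q * r * s) from
          fun p q r s => by ring, coeff_zero_X_mul]
      exact vacuum_cons i w
  | succ n ih =>
    have hpow : (a ^ (n + 1)) (vacuum ι) = a ((a ^ n) (vacuum ι)) := by
      rw [pow_succ']
      rfl
    rw [hpow]
    cases w with
    | nil =>
      have h := ha.nil ((a ^ n) (vacuum ι))
      simp_rw [ih] at h
      rw [List.map_nil, List.prod_nil, mul_one, hM1, map_add, coeff_succ_X_mul, coeff_one,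
        if_neg n.succ_ne_zero, zero_add]
      refine h.unique ((hsum n M).congr_fun fun j => ?_)
      rw [List.map_cons, List.map_nil, List.prod_cons, List.prod_nil, mul_one]
    | cons i w =>
      have h := ha.cons ((a ^ n) (vacuum ι)) i w
      simp_rw [ih] at h
      have h2 := h.unique ((hsum n (M * ((i :: w).map fun i => C (f i : ℂ) * E i).prod)).congr_fun
        fun j => by
          rw [List.map_cons, List.prod_cons]
          congr 2
          ring)
      rw [sub_sub, sub_eq_iff_eq_add] at h2
      rw [h2, List.map_cons, List.prod_cons]
      conv_rhs => rw [hE1 i, show ∀ p q r s : PowerSeries ℂ, p * (q * (X * r) * s) =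
        X * (p * (q * r) * s) from fun p q r s => by ring, coeff_succ_X_mul]
      rw [← coeff_C_mul, ← coeff_C_mul, ← map_add, ← map_add]
      congr 1
      ring

/-- The free cumulants in the vacuum state of a Fock space operator. -/
theorem IsFockOp.vacuumState_pow {a : FockSpace ι →L[ℂ] FockSpace ι} {f t : ι → ℝ}
    (ha : IsFockOp a f t) {k : ℕ → ℂ} (h1 : k 1 = 0)
    (hk : ∀ m, HasSum (fun i => (f i : ℂ) ^ 2 * (t i : ℂ) ^ m) (k (m + 2))) (n : ℕ) :
    vacuumState ι (a ^ n) = PowerSeries.coeff n (cumulantSeries k) := by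
  rw [vacuumState_apply, ha.pow_apply_vacuum h1 hk, List.map_nil, List.prod_nil, mul_one]

end FockMoments

section FockFreeness
variable {ι K : Type*}

theorem StarAlgebra.adjoin_selfAdjoint_induction {B : Type*} [Ring B] [StarRing B] [Algebra ℂ B]
    [StarModule ℂ B] {a : B} (ha : IsSelfAdjoint a) {p : B → Prop} (mem : p a)
    (algebraMap : ∀ c : ℂ, p (algebraMap ℂ B c)) (add : ∀ x y, p x → p y → p (x + y))
    (mul : ∀ x y, p x → p y → p (x * y)) {x : B} (hx : x ∈ StarAlgebra.adjoin ℂ {a}) : p x := by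
  rw [← StarSubalgebra.mem_toSubalgebra, StarAlgebra.adjoin_toSubalgebra] at hx
  refine Algebra.adjoin_induction (p := fun x _ => p x) ?_ algebraMap
    (fun x y _ _ => add x y) (fun x y _ _ => mul x y) hx
  rintro y (rfl | hy)
  · exact mem
  · have : star y = a := hy
    rw [← star_star y, this, ha.star_eq]
    exact mem

/-- Operators which commute with stripping the suffix `w` off all words. -/
def CommutesSuffix (w : List ι) (b : FockSpace ι →L[ℂ] FockSpace ι) : Prop :=
  ∀ x y : FockSpace ι, (∀ v, y v = x (v ++ w)) → ∀ v, b y v = b x (v ++ w)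

/-- Operators preserving the vectors which vanish on the words with letters in `s`. -/
def PreservesVanishing (s : Set ι) (b : FockSpace ι →L[ℂ] FockSpace ι) : Prop :=
  ∀ x : FockSpace ι, (∀ v : List ι, (∀ i ∈ v, i ∈ s) → x v = 0) →
    ∀ v : List ι, (∀ i ∈ v, i ∈ s) → b x v = 0

theorem IsFockOp.commutesSuffix {a : FockSpace ι →L[ℂ] FockSpace ι} {f t : ι → ℝ}
    (ha : IsFockOp a f t) {w : List ι} (hw : ∀ i ∈ w.head?, f i = 0 ∧ t i = 0)
    {b : FockSpace ι →L[ℂ] FockSpace ι} (hb : b ∈ StarAlgebra.adjoin ℂ {a}) :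
    CommutesSuffix w b := by
  refine StarAlgebra.adjoin_selfAdjoint_induction ha.selfAdjoint ?_ ?_ ?_ ?_ hb
  · intro x y hxy v
    cases v with
    | nil =>
      have h := ha.nil y
      simp_rw [hxy] at h
      cases w with
      | nil => exact h.unique (ha.nil x)
      | cons i w =>
        have h2 := ha.cons x i w
        obtain ⟨h3, h4⟩ := hw i rfl
        rw [h3, h4, Complex.ofReal_zero, zero_mul, zero_mul, sub_zero, sub_zero] at h2
        exact h.unique h2
    | cons i v =>
      have h := ha.cons y i v
      simp_rw [hxy] at h
      have h2 := h.unique (ha.cons x i (v ++ w))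
      rw [List.cons_append] at h2
      exact sub_left_injective (sub_left_injective h2)
  · intro c x y hxy v
    change c * y v = c * x (v ++ w)
    rw [hxy]
  · intro b c hb hc x y hxy v
    change b y v + c y v = b x (v ++ w) + c x (v ++ w)
    rw [hb x y hxy, hc x y hxy]
  · intro b c hb hc x y hxy
    exact hb _ _ (hc x y hxy)

theorem IsFockOp.preservesVanishing {a : FockSpace ι →L[ℂ] FockSpace ι} {f t : ι → ℝ}
    (ha : IsFockOp a f t) {s : Set ι} (hs : ∀ i ∉ s, f i = 0)
    {b : FockSpace ι →L[ℂ] FockSpace ι} (hb : b ∈ StarAlgebra.adjoin ℂ {a}) :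
    PreservesVanishing s b := by
  refine StarAlgebra.adjoin_selfAdjoint_induction ha.selfAdjoint ?_ ?_ ?_ ?_ hb
  · intro x hx v hv
    have h0 : ∀ j, (f j : ℂ) * x (j :: v) = 0 := by
      intro j
      by_cases hj : j ∈ s
      · rw [hx (j :: v) (by simpa [hj] using hv), mul_zero]
      · rw [hs j hj, Complex.ofReal_zero, zero_mul]
    cases v with
    | nil =>
      have h := ha.nil x
      simp_rw [h0] at h
      exact h.unique hasSum_zero
    | cons i v =>
      have h := ha.cons x i v
      simp_rw [h0] at h
      have h := h.unique hasSum_zero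
      rwa [hx v (fun j hj => hv j (List.mem_cons_of_mem _ hj)), hx _ hv, mul_zero, mul_zero,
        sub_zero, sub_zero] at h
  · intro c x hx v hv
    change c * x v = 0
    rw [hx v hv, mul_zero]
  · intro b c hb hc x hx v hv
    change b x v + c x v = 0
    rw [hb x hx v hv, hc x hx v hv, add_zero]
  · intro b c hb hc x hx
    exact hb _ (hc x hx)

/-- A centred element of the algebra generated by a Fock operator living on the letters of `s`
maps the vectors supported on words not starting in `s` to vectors supported on words starting
in `s`. -/
theorem IsFockOp.apply_eq_zero {a : FockSpace ι →L[ℂ] FockSpace ι} {f t : ι → ℝ}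
    (ha : IsFockOp a f t) {s : Set ι} (hs : ∀ i ∉ s, f i = 0 ∧ t i = 0)
    {b : FockSpace ι →L[ℂ] FockSpace ι} (hb : b ∈ StarAlgebra.adjoin ℂ {a})
    (hb0 : vacuumState ι b = 0) {x : FockSpace ι} (hx : ∀ i ∈ s, ∀ v, x (i :: v) = 0)
    {w : List ι} (hw : ∀ i ∈ w.head?, i ∉ s) : b x w = 0 := by
  have hinj : Function.Injective fun v : List ι => v ++ w := List.append_left_injective w
  let y : FockSpace ι := ⟨fun v => x (v ++ w), FockSpace.memℓp_two
    ((FockSpace.hasSum_norm_sq x).summable.comp_injective hinj)⟩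
  have hy : ∀ v, y v = x (v ++ w) := fun v => rfl
  have h1 := ha.commutesSuffix (fun i hi => hs i (hw i hi)) hb x y hy []
  rw [List.nil_append] at h1
  rw [← h1]
  have h2 := ha.preservesVanishing (fun i hi => (hs i hi).1) hb (y - y [] • vacuum ι) (by
    intro v hv
    change y v - y [] * vacuum ι v = 0
    cases v with
    | nil => rw [vacuum_nil, mul_one, sub_self]
    | cons i v =>
      rw [vacuum_cons, mul_zero, sub_zero, hy, List.cons_append,
        hx i (hv i List.mem_cons_self)]) [] (by simp)
  rw [map_sub, map_smul] at h2
  have h3 : b y [] - y [] * vacuumState ι b = 0 := h2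
  rwa [hb0, mul_zero, sub_zero] at h3

/-- Fock operators living on disjoint sets of letters are free. -/
theorem areFree_of_isFockOp {a : K → FockSpace ι →L[ℂ] FockSpace ι} {f t : K → ι → ℝ}
    (ha : ∀ r, IsFockOp (a r) (f r) (t r)) (col : ι → K)
    (h0 : ∀ r i, col i ≠ r → f r i = 0 ∧ t r i = 0) : AreFree (vacuumState ι) a := by
  have key : ∀ l : List (K × (FockSpace ι →L[ℂ] FockSpace ι)),
      (∀ p ∈ l, p.2 ∈ StarAlgebra.adjoin ℂ {a p.1} ∧ vacuumState ι p.2 = 0) →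
      l.IsChain (fun p q => p.1 ≠ q.1) →
      ∀ r, (∀ p ∈ l.head?, r = p.1) → l ≠ [] →
        ∀ w : List ι, (∀ i ∈ w.head?, col i ≠ r) → (l.map Prod.snd).prod (vacuum ι) w = 0 := by
    intro l
    induction l with
    | nil => intro _ _ _ _ h; exact absurd rfl h
    | cons p l ih =>
      intro hl hc r hr _ w hw
      obtain ⟨hp, hp0⟩ := hl p List.mem_cons_self
      obtain rfl := hr p rfl
      rw [List.map_cons, List.prod_cons]
      change p.2 ((l.map Prod.snd).prod (vacuum ι)) w = 0
      refine (ha p.1).apply_eq_zero (s := {i | col i = p.1}) (fun i hi => h0 p.1 i hi) hp hp0 ?_ hw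
      intro i hi v
      cases l with
      | nil => exact vacuum_cons i v
      | cons q l =>
        rw [List.isChain_cons_cons] at hc
        refine ih (fun x hx => hl x (List.mem_cons_of_mem _ hx)) hc.2 q.1 (fun x hx => ?_)
          (List.cons_ne_nil _ _) _ (fun j hj => ?_)
        · rw [List.head?_cons, Option.mem_some_iff] at hx
          rw [hx]
        · rw [List.head?_cons, Option.mem_some_iff] at hj
          subst hj
          rw [show col i = p.1 from hi]
          exact hc.1
  intro l hne hl hc
  obtain ⟨p, l', rfl⟩ := List.exists_cons_of_ne_nil hne
  exact key _ hl hc p.1 (fun q hq => by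
    rw [List.head?_cons, Option.mem_some_iff] at hq
    rw [hq]) hne [] (by simp)

end FockFreeness

section FreeInfinitelyDivisible

/-- The free cumulants `k₁ = 0`, `kₘ₊₂ = ∑ᵢ (f i)² (t i)ᵐ` of a centred law whose Lévy measure is
purely atomic. -/
structure IsJumpCumulants {ι : Type*} (k : ℕ → ℝ) (f t : ι → ℝ) : Prop where
  one : k 1 = 0
  bounded : ∃ C, 0 ≤ C ∧ ∀ i, |t i| ≤ C
  hasSum : ∀ m, HasSum (fun i => f i ^ 2 * t i ^ m) (k (m + 2))

theorem IsJumpCumulants.const_mul {ι : Type*} {k : ℕ → ℝ} {f t : ι → ℝ}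
    (h : IsJumpCumulants k f t) {c : ℝ} (hc : 0 ≤ c) :
    IsJumpCumulants (fun m => c * k m) (fun i => Real.sqrt c * f i) t where
  one := by rw [h.one, mul_zero]
  bounded := h.bounded
  hasSum m := ((h.hasSum m).mul_left c).congr_fun fun i => by
    rw [mul_pow, Real.sq_sqrt hc, mul_assoc]

theorem IsJumpCumulants.fiber {ι K : Type*} [DecidableEq K] {k : ℕ → ℝ} {f t : ι → ℝ}
    (h : IsJumpCumulants k f t) (r : K) :
    IsJumpCumulants k (fun p : K × ι => if p.1 = r then f p.2 else 0)
      (fun p => if p.1 = r then t p.2 else 0) where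
  one := h.one
  bounded := by
    obtain ⟨C, hC, hb⟩ := h.bounded
    refine ⟨C, hC, fun p => ?_⟩
    split_ifs
    · exact hb _
    · rwa [abs_zero]
  hasSum m := by
    have hinj : Function.Injective fun i : ι => (r, i) := Prod.mk_right_injective r
    rw [← hinj.hasSum_iff]
    · exact (h.hasSum m).congr_fun fun i => by simp
    · intro p hp
      have : p.1 ≠ r := fun hr => hp ⟨p.2, by rw [← hr]⟩
      simp [this]

theorem IsJumpCumulants.add {ι : Type*} {k l : ℕ → ℝ} {f t g u : ι → ℝ}
    (h : IsJumpCumulants k f t) (h' : IsJumpCumulants l g u)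
    (hd : ∀ i, f i = 0 ∧ t i = 0 ∨ g i = 0 ∧ u i = 0) :
    IsJumpCumulants (fun m => k m + l m) (f + g) (t + u) where
  one := by rw [h.one, h'.one, add_zero]
  bounded := by
    obtain ⟨C, hC, hb⟩ := h.bounded
    obtain ⟨D, hD, hb'⟩ := h'.bounded
    exact ⟨C + D, add_nonneg hC hD, fun i => (abs_add_le _ _).trans (add_le_add (hb i) (hb' i))⟩
  hasSum m := ((h.hasSum m).add (h'.hasSum m)).congr_fun fun i => by
    rcases hd i with ⟨h1, h2⟩ | ⟨h1, h2⟩ <;> simp [h1, h2]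

theorem IsJumpCumulants.exists_isFockOp {ι : Type*} {k : ℕ → ℝ} {f t : ι → ℝ}
    (h : IsJumpCumulants k f t) : ∃ a : FockSpace ι →L[ℂ] FockSpace ι, IsFockOp a f t := by
  obtain ⟨C, hC, hb⟩ := h.bounded
  refine _root_.exists_isFockOp ?_ hC hb
  simpa using (h.hasSum 0).summable

theorem IsJumpCumulants.vacuumState_pow {ι : Type*} {k : ℕ → ℝ} {f t : ι → ℝ}
    (h : IsJumpCumulants k f t) {a : FockSpace ι →L[ℂ] FockSpace ι} (ha : IsFockOp a f t) (n : ℕ) :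
    vacuumState ι (a ^ n) = PowerSeries.coeff n (cumulantSeries fun m => (k m : ℂ)) := by
  refine ha.vacuumState_pow (by rw [h.one, Complex.ofReal_zero]) (fun m => ?_) n
  exact (Complex.hasSum_ofReal.mpr (h.hasSum m)).congr_fun fun i => by push_cast; rfl

/-- `μ` is a compactly supported law with free cumulants `k`. -/
def HasFreeCumulants (μ : Measure ℝ) (k : ℕ → ℝ) : Prop :=
  IsCompactlySupportedProb μ ∧ ∀ n : ℕ,
    ((∫ t : ℝ, t ^ n ∂μ : ℝ) : ℂ) = PowerSeries.coeff n (cumulantSeries fun m => (k m : ℂ))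

theorem IsJumpCumulants.exists_hasFreeCumulants {ι : Type*} {k : ℕ → ℝ} {f t : ι → ℝ}
    (h : IsJumpCumulants k f t) : ∃ μ, HasFreeCumulants μ k := by
  obtain ⟨a, ha⟩ := h.exists_isFockOp
  obtain ⟨μ, hμ, hμ'⟩ := isState_vacuumState.exists_isLaw ha.selfAdjoint
  exact ⟨μ, hμ, fun n => (hμ' n).symm.trans (h.vacuumState_pow ha n)⟩

theorem HasFreeCumulants.isLaw {ι : Type*} {k : ℕ → ℝ} {f t : ι → ℝ} {μ : Measure ℝ}
    (hμ : HasFreeCumulants μ k) (h : IsJumpCumulants k f t)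
    {a : FockSpace ι →L[ℂ] FockSpace ι} (ha : IsFockOp a f t) : IsLaw (vacuumState ι) a μ :=
  ⟨hμ.1, fun n => (h.vacuumState_pow ha n).trans (hμ.2 n).symm⟩

/-- Free convolution adds free cumulants. -/
theorem IsJumpCumulants.isFreeConv {ι : Type} {k l : ℕ → ℝ} {f t g u : ι → ℝ}
    (h : IsJumpCumulants k f t) (h' : IsJumpCumulants l g u) {μ ν ρ : Measure ℝ}
    (hμ : HasFreeCumulants μ k) (hν : HasFreeCumulants ν l)
    (hρ : HasFreeCumulants ρ fun m => k m + l m) : IsFreeConv μ ν ρ := by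
  have h0 := h.fiber (0 : Fin 2)
  have h1 := h'.fiber (1 : Fin 2)
  obtain ⟨a, ha⟩ := h0.exists_isFockOp
  obtain ⟨b, hb⟩ := h1.exists_isFockOp
  refine ⟨_, inferInstance, vacuumState (Fin 2 × ι), a, b, isState_vacuumState, ha.selfAdjoint,
    hb.selfAdjoint, ?_, hμ.isLaw h0 ha, hν.isLaw h1 hb, hρ.isLaw (h0.add h1 fun p => ?_)
      (ha.add hb)⟩
  · refine areFree_of_isFockOp (f := ![_, _]) (t := ![_, _])
      (Fin.forall_fin_two.mpr ⟨ha, hb⟩) Prod.fst ?_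
    refine Fin.forall_fin_two.mpr ⟨fun i hi => ?_, fun i hi => ?_⟩
    · exact ⟨if_neg hi, if_neg hi⟩
    · exact ⟨if_neg hi, if_neg hi⟩
  · rcases p with ⟨r, i⟩
    fin_cases r
    · right
      simp
    · left
      simp

theorem IsJumpCumulants.isFreelyInfinitelyDivisible {ι : Type} {k : ℕ → ℝ} {f t : ι → ℝ}
    (h : IsJumpCumulants k f t) {μ : Measure ℝ} (hμ : HasFreeCumulants μ k) :
    IsFreelyInfinitelyDivisible μ := by
  refine ⟨hμ.1, fun n hn => ?_⟩
  have hn0 : (n : ℝ) ≠ 0 := Nat.cast_ne_zero.mpr hn.ne'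
  have hk : ∀ j : ℕ, 0 ≤ (j / n : ℝ) := fun j => by positivity
  have hex : ∃ σ : ℕ → Measure ℝ,
      (∀ j, HasFreeCumulants (σ j) fun m => (j / n : ℝ) * k m) ∧ σ n = μ := by
    choose σ hσ using fun j : ℕ => (h.const_mul (hk j)).exists_hasFreeCumulants
    refine ⟨Function.update σ n μ, fun j => ?_, Function.update_self ..⟩
    by_cases hj : j = n
    · subst hj
      rw [Function.update_self, div_self hn0]
      simpa only [one_mul] using hμ
    · rw [Function.update_of_ne hj]
      exact hσ j
  obtain ⟨σ, hσ, rfl⟩ := hex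
  have hpow : ∀ j, IsFreeConvPow (σ 1) (j + 1) (σ (j + 1)) := by
    intro j
    induction j with
    | zero => rfl
    | succ j ih =>
      refine ⟨σ (j + 1), ih, ?_⟩
      refine (h.const_mul (hk (j + 1))).isFreeConv (h.const_mul (hk 1)) (hσ (j + 1)) (hσ 1) ?_
      have h2 := hσ (j + 1 + 1)
      convert h2 using 2 with m
      push_cast
      ring
  refine ⟨σ 1, (hσ 1).1, ?_⟩
  obtain ⟨j, rfl⟩ := Nat.exists_eq_succ_of_ne_zero hn.ne'
  exact hpow j

theorem cumulantSeries_congr {R : Type*} [CommRing R] {k l : ℕ → R} (h : ∀ m, 0 < m → k m = l m) :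
    cumulantSeries k = cumulantSeries l := by
  ext n
  rw [cumulantSeries, cumulantSeries, PowerSeries.coeff_mk, PowerSeries.coeff_mk]
  refine Finset.sum_congr rfl fun p _ => Finset.prod_congr rfl fun V hV => h _ ?_
  exact Finset.card_pos.mpr (p.nonempty_of_mem_parts hV)

theorem IsLaw.hasFreeCumulants {A : Type*} [CStarAlgebra A] {φ : A →ₗ[ℂ] ℂ} (hφ : IsState φ)
    {a : A} {μ : Measure ℝ} (hμ : IsLaw φ a μ) {k : ℕ → ℝ}
    (hk : ∀ m, 0 < m → freeCumulant φ m (fun _ => a) = k m) : HasFreeCumulants μ k := by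
  refine ⟨hμ.1, fun n => ?_⟩
  have h1 := ncSum_freeCumulant_const hφ a (Finset.range n)
  have h2 := ncSum_card (fun m => freeCumulant φ m (fun _ => a)) (Finset.range n)
  rw [Finset.card_range] at h1 h2
  rw [← hμ.2 n, ← cumulantSeries_congr hk, ← h2, h1, momentSeries, PowerSeries.coeff_mk]

theorem isJumpCumulants_int :
    ∃ t : ℤ → ℝ, IsJumpCumulants
      (fun m => if Odd m then 0 else 2 * ∑' p : ℕ, (1 / ((p : ℝ) + 1)) ^ m) t t := by
  let t : ℤ → ℝ := fun
    | Int.ofNat p => 1 / ((p : ℝ) + 1)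
    | Int.negSucc p => -(1 / ((p : ℝ) + 1))
  refine ⟨t, by simp, ⟨1, zero_le_one, ?_⟩, fun m => ?_⟩
  · have h (p : ℕ) : |1 / ((p : ℝ) + 1)| ≤ 1 := by
      rw [abs_of_pos (by positivity), div_le_one (by positivity)]
      linarith [p.cast_nonneg (α := ℝ)]
    rintro (p | p)
    · exact h p
    · change |-(1 / ((p : ℝ) + 1))| ≤ 1
      rw [abs_neg]
      exact h p
  · have hs : Summable fun p : ℕ => (1 / ((p : ℝ) + 1)) ^ (m + 2) := by
      have := (summable_nat_add_iff 1).mpr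
        (Real.summable_one_div_nat_pow.mpr (show 1 < m + 2 by omega))
      refine this.congr fun p => ?_
      rw [div_pow, one_pow]
      push_cast
      rfl
    have h := HasSum.of_nat_of_neg_add_one (f := fun i : ℤ => t i ^ 2 * t i ^ m)
      (hs.hasSum.congr_fun fun p => ?_) ((hs.hasSum.mul_left ((-1) ^ (m + 2))).congr_fun fun p => ?_)
    · convert h using 1
      split_ifs with hm
      · rw [hm.neg_one_pow]
        ring
      · rw [(Nat.not_odd_iff_even.mp hm).neg_one_pow]
        ring
    · change (1 / ((p : ℝ) + 1)) ^ 2 * (1 / ((p : ℝ) + 1)) ^ m = _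
      ring
    · have : t (-((p : ℤ) + 1)) = -(1 / ((p : ℝ) + 1)) := by
        rw [← Int.negSucc_eq]
      rw [this, ← pow_add, neg_pow, add_comm]

end FreeInfinitelyDivisible

section Frobenius
variable {m n : Type*} [Fintype m] [Fintype n]

open scoped Matrix.Norms.Frobenius

theorem Matrix.frobenius_norm_sq (M : Matrix m n ℝ) : ‖M‖ ^ 2 = ∑ i, ∑ j, M i j ^ 2 := by
  rw [Matrix.frobenius_norm_def, ← Real.sqrt_eq_rpow, Real.sq_sqrt]
  · simp only [Real.norm_eq_abs, Real.rpow_ofNat, sq_abs]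
  · exact Finset.sum_nonneg fun i _ => Finset.sum_nonneg fun j _ => by positivity

theorem Matrix.abs_trace_mul_le (M : Matrix m n ℝ) (L : Matrix n m ℝ) :
    |(M * L).trace| ≤ ‖M‖ * ‖L‖ := by
  rw [← abs_of_nonneg (mul_nonneg (norm_nonneg M) (norm_nonneg L)), ← sq_le_sq, mul_pow,
    Matrix.frobenius_norm_sq, Matrix.frobenius_norm_sq, Matrix.trace,
    Finset.sum_comm (s := (Finset.univ : Finset n))]
  simp only [Matrix.diag_apply, Matrix.mul_apply]
  simp_rw [← Finset.sum_product']
  exact Finset.sum_mul_sq_le_sq_mul_sq _ (fun p : m × n => M p.1 p.2) (fun p => L p.2 p.1)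

theorem Matrix.abs_trace_pow_le [DecidableEq m] (M : Matrix m m ℝ) (k : ℕ) :
    |(M ^ (k + 2)).trace| ≤ ‖M‖ ^ (k + 2) := by
  rw [pow_succ, pow_succ ‖M‖]
  exact (Matrix.abs_trace_mul_le _ _).trans
    (mul_le_mul_of_nonneg_right (norm_pow_le' M k.succ_pos) (norm_nonneg M))

/-- Multiplication by an orthogonal projection decreases the Frobenius norm. -/
theorem Matrix.norm_one_sub_vecMulVec_mul_le [DecidableEq m] {q : m → ℝ} (hq : ∑ i, q i ^ 2 = 1)
    (M : Matrix m n ℝ) : ‖(1 - Matrix.vecMulVec q q) * M‖ ≤ ‖M‖ := by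
  rw [← pow_le_pow_iff_left₀ (norm_nonneg _) (norm_nonneg _) two_ne_zero,
    Matrix.frobenius_norm_sq, Matrix.frobenius_norm_sq, Finset.sum_comm,
    Finset.sum_comm (f := fun i j => M i j ^ 2)]
  refine Finset.sum_le_sum fun j _ => ?_
  set y := ∑ k, q k * M k j with hy
  have h : ∀ i, ((1 - Matrix.vecMulVec q q) * M : Matrix m n ℝ) i j = M i j - q i * y := by
    intro i
    rw [Matrix.sub_mul, Matrix.one_mul, Matrix.sub_apply, Matrix.mul_apply, hy, Finset.mul_sum]
    simp only [Matrix.vecMulVec_apply, mul_assoc]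
  have h2 : ∑ i, (M i j - q i * y) ^ 2 = ∑ i, M i j ^ 2 - y ^ 2 := by
    have : ∀ i, (M i j - q i * y) ^ 2 = M i j ^ 2 - 2 * y * (q i * M i j) + y ^ 2 * q i ^ 2 :=
      fun i => by ring
    simp_rw [this]
    rw [Finset.sum_add_distrib, Finset.sum_sub_distrib, ← Finset.mul_sum, ← Finset.mul_sum, hq,
      ← hy]
    ring
  simp_rw [h]
  rw [h2]
  linarith [sq_nonneg y]

theorem Matrix.trace_mul_eq_zero_of_isSymm {c Q : Matrix m m ℝ} (hc : c.IsSymm)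
    (hQ : Q.transpose = -Q) : (c * Q).trace = 0 := by
  have h := Matrix.trace_transpose (c * Q)
  rw [Matrix.transpose_mul, hc.eq, hQ, Matrix.neg_mul, Matrix.trace_neg, Matrix.trace_mul_comm] at h
  linarith

end Frobenius

section NormBound
variable {A : Type*} [CStarAlgebra A]

/-- A self-adjoint element is bounded by the growth rate of its free cumulants in a faithful
state. -/
theorem IsFaithful.norm_le_of_freeCumulant {φ : A →ₗ[ℂ] ℂ} (hf : IsFaithful φ) (hφ : IsState φ)
    {a : A} (ha : IsSelfAdjoint a) {r : ℝ} (hr : 0 ≤ r)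
    (h : ∀ n, 0 < n → ‖freeCumulant φ n (fun _ => a)‖ ≤ r ^ n) : ‖a‖ ≤ 4 * r := by
  refine hf.norm_le hφ ha (by positivity) fun n => ?_
  rcases Nat.eq_zero_or_pos n with rfl | hn
  · rw [pow_zero, hφ.map_one, pow_zero, norm_one]
  have h1 := moment_eq_sum_freeCumulant φ hn (fun _ => a)
  rw [List.ofFn_const, List.prod_replicate] at h1
  rw [h1, mul_pow]
  refine (norm_sum_le _ _).trans ?_
  have h2 : ∀ p ∈ nonCrossingPartitions n,
      ‖∏ V ∈ p.parts, freeCumulant φ V.card (fun _ => a)‖ ≤ r ^ n := by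
    intro p _
    rw [norm_prod]
    calc _ ≤ ∏ V ∈ p.parts, r ^ V.card :=
          Finset.prod_le_prod (fun _ _ => norm_nonneg _) fun V hV =>
            h _ (Finset.card_pos.mpr (p.nonempty_of_mem_parts hV))
      _ = r ^ n := by
          rw [Finset.prod_pow_eq_pow_sum, p.sum_card_parts, Finset.card_univ, Fintype.card_fin]
  refine (Finset.sum_le_sum h2).trans ?_
  rw [Finset.sum_const, nsmul_eq_mul]
  refine mul_le_mul_of_nonneg_right ?_ (by positivity)
  exact_mod_cast card_nonCrossingPartitions_le n

variable {ι κ : Type*} [Fintype ι] [Fintype κ]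

theorem quadForm_linear_comb (Q : Matrix κ κ ℂ) (G : Matrix κ ι ℂ) (s : ι → A) :
    quadForm Q (fun j => ∑ i, G j i • s i) = quadForm (G.transpose * Q * G) s := by
  have h1 : ∀ p : κ × κ, (∑ i, G p.1 i • s i) * (∑ i, G p.2 i • s i) =
      ∑ q : ι × ι, (G p.1 q.1 * G p.2 q.2) • (s q.1 * s q.2) := by
    intro p
    rw [Finset.sum_mul_sum, ← Fintype.sum_prod_type']
    exact Finset.sum_congr rfl fun q _ => smul_mul_smul_comm _ _ _ _
  have h2 : ∀ q : ι × ι, (G.transpose * Q * G) q.1 q.2 =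
      ∑ p : κ × κ, Q p.1 p.2 * (G p.1 q.1 * G p.2 q.2) := by
    intro q
    simp only [Matrix.mul_apply, Matrix.transpose_apply, Finset.sum_mul]
    rw [Finset.sum_comm, ← Fintype.sum_prod_type']
    exact Finset.sum_congr rfl fun p _ => by ring
  simp_rw [quadForm, h1, h2, Finset.smul_sum, Finset.sum_smul, smul_smul]
  exact Finset.sum_comm

/-- The free cumulants of an antisymmetric form in linear combinations of a semicircular family. -/
theorem IsWick.freeCumulant_quadForm_linear_comb [DecidableEq ι] [DecidableEq κ]
    {φ : A →ₗ[ℂ] ℂ} (hφ : IsState φ) {s : ι → A}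
    {c : Matrix ι ι ℝ} (h : IsWick φ s (fun i j => (c i j : ℂ))) (hc : c.IsSymm)
    (Q : Matrix κ κ ℝ) (G : Matrix κ ι ℝ) (n : ℕ) :
    freeCumulant φ (n + 1) (fun _ => quadForm ((Complex.I / 2) • Q.map Complex.ofReal)
      (fun j => ∑ i, (G j i : ℂ) • s i)) =
    (Complex.I / 2) ^ (n + 1) * (((G * c * G.transpose * Q) ^ (n + 1)).trace : ℝ) := by
  have h1 := quadForm_linear_comb ((Complex.I / 2) • Q.map Complex.ofReal)
    (G.map Complex.ofReal) s
  simp only [Matrix.map_apply] at h1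
  have h2 := (h.freeCumulant_quadForm (c := c.map Complex.ofReal) hφ (hc.map _))
    ((G.map Complex.ofReal).transpose * ((Complex.I / 2) • Q.map Complex.ofReal) *
      G.map Complex.ofReal) n
  rw [h1, h2]
  have hmap : c.map Complex.ofReal * ((G.map Complex.ofReal).transpose *
      ((Complex.I / 2) • Q.map Complex.ofReal) * G.map Complex.ofReal) =
      (Complex.I / 2) • Complex.ofRealHom.mapMatrix (c * (G.transpose * Q) * G) := by
    rw [Matrix.mul_smul, Matrix.smul_mul, Matrix.mul_smul]
    congr 1
    change _ = (c * (G.transpose * Q) * G).map Complex.ofRealHom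
    rw [Matrix.map_mul, Matrix.map_mul, Matrix.map_mul, Matrix.mul_assoc (c.map _)]
    rfl
  rw [hmap, smul_pow, Matrix.trace_smul, ← map_pow, smul_eq_mul]
  congr 1
  rw [show G * c * G.transpose * Q = G * (c * (G.transpose * Q)) by simp only [Matrix.mul_assoc],
    Matrix.trace_mul_pow_comm G]
  exact (AddMonoidHom.map_trace Complex.ofRealHom
    ((c * (G.transpose * Q) * G) ^ (n + 1))).symm

end NormBound

section Increments

/-- The matrix of the map which sends a sequence to its increments. -/
def incrementMatrix (N : ℕ) : Matrix (Fin N) (Fin (N + 1)) ℝ :=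
  fun j i => (if i = j.succ then 1 else 0) - if i = j.castSucc then 1 else 0

theorem incrementMatrix_mul_mul_transpose_apply {N : ℕ} (c : Matrix (Fin (N + 1)) (Fin (N + 1)) ℝ)
    (j k : Fin N) : (incrementMatrix N * c * (incrementMatrix N).transpose) j k =
      c j.succ k.succ - c j.castSucc k.succ - (c j.succ k.castSucc - c j.castSucc k.castSucc) := by
  simp [Matrix.mul_apply, incrementMatrix, sub_mul, mul_sub, Finset.sum_sub_distrib]

theorem min_increments {e : ℕ → ℝ} (he : Monotone e) (j k : ℕ) :
    min (e (j + 1)) (e (k + 1)) - min (e j) (e (k + 1)) - (min (e (j + 1)) (e k) -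
      min (e j) (e k)) = if j = k then e (j + 1) - e j else 0 := by
  have hj := he (Nat.le_succ j)
  have hk := he (Nat.le_succ k)
  rcases lt_trichotomy j k with h | rfl | h
  · have h1 := he (show j + 1 ≤ k from h)
    rw [if_neg h.ne, min_eq_left (h1.trans hk), min_eq_left (hj.trans (h1.trans hk)),
      min_eq_left h1, min_eq_left (hj.trans h1)]
    ring
  · rw [if_pos rfl, min_self, min_self, min_eq_left hj, min_eq_right hj]
    ring
  · have h1 := he (show k + 1 ≤ j from h)
    rw [if_neg h.ne', min_eq_right (h1.trans hj), min_eq_right h1,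
      min_eq_right (hk.trans (h1.trans hj)), min_eq_right (hk.trans h1)]
    ring

/-- The covariance matrix of the increments of the free Brownian bridge. -/
theorem increment_covariance {e : ℕ → ℝ} (he : Monotone e) {T : ℝ} (hT : 0 < T) (N : ℕ) :
    incrementMatrix N *
        (Matrix.of fun i j : Fin (N + 1) => min (e i) (e j) - e i * e j / T) *
      (incrementMatrix N).transpose =
    Matrix.diagonal (fun j : Fin N => Real.sqrt (e (j + 1) - e j)) *
      (1 - Matrix.vecMulVec (fun j : Fin N => Real.sqrt (e (j + 1) - e j) / Real.sqrt T)
        (fun j : Fin N => Real.sqrt (e (j + 1) - e j) / Real.sqrt T)) *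
      Matrix.diagonal (fun j : Fin N => Real.sqrt (e (j + 1) - e j)) := by
  ext j k
  have hh : ∀ j, 0 ≤ e (j + 1) - e j := fun j => sub_nonneg.mpr (he (Nat.le_succ j))
  rw [incrementMatrix_mul_mul_transpose_apply, Matrix.mul_diagonal, Matrix.diagonal_mul,
    Matrix.sub_apply, Matrix.one_apply, Matrix.vecMulVec_apply]
  have h1 := min_increments he j k
  have h2 : Real.sqrt (e (j + 1) - e j) * (Real.sqrt (e (j + 1) - e j) / Real.sqrt T *
      (Real.sqrt (e (k + 1) - e k) / Real.sqrt T)) * Real.sqrt (e (k + 1) - e k) =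
      (e (j + 1) - e j) * (e (k + 1) - e k) / T := by
    rw [show ∀ a b c : ℝ, a * (a / c * (b / c)) * b = (a * a) * (b * b) / (c * c) from
      fun a b c => by ring, Real.mul_self_sqrt (hh _), Real.mul_self_sqrt (hh _),
      Real.mul_self_sqrt hT.le]
  rw [mul_sub, sub_mul, h2]
  simp only [Fin.val_succ, Fin.val_castSucc, Matrix.of_apply]
  have h3 : (if (j : ℕ) = k then e (j + 1) - e j else 0) =
      Real.sqrt (e (j + 1) - e j) * (if j = k then 1 else 0) * Real.sqrt (e (k + 1) - e k) := by
    by_cases hjk : j = k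
    · subst hjk
      rw [if_pos rfl, if_pos rfl, mul_one, Real.mul_self_sqrt (hh _)]
    · rw [if_neg hjk, if_neg (fun h => hjk (Fin.ext h)), mul_zero, zero_mul]
  rw [← h3, ← h1]
  ring

end Increments

section Bound
variable {A : Type*} [CStarAlgebra A]

open scoped Matrix.Norms.Frobenius

theorem Matrix.frobenius_norm_sq_diagonal_mul_mul_diagonal {N : ℕ} {h : Fin N → ℝ}
    (hh : ∀ j, 0 ≤ h j) (Q : Matrix (Fin N) (Fin N) ℝ) :
    ‖Matrix.diagonal (fun j => Real.sqrt (h j)) * Q *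
      Matrix.diagonal (fun j => Real.sqrt (h j))‖ ^ 2 = ∑ i, ∑ j, Q i j ^ 2 * h i * h j := by
  rw [Matrix.frobenius_norm_sq]
  refine Finset.sum_congr rfl fun i _ => Finset.sum_congr rfl fun j _ => ?_
  rw [Matrix.mul_diagonal, Matrix.diagonal_mul, mul_pow, mul_pow, Real.sq_sqrt (hh i),
    Real.sq_sqrt (hh j)]
  ring

/-- The norm of an antisymmetric form in the increments of a free Brownian bridge. -/
theorem IsFreeBrownianBridge.norm_quadForm_le {φ : A →ₗ[ℂ] ℂ} {T : ℝ} {β : ℝ → A}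
    (hβ : IsFreeBrownianBridge φ T β) (hφ : IsState φ) (hf : IsFaithful φ) (hT : 0 < T) {N : ℕ}
    {e : ℕ → ℝ} (he : Monotone e) (h0 : e 0 = 0) (hN : e N = T) {Q : Matrix (Fin N) (Fin N) ℝ}
    (hQ : Q.transpose = -Q) {D : A} (hD : IsSelfAdjoint D)
    (hDQ : D = quadForm ((Complex.I / 2) • Q.map Complex.ofReal)
      fun j : Fin N => β (e (j + 1)) - β (e j)) {τ : ℝ} (hτ : 0 ≤ τ)
    (hle : ∑ i : Fin N, ∑ j : Fin N, Q i j ^ 2 * (e (i + 1) - e i) * (e (j + 1) - e j) ≤ τ ^ 2) :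
    ‖D‖ ≤ 2 * τ := by
  have htime : ∀ i : Fin (N + 1), e i ∈ Set.Icc 0 T := fun i =>
    ⟨h0 ▸ he (Nat.zero_le _), hN ▸ he (Nat.le_of_lt_succ i.2)⟩
  have hh : ∀ j, 0 ≤ e (j + 1) - e j := fun j => sub_nonneg.mpr (he (Nat.le_succ j))
  set c : Matrix (Fin (N + 1)) (Fin (N + 1)) ℝ :=
    Matrix.of fun i j => min (e i) (e j) - e i * e j / T
    with hc
  have hcs : c.IsSymm := Matrix.IsSymm.ext fun i j => by
    simp only [hc, Matrix.of_apply]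
    rw [min_comm, mul_comm]
  have hW : IsWick φ (fun i : Fin (N + 1) => β (e i)) (fun i j => (c i j : ℂ)) :=
    (hβ.isWick hφ).comp fun i : Fin (N + 1) => (⟨e i, htime i⟩ : Set.Icc (0 : ℝ) T)
  have hinc : (fun j : Fin N => β (e (j + 1)) - β (e j)) =
      fun j => ∑ i : Fin (N + 1), (incrementMatrix N j i : ℂ) • β (e i) := by
    funext j
    simp [incrementMatrix, sub_smul, Finset.sum_sub_distrib]
  set r : Fin N → ℝ := fun j => Real.sqrt (e (j + 1) - e j) with hr
  set q : Fin N → ℝ := fun j => Real.sqrt (e (j + 1) - e j) / Real.sqrt T with hq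
  have hq1 : ∑ j, q j ^ 2 = 1 := by
    simp only [hq, div_pow, Real.sq_sqrt (hh _), Real.sq_sqrt hT.le]
    rw [← Finset.sum_div, Fin.sum_univ_eq_sum_range (fun j => e (j + 1) - e j),
      Finset.sum_range_sub, h0, hN, sub_zero, div_self hT.ne']
  have hcov := increment_covariance he hT N
  have hcum : ∀ n, freeCumulant φ (n + 1) (fun _ => D) = (Complex.I / 2) ^ (n + 1) *
      ((((incrementMatrix N * c * (incrementMatrix N).transpose) * Q) ^ (n + 1)).trace : ℝ) := by
    intro n
    rw [hDQ, hinc]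
    exact hW.freeCumulant_quadForm_linear_comb hφ hcs Q _ n
  have hnorm : ‖(1 - Matrix.vecMulVec q q) * (Matrix.diagonal r * Q * Matrix.diagonal r)‖ ≤ τ := by
    refine (Matrix.norm_one_sub_vecMulVec_mul_le hq1 _).trans ?_
    rw [← pow_le_pow_iff_left₀ (norm_nonneg _) hτ two_ne_zero,
      Matrix.frobenius_norm_sq_diagonal_mul_mul_diagonal fun j : Fin N => hh j]
    exact hle
  have htr : ∀ n, ((((incrementMatrix N * c * (incrementMatrix N).transpose) * Q) ^ (n + 1)).trace)
      = (((1 - Matrix.vecMulVec q q) * (Matrix.diagonal r * Q * Matrix.diagonal r)) ^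
        (n + 1)).trace := by
    intro n
    rw [hcov, Matrix.mul_assoc, Matrix.mul_assoc (Matrix.diagonal r), Matrix.trace_mul_pow_comm]
    simp only [Matrix.mul_assoc]
    rfl
  have hbound : ∀ n, |(((incrementMatrix N * c * (incrementMatrix N).transpose) * Q) ^
      (n + 1)).trace| ≤ τ ^ (n + 1) := by
    intro n
    cases n with
    | zero =>
      rw [zero_add, pow_one, Matrix.trace_mul_eq_zero_of_isSymm _ hQ, abs_zero]
      · positivity
      · rw [Matrix.IsSymm, Matrix.transpose_mul, Matrix.transpose_mul, Matrix.transpose_transpose,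
          hcs.eq, Matrix.mul_assoc]
    | succ n =>
      rw [htr]
      exact (Matrix.abs_trace_pow_le _ n).trans (pow_le_pow_left₀ (norm_nonneg _) hnorm _)
  have h := hf.norm_le_of_freeCumulant hφ hD (r := τ / 2) (by positivity) (fun n hn => by
    obtain ⟨n, rfl⟩ := Nat.exists_eq_succ_of_ne_zero hn.ne'
    rw [Nat.succ_eq_add_one, hcum, norm_mul, norm_pow, Complex.norm_real, Real.norm_eq_abs,
      norm_div, Complex.norm_I, Complex.norm_ofNat, div_pow τ, div_pow (1 : ℝ), one_pow,
      div_mul_eq_mul_div, one_mul]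
    exact div_le_div_of_nonneg_right (hbound n) (by positivity))
  linarith

end Bound

section Refinement
variable {A : Type*} [CStarAlgebra A]

/-- The start of the block of the interval partition `κ 0 ≤ ⋯ ≤ κ n` which contains `j`. -/
def blockStart (κ : ℕ → ℕ) (n j : ℕ) : ℕ :=
  κ (Nat.findGreatest (fun k => κ k ≤ j) n)

theorem blockStart_eq {κ : ℕ → ℕ} (hκ : Monotone κ) {n k j : ℕ} (hk : k < n) (h1 : κ k ≤ j)
    (h2 : j < κ (k + 1)) : blockStart κ n j = κ k := by
  rw [blockStart]
  congr 1
  rw [Nat.findGreatest_eq_iff]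
  exact ⟨hk.le, fun _ => h1, fun i hi _ => not_le.mpr (h2.trans_le (hκ hi))⟩

theorem exists_block {κ : ℕ → ℕ} {n j : ℕ} (h0 : κ 0 ≤ j) (hn : j < κ n) :
    ∃ k < n, κ k ≤ j ∧ j < κ (k + 1) := by
  induction n with
  | zero => omega
  | succ n ih =>
    by_cases h : j < κ n
    · obtain ⟨k, hk, h'⟩ := ih h
      exact ⟨k, hk.trans (Nat.lt_succ_self n), h'⟩
    · exact ⟨n, Nat.lt_succ_self n, not_lt.mp h, hn⟩

theorem sum_blocks {M : Type*} [AddCommMonoid M] {κ : ℕ → ℕ} (hκ : Monotone κ) (h0 : κ 0 = 0)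
    (F : ℕ → M) (n : ℕ) :
    ∑ k ∈ Finset.range n, ∑ j ∈ Finset.Ico (κ k) (κ (k + 1)), F j =
      ∑ j ∈ Finset.range (κ n), F j := by
  induction n with
  | zero => simp [h0]
  | succ n ih =>
    rw [Finset.sum_range_succ, ih, Finset.range_eq_Ico, Finset.range_eq_Ico,
      Finset.sum_Ico_consecutive _ (Nat.zero_le _) (hκ (Nat.le_succ n))]

/-- The coefficients of the difference between a Riemann sum of the Lévy area and that of a coarser
partition, with block starts `π`, in terms of the increments. -/
noncomputable def blockMatrix (π : ℕ → ℕ) (N : ℕ) : Matrix (Fin N) (Fin N) ℝ :=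
  fun i j => (if π j ≤ i ∧ i < j then 1 else 0) - if π i ≤ j ∧ j < i then 1 else 0

theorem blockMatrix_transpose (π : ℕ → ℕ) (N : ℕ) :
    (blockMatrix π N).transpose = -blockMatrix π N := by
  ext i j
  simp [blockMatrix]

theorem sum_sq_blockMatrix_le {π : ℕ → ℕ} {e : ℕ → ℝ} (he : Monotone e) {N : ℕ}
    (hπ : ∀ j, π j ≤ j) {δ : ℝ} (hδ : ∀ j < N, e j - e (π j) ≤ δ) :
    ∑ i : Fin N, ∑ j : Fin N, blockMatrix π N i j ^ 2 * (e (i + 1) - e i) * (e (j + 1) - e j) ≤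
      2 * (δ * (e N - e 0)) := by
  have hh : ∀ j, 0 ≤ e (j + 1) - e j := fun j => sub_nonneg.mpr (he (Nat.le_succ j))
  have h1 : ∑ j : Fin N, ∑ i : Fin N, (if π j ≤ i ∧ i < j then 1 else 0) *
      (e (i + 1) - e i) * (e (j + 1) - e j) ≤ δ * (e N - e 0) := by
    rw [← Finset.sum_range_sub e, ← Fin.sum_univ_eq_sum_range (fun j => e (j + 1) - e j),
      Finset.mul_sum]
    refine Finset.sum_le_sum fun j _ => ?_
    rw [← Finset.sum_mul]
    refine mul_le_mul_of_nonneg_right (le_trans ?_ (hδ j j.2)) (hh _)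
    have h2 : ∀ i : Fin N, (if π j ≤ i ∧ i < j then 1 else 0) * (e (i + 1) - e i) =
        if (i : ℕ) ∈ Finset.Ico (π j) j then e (i + 1) - e i else 0 := fun i => by
      rw [ite_mul, one_mul, zero_mul]
      simp only [Finset.mem_Ico, Fin.lt_def]
    simp_rw [h2]
    rw [Fin.sum_univ_eq_sum_range (fun i => if i ∈ Finset.Ico (π j) j then e (i + 1) - e i else 0),
      ← Finset.sum_filter, Finset.filter_mem_eq_inter, Finset.inter_eq_right.mpr]
    · rw [Finset.sum_Ico_sub e (hπ j)]
    · intro i hi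
      exact Finset.mem_range.mpr ((Finset.mem_Ico.mp hi).2.trans j.2)
  have h2 : ∀ i j : Fin N, blockMatrix π N i j ^ 2 ≤ (if π j ≤ i ∧ i < j then 1 else 0) +
      if π i ≤ j ∧ j < i then 1 else 0 := by
    intro i j
    rw [blockMatrix]
    split_ifs <;> norm_num
  calc _ ≤ ∑ i : Fin N, ∑ j : Fin N, ((if π j ≤ i ∧ i < j then 1 else 0) *
        (e (i + 1) - e i) * (e (j + 1) - e j) + (if π i ≤ j ∧ j < i then 1 else 0) *
        (e (j + 1) - e j) * (e (i + 1) - e i)) := by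
        refine Finset.sum_le_sum fun i _ => Finset.sum_le_sum fun j _ => ?_
        have h3 := mul_le_mul_of_nonneg_right (mul_le_mul_of_nonneg_right (h2 i j) (hh i)) (hh j)
        refine h3.trans_eq ?_
        ring
    _ ≤ _ := by
        simp_rw [Finset.sum_add_distrib]
        rw [Finset.sum_comm, two_mul]
        exact add_le_add h1 h1

/-- The difference between a Riemann sum of the Lévy area and that of a coarser partition. -/
theorem levyAreaSum_sub_levyAreaSum (β : ℝ → A) {e t : ℕ → ℝ} {κ : ℕ → ℕ} (hκ : Monotone κ)
    (h0 : κ 0 = 0) {n : ℕ} (ht : ∀ k ≤ n, t k = e (κ k)) :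
    levyAreaSum β (κ n) e - levyAreaSum β n t =
      quadForm ((Complex.I / 2) • (blockMatrix (blockStart κ n) (κ n)).map Complex.ofReal)
        fun j : Fin (κ n) => β (e (j + 1)) - β (e j) := by
  set Δ : ℕ → A := fun j => β (e (j + 1)) - β (e j) with hΔ
  have h1 : ∀ p q, p ≤ q → β (e q) - β (e p) = ∑ j ∈ Finset.Ico p q, Δ j := fun p q h =>
    (Finset.sum_Ico_sub (fun j => β (e j)) h).symm
  have hπ : ∀ j, blockStart κ n j ≤ j := fun j =>
    Nat.findGreatest_spec (P := fun k => κ k ≤ j) (Nat.zero_le n) (by rw [h0]; exact Nat.zero_le j)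
  have h2 : ∑ k ∈ Finset.range n, (β (t k) * (β (t (k + 1)) - β (t k)) -
      (β (t (k + 1)) - β (t k)) * β (t k)) = ∑ j ∈ Finset.range (κ n),
        (β (e (blockStart κ n j)) * Δ j - Δ j * β (e (blockStart κ n j))) := by
    rw [← sum_blocks hκ h0]
    refine Finset.sum_congr rfl fun k hk => ?_
    have hk := Finset.mem_range.mp hk
    rw [ht k hk.le, ht (k + 1) hk, h1 _ _ (hκ (Nat.le_succ k)), Finset.mul_sum,
      Finset.sum_mul, ← Finset.sum_sub_distrib]
    refine Finset.sum_congr rfl fun j hj => ?_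
    have hj := Finset.mem_Ico.mp hj
    rw [blockStart_eq hκ hk hj.1 hj.2]
  have h3 : ∀ j ∈ Finset.range (κ n), β (e j) * Δ j - Δ j * β (e j) -
      (β (e (blockStart κ n j)) * Δ j - Δ j * β (e (blockStart κ n j))) =
      ∑ i ∈ Finset.range (κ n),
        if blockStart κ n j ≤ i ∧ i < j then Δ i * Δ j - Δ j * Δ i else 0 := by
    intro j hj
    have h4 : ∀ x y z : A, x * z - z * x - (y * z - z * y) = (x - y) * z - z * (x - y) :=
      fun x y z => by noncomm_ring
    rw [h4, h1 _ _ (hπ j), Finset.sum_mul, Finset.mul_sum, ← Finset.sum_sub_distrib,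
      ← Finset.sum_filter]
    refine Finset.sum_congr ?_ fun _ _ => rfl
    ext i
    have := Finset.mem_range.mp hj
    simp only [Finset.mem_Ico, Finset.mem_filter, Finset.mem_range]
    omega
  rw [levyAreaSum, levyAreaSum, h2, ← smul_sub, ← Finset.sum_sub_distrib,
    Finset.sum_congr rfl h3, quadForm, Fintype.sum_prod_type]
  simp only [Matrix.smul_apply, Matrix.map_apply, smul_assoc]
  simp_rw [← Finset.smul_sum]
  congr 1
  simp_rw [Finset.sum_range]
  have h5 : ∀ (p : Prop) [Decidable p] (x y : A), (if p then x - y else 0) =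
      ((if p then 1 else 0 : ℝ) : ℂ) • x - ((if p then 1 else 0 : ℝ) : ℂ) • y := fun p _ x y => by
    split_ifs <;> simp
  simp_rw [h5, blockMatrix, Fin.lt_def, Complex.ofReal_sub, sub_smul, Finset.sum_sub_distrib]
  rw [Finset.sum_comm]

/-- Refining a partition of small mesh changes the Riemann sums of the Lévy area little. -/
theorem IsFreeBrownianBridge.norm_levyAreaSum_sub_le {φ : A →ₗ[ℂ] ℂ} {T : ℝ} {β : ℝ → A}
    (hβ : IsFreeBrownianBridge φ T β) (hφ : IsState φ) (hf : IsFaithful φ) (hT : 0 < T)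
    {e t : ℕ → ℝ} (he : Monotone e) (he0 : e 0 = 0) {κ : ℕ → ℕ} (hκ : Monotone κ) (h0 : κ 0 = 0)
    {n : ℕ} (heT : e (κ n) = T) (ht : ∀ k ≤ n, t k = e (κ k)) {δ : ℝ} (hδ0 : 0 ≤ δ)
    (hδ : ∀ k < n, t (k + 1) - t k ≤ δ) :
    ‖levyAreaSum β (κ n) e - levyAreaSum β n t‖ ≤ 2 * Real.sqrt (2 * (δ * T)) := by
  have hmem : ∀ j ≤ κ n, e j ∈ Set.Icc 0 T := fun j hj =>
    ⟨he0 ▸ he (Nat.zero_le _), heT ▸ he hj⟩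
  have hsa : ∀ j ≤ κ n, IsSelfAdjoint (β (e j)) := fun j hj => hβ.selfAdjoint ⟨_, hmem j hj⟩
  have hπ : ∀ j, blockStart κ n j ≤ j := fun j =>
    Nat.findGreatest_spec (P := fun k => κ k ≤ j) (Nat.zero_le n) (by rw [h0]; exact Nat.zero_le j)
  refine hβ.norm_quadForm_le hφ hf hT he he0 heT (blockMatrix_transpose _ _)
    ((isSelfAdjoint_levyAreaSum hsa).sub (isSelfAdjoint_levyAreaSum fun k hk => ?_))
    (levyAreaSum_sub_levyAreaSum β hκ h0 ht) (Real.sqrt_nonneg _) ?_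
  · rw [ht k hk]
    exact hsa _ (hκ hk)
  · rw [Real.sq_sqrt (by positivity)]
    have h := sum_sq_blockMatrix_le (π := blockStart κ n) he (N := κ n) hπ (δ := δ) fun j hj => ?_
    · rwa [heT, he0, sub_zero] at h
    · obtain ⟨k, hk, h1, h2⟩ := exists_block (h0.trans_le (Nat.zero_le j)) hj
      rw [blockStart_eq hκ hk h1 h2]
      have h3 := hδ k hk
      rw [ht k hk.le, ht (k + 1) hk] at h3
      linarith [he h2.le]

end Refinement

section CommonRefinement

theorem exists_monotone_enumeration {E : Finset ℝ} {a b : ℝ} (ha : a ∈ E) (hb : b ∈ E)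
    (hE : ∀ x ∈ E, x ∈ Set.Icc a b) :
    ∃ (N : ℕ) (e : ℕ → ℝ), Monotone e ∧ e 0 = a ∧ e N = b ∧
      ∀ (n : ℕ) (t : ℕ → ℝ), Monotone t → t 0 = a → t n = b → (∀ k ≤ n, t k ∈ E) →
        ∃ κ : ℕ → ℕ, Monotone κ ∧ κ 0 = 0 ∧ κ n = N ∧ ∀ k ≤ n, t k = e (κ k) := by
  obtain ⟨N, hN⟩ : ∃ N, E.card = N + 1 :=
    Nat.exists_eq_succ_of_ne_zero (Finset.card_ne_zero_of_mem ha)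
  set f := E.orderIsoOfFin hN with hf
  set m : ℕ → Fin (N + 1) := fun j => ⟨min j N, by omega⟩ with hm
  have hm' : ∀ i : Fin (N + 1), m i = i := fun i => Fin.ext (by simp only [hm]; omega)
  have h0 : f.symm ⟨a, ha⟩ = 0 := by
    refine le_antisymm ?_ (Fin.zero_le _)
    rw [f.symm_apply_le]
    exact (hE _ (f 0).2).1
  have h1 : f.symm ⟨b, hb⟩ = Fin.last N := by
    refine le_antisymm (Fin.le_last _) ?_
    rw [f.le_symm_apply]
    exact (hE _ (f (Fin.last N)).2).2
  refine ⟨N, fun j => f (m j), fun i j hij => ?_, ?_, ?_, fun n t ht ht0 htn htE => ?_⟩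
  · refine Subtype.coe_le_coe.mpr (f.monotone ?_)
    exact Fin.mk_le_mk.mpr (min_le_min_right N hij)
  · have : m 0 = 0 := hm' 0
    simp only [this, ← h0, f.apply_symm_apply]
  · have : m N = Fin.last N := hm' (Fin.last N)
    simp only [this, ← h1, f.apply_symm_apply]
  · have hmem : ∀ k, t (min k n) ∈ E := fun k => htE _ (min_le_right k n)
    refine ⟨fun k => f.symm ⟨t (min k n), hmem k⟩, fun i j hij => ?_, ?_, ?_, fun k hk => ?_⟩
    · refine Fin.val_le_of_le (f.symm.monotone ?_)
      exact Subtype.mk_le_mk.mpr (ht (min_le_min_right n hij))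
    · simp [ht0, h0]
    · simp [htn, h1]
    · simp [hm', min_eq_left hk]

end CommonRefinement

section Existence
variable {A : Type*} [CStarAlgebra A]

open Filter Topology

theorem IsFreeBrownianBridge.norm_levyAreaSum_sub_levyAreaSum_le {φ : A →ₗ[ℂ] ℂ} {T : ℝ}
    {β : ℝ → A} (hβ : IsFreeBrownianBridge φ T β) (hφ : IsState φ) (hf : IsFaithful φ)
    (hT : 0 < T) {δ : ℝ} (hδ0 : 0 ≤ δ) {n n' : ℕ} {t t' : ℕ → ℝ} (ht : Monotone t)
    (ht0 : t 0 = 0) (htn : t n = T) (hδ : ∀ k < n, t (k + 1) - t k ≤ δ) (ht' : Monotone t')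
    (ht0' : t' 0 = 0) (htn' : t' n' = T) (hδ' : ∀ k < n', t' (k + 1) - t' k ≤ δ) :
    ‖levyAreaSum β n t - levyAreaSum β n' t'‖ ≤ 4 * Real.sqrt (2 * (δ * T)) := by
  classical
  set E : Finset ℝ := (Finset.range (n + 1)).image t ∪ (Finset.range (n' + 1)).image t' with hE
  have h1 : ∀ k ≤ n, t k ∈ E := fun k hk => Finset.mem_union_left _
    (Finset.mem_image_of_mem t (Finset.mem_range_succ_iff.mpr hk))
  have h2 : ∀ k ≤ n', t' k ∈ E := fun k hk => Finset.mem_union_right _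
    (Finset.mem_image_of_mem t' (Finset.mem_range_succ_iff.mpr hk))
  have h3 : ∀ x ∈ E, x ∈ Set.Icc 0 T := by
    intro x hx
    rcases Finset.mem_union.mp hx with hx | hx
    · obtain ⟨k, hk, rfl⟩ := Finset.mem_image.mp hx
      exact ⟨ht0 ▸ ht (Nat.zero_le k), htn ▸ ht (Finset.mem_range_succ_iff.mp hk)⟩
    · obtain ⟨k, hk, rfl⟩ := Finset.mem_image.mp hx
      exact ⟨ht0' ▸ ht' (Nat.zero_le k), htn' ▸ ht' (Finset.mem_range_succ_iff.mp hk)⟩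
  obtain ⟨N, e, he, he0, heN, hκ⟩ := exists_monotone_enumeration (ht0 ▸ h1 0 (Nat.zero_le n))
    (htn ▸ h1 n le_rfl) h3
  obtain ⟨κ, hκm, hκ0, rfl, hκe⟩ := hκ n t ht ht0 htn h1
  obtain ⟨κ', hκm', hκ0', hκn', hκe'⟩ := hκ n' t' ht' ht0' htn' h2
  have b1 := hβ.norm_levyAreaSum_sub_le hφ hf hT he he0 hκm hκ0 heN hκe hδ0 hδ
  have b2 := hβ.norm_levyAreaSum_sub_le hφ hf hT he he0 hκm' hκ0' (hκn' ▸ heN) hκe' hδ0 hδ'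
  rw [hκn'] at b2
  rw [norm_sub_rev] at b1
  have := norm_sub_le_norm_sub_add_norm_sub (levyAreaSum β n t) (levyAreaSum β (κ n) e)
    (levyAreaSum β n' t')
  linarith

theorem uniform_partition {T : ℝ} (hT : 0 < T) (n : ℕ) :
    Monotone (fun k : ℕ => (k : ℝ) * (T / (n + 1 : ℕ))) ∧
      ((0 : ℕ) : ℝ) * (T / (n + 1 : ℕ)) = 0 ∧ ((n + 1 : ℕ) : ℝ) * (T / (n + 1 : ℕ)) = T ∧
      ∀ k : ℕ, ((k + 1 : ℕ) : ℝ) * (T / (n + 1 : ℕ)) - k * (T / (n + 1 : ℕ)) =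
        T / (n + 1 : ℕ) := by
  have hn : ((n + 1 : ℕ) : ℝ) ≠ 0 := Nat.cast_ne_zero.mpr n.succ_ne_zero
  refine ⟨fun i j hij => ?_, by simp, mul_div_cancel₀ _ hn, fun k => ?_⟩
  · have : (i : ℝ) ≤ j := by exact_mod_cast hij
    exact mul_le_mul_of_nonneg_right this (by positivity)
  · rw [← sub_mul]
    push_cast
    ring

/-- The Lévy area of a free Brownian bridge exists if the state is faithful. -/
theorem IsFreeBrownianBridge.exists_isLevyArea {φ : A →ₗ[ℂ] ℂ} {T : ℝ} {β : ℝ → A}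
    (hβ : IsFreeBrownianBridge φ T β) (hφ : IsState φ) (hf : IsFaithful φ) (hT : 0 < T) :
    ∃ ℓ : A, IsLevyArea β T ℓ := by
  set u : ℕ → A := fun n => levyAreaSum β (n + 1) fun k => k * (T / (n + 1 : ℕ)) with hu
  have hmesh : Tendsto (fun n : ℕ => T / (n + 1 : ℕ)) atTop (𝓝 0) :=
    (tendsto_const_div_atTop_nhds_zero_nat T).comp (tendsto_add_atTop_nat 1)
  have hanti : ∀ {n m : ℕ}, n ≤ m → T / (m + 1 : ℕ) ≤ T / (n + 1 : ℕ) := fun {n m} h => by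
    have : ((n + 1 : ℕ) : ℝ) ≤ (m + 1 : ℕ) := by exact_mod_cast Nat.succ_le_succ h
    exact div_le_div_of_nonneg_left hT.le (by positivity) this
  have hcauchy : CauchySeq u := by
    refine cauchySeq_of_le_tendsto_0 (fun N : ℕ => 4 * Real.sqrt (2 * (T / (N + 1 : ℕ) * T)))
      (fun n m N hn hm => ?_) ?_
    · rw [dist_eq_norm]
      obtain ⟨a1, a2, a3, a4⟩ := uniform_partition hT n
      obtain ⟨b1, b2, b3, b4⟩ := uniform_partition hT m
      exact hβ.norm_levyAreaSum_sub_levyAreaSum_le hφ hf hT (by positivity) a1 a2 a3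
        (fun k _ => (a4 k).trans_le (hanti hn)) b1 b2 b3 (fun k _ => (b4 k).trans_le (hanti hm))
    · have h := (((hmesh.mul_const T).const_mul 2).sqrt).const_mul 4
      simpa using h
  obtain ⟨ℓ, hℓ⟩ := cauchySeq_tendsto_of_complete hcauchy
  refine ⟨ℓ, fun ε hε => ⟨ε ^ 2 / (64 * T), by positivity, fun n t ht ht0 htn hδ => ?_⟩⟩
  have hle : ‖levyAreaSum β n t - ℓ‖ ≤ 4 * Real.sqrt (2 * (ε ^ 2 / (64 * T) * T)) := by
    refine le_of_tendsto ((tendsto_const_nhds.sub hℓ).norm) ?_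
    filter_upwards [hmesh.eventually_le_const (show 0 < ε ^ 2 / (64 * T) by positivity)] with m hm
    obtain ⟨b1, b2, b3, b4⟩ := uniform_partition hT m
    exact hβ.norm_levyAreaSum_sub_levyAreaSum_le hφ hf hT (by positivity) ht ht0 htn
      (fun k hk => (hδ k hk).le) b1 b2 b3 (fun k _ => (b4 k).trans_le hm)
  refine hle.trans_lt ?_
  have : Real.sqrt (2 * (ε ^ 2 / (64 * T) * T)) < ε / 4 := by
    rw [Real.sqrt_lt' (by positivity)]
    field_simp
    norm_num
  linarith

end Existence

theorem IsLevyArea.isSelfAdjoint {A : Type*} [CStarAlgebra A] {β : ℝ → A} {T : ℝ} (hT : 0 < T)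
    (hβ : ∀ t ∈ Set.Icc 0 T, IsSelfAdjoint (β t)) {ℓ : A} (hℓ : IsLevyArea β T ℓ) :
    IsSelfAdjoint ℓ := by
  have h := hℓ.tendsto_uniform hT
  refine tendsto_nhds_unique (h.star.congr fun n => ?_) h
  refine (isSelfAdjoint_levyAreaSum fun k hk => hβ _ ⟨by positivity, ?_⟩).star_eq
  have hn : (0 : ℝ) < (n + 1 : ℕ) := by positivity
  rw [mul_div_left_comm]
  refine mul_le_of_le_one_right hT.le ((div_le_one hn).mpr ?_)
  exact_mod_cast hk

theorem mainTheorem5 {A : Type*} [CStarAlgebra A] (φ : A →ₗ[ℂ] ℂ) (hφ : IsState φ)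
    (β : ℝ → A) (hβ : IsFreeBrownianBridge φ (2 * Real.pi) β) :
    (IsFaithful φ → ∃ ℓ : A, IsLevyArea β (2 * Real.pi) ℓ) ∧
    ∀ ℓ : A, IsLevyArea β (2 * Real.pi) ℓ →
      IsSelfAdjoint ℓ ∧
      (∀ z : ℂ, 0 < ‖z‖ → ‖z‖ < 1 →
        HasSum (fun n : ℕ => PowerSeries.coeff n (rTransform φ ℓ) * z ^ n)
          (1 / z - Real.pi * Complex.cot (Real.pi * z))) ∧
      (∀ m : ℕ, 0 < m → Even m →
        freeCumulant φ m (fun _ => ℓ) = 2 * riemannZeta (m : ℂ)) ∧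
      (∀ m : ℕ, Odd m → freeCumulant φ m (fun _ => ℓ) = 0) ∧
      ∃ μ : Measure ℝ, IsLaw φ ℓ μ ∧ IsFreelyInfinitelyDivisible μ := by
  refine ⟨fun hf => ?_, fun ℓ hℓ => ?_⟩
  · exact hβ.exists_isLevyArea hφ hf Real.two_pi_pos
  · have hsa : IsSelfAdjoint ℓ :=
      hℓ.isSelfAdjoint Real.two_pi_pos fun t ht => hβ.selfAdjoint ⟨t, ht⟩
    refine ⟨hsa, fun z => hℓ.hasSum_rTransform hφ hβ, fun m hm heven => ?_,
      fun m hm => hℓ.freeCumulant_odd hφ hβ hm, ?_⟩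
    · rw [hℓ.freeCumulant_even hφ hβ hm heven, Complex.ofReal_mul, Complex.ofReal_ofNat,
        ofReal_tsum_eq_riemannZeta]
      obtain ⟨r, rfl⟩ := heven
      omega
    · obtain ⟨μ, hμ⟩ := hφ.exists_isLaw hsa
      obtain ⟨t, ht⟩ := isJumpCumulants_int
      refine ⟨μ, hμ, ht.isFreelyInfinitelyDivisible (hμ.hasFreeCumulants hφ fun m hm => ?_)⟩
      split_ifs with h
      · rw [hℓ.freeCumulant_odd hφ hβ h, Complex.ofReal_zero]
      · exact hℓ.freeCumulant_even hφ hβ hm (Nat.not_odd_iff_even.mp h)
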